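/- **Problem.** Let $m,n\ge 1$. Agents $i=1,\dots,m$ minimize $f(x)=\frac1m\sum_{i=1}^m f_i(x)$ over $\mathbb R^n$, where $f_i(x)=\mathbb E[\tilde h_i(x,z(x),\xi_i)]$ and $z(x)$ solves the variational inequality $\mathrm{VI}(\mathcal Z(x),F(x,\cdot))$ in $\mathbb R^p$ with $F(x,z)=\mathbb E[\tilde F(x,z,\zeta)]$. For $\eta>0$ put $h^\eta(x)=\mathbb E[h(x+\eta u)]$, $u$ uniform on the unit ball. $\|\cdot\|$ is the Euclidean (Frobenius) norm; $\bar x$ is the average of $x_1,\dots,x_m$, and $\mathbf x-\mathbf 1\bar x$ is the matrix with rows $x_i-\bar x$. **Assumptions.** (1) $\mathbf w\in\mathbb R^{m\times m}$ is symmetric and doubly stochastic, and its second largest eigenvalue in modulus, $\rho$, is $<1$. (2) The samples $\xi_{i,k}\sim\xi_i$, $v_{i,k}$ (uniform on the sphere $\eta\mathbb S$ of radius $\eta$), the lower-level samples (distributed as $\zeta$) and the initial randomness are mutually independent. (3) $\tilde h_i(x,\cdot,\xi)$ is $\tilde L_0(\xi)$-Lipschitz and $\tilde h_i(\cdot,z(\cdot),\xi)$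 is $L_0(\xi)$-Lipschitz, with $\mathbb E[\tilde L_0(\xi_i)^2]\le\tilde L_0^2$ and $\mathbb E[L_0(\xi_i)^2]\le L_0^2$ for all $i$, $L_0>0$. (4) $F(x,\cdot)$ is $\mu_F$-strongly monotone ($\mu_F>0$) and $L_F$-Lipschitz uniformly in $x$, every $\mathcal Z(x)$ is nonempty, closed and convex, and $\mathbb E\|\tilde F(x,z,\zeta)-F(x,z)\|^2\le\nu^2$ for all $x$ and all $z\in\mathcal Z(x)$. **Algorithm.** With square-integrable random $x_{i,0}$, $$x_{i,k+1}=\sum_j\mathbf w_{ij}x_{j,k}-\gamma y_{i,k},\qquad y_{i,0}=g_{i,0},\qquad y_{i,k+1}=\sum_j\mathbf w_{ij}y_{j,k}+g_{i,k+1}-g_{i,k},$$ $$g_{i,k}=\frac n\eta\Big(\tilde h_i\big(x_{i,k}+v_{i,k},z_{\varepsilon_k}(x_{i,k}+v_{i,k}),\xi_{i,k}\big)-\tilde h_i\big(x_{i,k},z_{\varepsilon_k}(x_{i,k}),\xi_{i,k}\big)\Big)\frac{v_{i,k}}{\|v_{i,k}\|}.$$ Here $z_{\varepsilon_k}(\hat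 x)$ is the last iterate of $z_{t+1}=\Pi_{\mathcal Z(\hat x)}[z_t-\hat\gamma_t\tilde F(\hat x,z_t,\zeta_t)]$, run for the integers $0\le t\le t_k=\sqrt{k+1}$ with $\hat\gamma_t=\hat\gamma/(t+\Gamma)$, $\hat\gamma>\frac1{2\mu_F}$, $\Gamma>0$, from an arbitrary $z_0\in\mathcal Z(\hat x)$ that may depend on all earlier randomness and on the directions $v_{j,k}$ of the current iteration, and has $\mathbb E\|z_0-z(\hat x)\|^2\le D$ in all calls. Let $\underline{\mathbf y}_0=\nabla\mathbf f^\eta(\mathbf x_0)$, $\underline{\mathbf y}_{k+1}=\mathbf w\underline{\mathbf y}_k+\nabla\mathbf f^\eta(\mathbf x_{k+1})-\nabla\mathbf f^\eta(\mathbf x_k)$, where $\nabla\mathbf f^\eta(\mathbf x)$ has rows $\nabla f_i^\eta(x_i)$, and $$\mathbf L(\mathbf x_k)=\mathbb E[f^\eta(\bar x_k)]+\mathbb E\|\mathbf x_k-\mathbf 1\bar x_k\|^2+Q\,\mathbb E\|\underline{\mathbf y}_k-\mathbf 1\underline{\bar y}_k\|^2 .$$ **Constants.** Let $\alpha>0$,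 $0<\beta<\frac23$, $(1+\beta)\rho^2<1$, $Q=\alpha\gamma$, $\gamma=C_0/\sqrt K$, $C_0=\min\{T_1,T_2,T_3\}$, where, with $s=1+\frac1\beta$, $$T_1=\frac{\sqrt{1+16\alpha(1-\frac{3\beta}4)s^2}-1}{\frac{8L_0n\alpha}{\eta}s^2},\quad T_2=\frac{-\sqrt{b^2-4ac}-b}{2a},\quad T_3=\frac{\sqrt{d^2+\frac{16\alpha L_0^2n^2}{\eta^2}s^2(\alpha-(1+\beta)\rho^2\alpha)}-d}{\frac{8L_0^2n^2\alpha}{\eta^2}s^2},$$ $$a=-\frac{4\alpha L_0^2n^2}{\eta^2}s^2\,\frac{2L_0n}{m\eta}\,\frac{(1-\frac{3\beta}2)\eta}{2L_0n}-\frac{2L_0^2n^2}{m\eta^2},\quad c=1-(1+\beta)\rho^2,\quad d=\frac{2L_0n}\eta+3s,$$ $$b=-\frac{L_0^2n^2}{2\beta m\eta^2}+\frac{L_0n(2-\beta)}{m\eta}-\frac{4\alpha L_0^2n^2}{\eta^2}s^2-\frac{\alpha L_0^2n^2}{\eta^2}\rho^2(1+\beta)s .$$ Let also $\theta=\frac{16\tilde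 L_0^2n^2}{\beta\eta^2}$ and $$C_1=2-\frac{3\beta}2-\frac{2L_0n\gamma}\eta-\frac{8QL_0^2n^2\gamma}{\eta^2}s^2,$$ $$C_2=1-\frac{\gamma}{2\beta}\frac{L_0^2n^2}{m\eta^2}-\frac{2L_0n}{m\eta}\Big(-\gamma+\frac{\gamma\beta}2+\frac{L_0n\gamma^2}\eta\Big)-(1+\beta)\rho^2-\frac{4QL_0^2n^2}{\eta^2}s^2-\frac{QL_0^2n^2}{\eta^2}\rho^2(1+\beta)s-\frac{2QL_0n}{m\eta}\frac{4L_0^2n^2\gamma^2}{\eta^2}s^2 .$$ **Theorem.** $C_0>0$, and there is a constant $\kappa\ge0$ that depends only on $m,n,\eta,L_0,\tilde L_0,\rho,\alpha,\beta,\mu_F,L_F,\nu,D,\hat\gamma,\Gamma$ such that the following holds for every integer $K\ge1$ with $K\ge C_0^2(1-\frac{3\beta}2)^{-2}\frac{4L_0^2n^2}{\eta^2}$, every run of the algorithm with $\gamma=C_0/\sqrt K$, and every $\underline{\mathbf L}\in\mathbb R$ with $\mathbf L(\mathbf x_k)\ge\underline{\mathbf L}$ for all $k$. The functions $f_i^\eta$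 and $f^\eta$ are differentiable, the expectations below are finite, $C_1,C_2\ge0$, and $$C_1\,\frac1K\sum_{k=0}^{K-1}\mathbb E\|G_k\|^2+\frac{C_2}{C_0}\,\frac1K\sum_{k=0}^{K-1}\mathbb E\|\mathbf x_k-\mathbf 1\bar x_k\|^2\le\kappa\Big(\frac{\mathbf L(\mathbf x_0)-\underline{\mathbf L}}{C_0}+1\Big)\frac1{\sqrt K}+\frac{\kappa\theta}{K},$$ both for $G_k=\underline{\bar y}_k=\frac1m\sum_i\nabla f_i^\eta(x_{i,k})$ and for $G_k=\nabla f^\eta(\bar x_k)$. Moreover, for every $\epsilon>0$, if in addition $K\ge\kappa\big(\frac{\mathbf L(\mathbf x_0)-\underline{\mathbf L}}{C_0}+1\big)^2\epsilon^{-2}$, then the three averages over $k<K$ of $\mathbb E\|\underline{\bar y}_k\|^2$, $\mathbb E\|\nabla f^\eta(\bar x_k)\|^2$ and $\mathbb E\|\mathbf x_k-\mathbf 1\bar x_k\|^2$ are all at most $\epsilon$; that is, the iteration complexity is $O(\epsilon^{-2})$. -/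

import Mathlib

open MeasureTheory ProbabilityTheory
open scoped ENNReal

noncomputable section

/-- The Euclidean space `ℝⁿ`. -/
abbrev Vec (n : ℕ) : Type := EuclideanSpace ℝ (Fin n)

/-! ### Generic notions -/

/-- `y` is a nearest point of `C` to `u`. -/
def IsNearest {p : ℕ} (C : Set (Vec p)) (u y : Vec p) : Prop :=
  y ∈ C ∧ ∀ w ∈ C, ‖u - y‖ ≤ ‖u - w‖

open Classical in
/-- Euclidean projection onto `C` (the unique nearest point when `C` is nonempty closed convex). -/
def proj {p : ℕ} (C : Set (Vec p)) (u : Vec p) : Vec p :=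
  if h : ∃ y, IsNearest C u y then h.choose else u

/-- `z` solves the variational inequality `VI(C, Φ)`. -/
def IsVISol {p : ℕ} (C : Set (Vec p)) (Φ : Vec p → Vec p) (z : Vec p) : Prop :=
  z ∈ C ∧ ∀ w ∈ C, 0 ≤ inner ℝ (Φ z) (w - z)

/-- The smoothed function `h^η(x) = 𝔼[h(x + η u)]`, `u` uniform on the closed unit ball. -/
def smooth {n : ℕ} (η : ℝ) (h : Vec n → ℝ) (x : Vec n) : ℝ :=
  ⨍ u in Metric.closedBall (0 : Vec n) 1, h (x + η • u)

/-- The uniform distribution on the sphere of radius `η` around the origin. -/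
def sphereLaw (n : ℕ) (η : ℝ) : Measure (Vec n) :=
  Measure.map (fun u : Metric.sphere (0 : Vec n) 1 => η • (u : Vec n))
    (((volume : Measure (Vec n)).toSphere Set.univ)⁻¹ • (volume : Measure (Vec n)).toSphere)

/-- Average of the rows `x₁, …, x_m`. -/
def rowMean {m n : ℕ} (x : Fin m → Vec n) : Vec n := (m : ℝ)⁻¹ • ∑ i, x i

/-- Squared Frobenius distance `‖𝐱 - 𝟏 x̄‖²` of a matrix with rows `xᵢ` from consensus. -/
def consSq {m n : ℕ} (x : Fin m → Vec n) : ℝ := ∑ i, ‖x i - rowMean x‖ ^ 2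

/-- Row `i` of the product `𝐰 𝐱`. -/
def mix {m n : ℕ} (W : Matrix (Fin m) (Fin m) ℝ) (x : Fin m → Vec n) (i : Fin m) : Vec n :=
  ∑ j, W i j • x j

/-- For symmetric doubly stochastic `W`: the second largest eigenvalue in modulus, that is, the
largest modulus of an eigenvalue with an eigenvector orthogonal to the vector of ones
(and `0` if there is no such eigenvalue, i.e. if `m = 1`). -/
def secondEigAbs {m : ℕ} (W : Matrix (Fin m) (Fin m) ℝ) : ℝ :=
  sSup {r : ℝ | ∃ (l : ℝ) (u : Fin m → ℝ),
    u ≠ 0 ∧ ∑ i, u i = 0 ∧ W.mulVec u = l • u ∧ r = |l|}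

/-! ### The problem -/

/-- Data of a distributed stochastic MPEC: local objectives `h̃ᵢ(x, z, ξ)`, laws of the `ξᵢ`,
the sampled lower-level map `F̃(x, z, ζ)`, the law of `ζ`, the lower-level sets `𝒵(x)`. -/
structure MPEC (m n p d : ℕ) where
  h : Fin m → Vec n → Vec p → Vec d → ℝ
  lawξ : Fin m → Measure (Vec d)
  Fs : Vec n → Vec p → Vec d → Vec p
  lawζ : Measure (Vec d)
  Z : Vec n → Set (Vec p)

namespace MPEC

variable {m n p d : ℕ}

/-- The expected lower-level map `F(x, z) = 𝔼[F̃(x, z, ζ)]`. -/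
def F (P : MPEC m n p d) (x : Vec n) (z : Vec p) : Vec p := ∫ s, P.Fs x z s ∂P.lawζ

/-- Local implicit objective `fᵢ(x) = 𝔼[h̃ᵢ(x, z(x), ξᵢ)]`. -/
def fi (P : MPEC m n p d) (z : Vec n → Vec p) (i : Fin m) (x : Vec n) : ℝ :=
  ∫ s, P.h i x (z x) s ∂P.lawξ i

/-- Global implicit objective `f = (1/m) ∑ fᵢ`. -/
def f (P : MPEC m n p d) (z : Vec n → Vec p) (x : Vec n) : ℝ :=
  (m : ℝ)⁻¹ * ∑ i, P.fi z i x

/-- Standing conventions: the laws are probabilities, all the maps are measurable, and the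
expectations that define `F` and `fᵢ` exist. -/
structure WellPosed (P : MPEC m n p d) (z : Vec n → Vec p) : Prop where
  prob_ξ : ∀ i, IsProbabilityMeasure (P.lawξ i)
  prob_ζ : IsProbabilityMeasure P.lawζ
  meas_h : ∀ i, Measurable fun q : Vec n × Vec p × Vec d => P.h i q.1 q.2.1 q.2.2
  meas_F : Measurable fun q : Vec n × Vec p × Vec d => P.Fs q.1 q.2.1 q.2.2
  meas_proj : Measurable fun q : Vec n × Vec p => proj (P.Z q.1) q.2
  int_F : ∀ x z', Integrable (P.Fs x z') P.lawζ
  int_h : ∀ i x, Integrable (P.h i x (z x)) (P.lawξ i)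

/-- The upper-level Lipschitz assumption, with random moduli whose root mean squares are at most
`Lt` (in the lower-level variable) and `L` (for the implicit objective). -/
structure UpperLipschitz (P : MPEC m n p d) (z : Vec n → Vec p) (Lt L : ℝ) : Prop where
  lower_var : ∃ l : Fin m → Vec d → ℝ, (∀ i, Measurable (l i)) ∧
    (∀ i x z₁ z₂ s, |P.h i x z₁ s - P.h i x z₂ s| ≤ l i s * ‖z₁ - z₂‖) ∧
    ∀ i, ∫⁻ s, ‖l i s‖ₑ ^ 2 ∂P.lawξ i ≤ ENNReal.ofReal (Lt ^ 2)
  implicit : ∃ l : Fin m → Vec d → ℝ, (∀ i, Measurable (l i)) ∧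
    (∀ i x₁ x₂ s, |P.h i x₁ (z x₁) s - P.h i x₂ (z x₂) s| ≤ l i s * ‖x₁ - x₂‖) ∧
    ∀ i, ∫⁻ s, ‖l i s‖ₑ ^ 2 ∂P.lawξ i ≤ ENNReal.ofReal (L ^ 2)

/-- The lower-level assumption: `F(x, ·)` is `μF`-strongly monotone and `LF`-Lipschitz uniformly
in `x`, the sets `𝒵(x)` are nonempty closed convex, and the samples of `F` have variance at
most `ν²`. -/
structure LowerMonotone (P : MPEC m n p d) (μF LF ν : ℝ) : Prop where
  strong_mono : ∀ x z₁ z₂, μF * ‖z₁ - z₂‖ ^ 2 ≤ inner ℝ (P.F x z₁ - P.F x z₂) (z₁ - z₂)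
  lipschitz : ∀ x z₁ z₂, ‖P.F x z₁ - P.F x z₂‖ ≤ LF * ‖z₁ - z₂‖
  nonempty : ∀ x, (P.Z x).Nonempty
  closed : ∀ x, IsClosed (P.Z x)
  convex : ∀ x, Convex ℝ (P.Z x)
  variance : ∀ x, ∀ z' ∈ P.Z x,
    ∫⁻ s, ‖P.Fs x z' s - P.F x z'‖ₑ ^ 2 ∂P.lawζ ≤ ENNReal.ofReal (ν ^ 2)

/-- The local zeroth-order gradient estimator `ĝᵢ(x, v, z₁, z₂, ξ)`. -/
def gHat (P : MPEC m n p d) (η : ℝ) (i : Fin m) (x v : Vec n) (z₁ z₂ : Vec p) (s : Vec d) :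
    Vec n :=
  ((n : ℝ) * (P.h i (x + v) z₂ s - P.h i x z₁ s) / η) • (‖v‖⁻¹ • v)

/-- The iterates of the lower-level stochastic approximation at the upper-level point `x`, from
`z₀`, with the samples `ζ₀, ζ₁, …` and the stepsizes `γ̂_t = γ̂ / (t + Γ)`. -/
def lowerIter (P : MPEC m n p d) (γh Γ : ℝ) (x : Vec n) (z₀ : Vec p) (ζ : ℕ → Vec d) :
    ℕ → Vec p
  | 0 => z₀
  | t + 1 => proj (P.Z x) (lowerIter P γh Γ x z₀ ζ t
      - (γh / ((t : ℝ) + Γ)) • P.Fs x (lowerIter P γh Γ x z₀ ζ t) (ζ t))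

/-- The inexact lower-level solution of upper-level iteration `k`: the output of the loop over
the integers `t` with `0 ≤ t ≤ √(k+1)`. -/
def lowerSol (P : MPEC m n p d) (γh Γ : ℝ) (k : ℕ) (x : Vec n) (z₀ : Vec p) (ζ : ℕ → Vec d) :
    Vec p :=
  P.lowerIter γh Γ x z₀ ζ (Nat.sqrt (k + 1) + 1)

end MPEC

/-! ### The samples -/

/-- The random inputs: samples `ξ i k`, `v i k`, and the lower-level samples `ζ i k b t` of agent
`i` in iteration `k`, where `b = false` is the call at `x_{i,k}` and `b = true` the call at
`x_{i,k} + v_{i,k}`; `initσ` is the σ-algebra of the initial randomness. -/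
structure Samples (Ω : Type*) (m n d : ℕ) where
  initσ : MeasurableSpace Ω
  ξ : Fin m → ℕ → Ω → Vec d
  v : Fin m → ℕ → Ω → Vec n
  ζ : Fin m → ℕ → Bool → ℕ → Ω → Vec d

/-- Labels of the sources of randomness. -/
inductive Source (m : ℕ) : Type
  | init : Source m
  | xi : Fin m → ℕ → Source m
  | dir : Fin m → ℕ → Source m
  | zeta : Fin m → ℕ → Bool → ℕ → Source m

/-- The sources that have been revealed before the lower-level calls of iteration `k` (the
initial randomness, everything of earlier iterations, the directions `v_{i,k}`). -/
def Source.knownAt {m : ℕ} (k : ℕ) : Source m → Prop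
  | .init => True
  | .xi _ l => l < k
  | .dir _ l => l ≤ k
  | .zeta _ l _ _ => l < k

namespace Samples

variable {Ω : Type*} {m n p d : ℕ}

/-- The σ-algebra generated by each source. -/
@[reducible] def sigma (S : Samples Ω m n d) : Source m → MeasurableSpace Ω
  | .init => S.initσ
  | .xi i k => MeasurableSpace.comap (S.ξ i k) inferInstance
  | .dir i k => MeasurableSpace.comap (S.v i k) inferInstance
  | .zeta i k b t => MeasurableSpace.comap (S.ζ i k b t) inferInstance

/-- The information available when the lower-level calls of iteration `k` are made. -/
@[reducible] def known (S : Samples Ω m n d) (k : ℕ) : MeasurableSpace Ω :=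
  ⨆ (s : Source m) (_ : s.knownAt k), S.sigma s

/-- The sampling assumption: `ξ_{i,k}` has the law of `ξᵢ`, `v_{i,k}` is uniform on `η 𝕊`, the
lower-level samples have the law of `ζ`, and all samples and the initial randomness are
mutually independent. -/
structure IsIID [mΩ : MeasurableSpace Ω] (S : Samples Ω m n d) (μ : Measure Ω)
    (P : MPEC m n p d) (η : ℝ) : Prop where
  init_le : S.initσ ≤ mΩ
  meas_ξ : ∀ i k, Measurable (S.ξ i k)
  meas_v : ∀ i k, Measurable (S.v i k)
  meas_ζ : ∀ i k b t, Measurable (S.ζ i k b t)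
  law_ξ : ∀ i k, Measure.map (S.ξ i k) μ = P.lawξ i
  law_v : ∀ i k, Measure.map (S.v i k) μ = sphereLaw n η
  law_ζ : ∀ i k b t, Measure.map (S.ζ i k b t) μ = P.lawζ
  indep : iIndep S.sigma μ

end Samples

/-! ### The algorithm -/

/-- The random variables of a run: iterates `x`, trackers `y`, inexact gradients `g`, and the
starting points `z₀` of the two lower-level calls of each agent in each iteration. -/
structure Run (Ω : Type*) (m n p : ℕ) where
  x : ℕ → Fin m → Ω → Vec n
  y : ℕ → Fin m → Ω → Vec n
  g : ℕ → Fin m → Ω → Vec n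
  z₀ : ℕ → Fin m → Bool → Ω → Vec p

namespace Run

variable {Ω : Type*} {m n p d : ℕ}

/-- The point at which a lower-level call is made: `x_{i,k}` or `x_{i,k} + v_{i,k}`. -/
def query (R : Run Ω m n p) (S : Samples Ω m n d) (k : ℕ) (i : Fin m) (b : Bool) (ω : Ω) :
    Vec n :=
  if b then R.x k i ω + S.v i k ω else R.x k i ω

/-- The result of a lower-level call. -/
def lowerOut (R : Run Ω m n p) (P : MPEC m n p d) (S : Samples Ω m n d) (γh Γ : ℝ)
    (k : ℕ) (i : Fin m) (b : Bool) (ω : Ω) : Vec p :=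
  P.lowerSol γh Γ k (R.query S k i b ω) (R.z₀ k i b ω) (fun t => S.ζ i k b t ω)

/-- `R` is a run of the gradient tracking method with weights `W`, stepsize `γ`, smoothing
parameter `η` and lower-level stepsize parameters `γh`, `Γ`. The random initial points are
square integrable; each lower-level call starts at an arbitrary point of the feasible set that
may depend on the information available at that time, within mean squared distance `D` of the
solution. -/
structure IsRun [MeasurableSpace Ω] (R : Run Ω m n p) (μ : Measure Ω) (P : MPEC m n p d)
    (z : Vec n → Vec p) (S : Samples Ω m n d) (W : Matrix (Fin m) (Fin m) ℝ)
    (γ η γh Γ D : ℝ) : Prop where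
  init_meas : ∀ i, Measurable[S.initσ] (R.x 0 i)
  init_sq : ∀ i, MemLp (R.x 0 i) 2 μ
  start_mem : ∀ k i b ω, R.z₀ k i b ω ∈ P.Z (R.query S k i b ω)
  start_meas : ∀ k i b, Measurable[S.known k] (R.z₀ k i b)
  start_dist : ∀ k i b,
    ∫⁻ ω, ‖R.z₀ k i b ω - z (R.query S k i b ω)‖ₑ ^ 2 ∂μ ≤ ENNReal.ofReal D
  g_eq : ∀ k i ω, R.g k i ω = P.gHat η i (R.x k i ω) (S.v i k ω)
    (R.lowerOut P S γh Γ k i false ω) (R.lowerOut P S γh Γ k i true ω) (S.ξ i k ω)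
  y_zero : ∀ i ω, R.y 0 i ω = R.g 0 i ω
  x_succ : ∀ k i ω, R.x (k + 1) i ω = mix W (fun j => R.x k j ω) i - γ • R.y k i ω
  y_succ : ∀ k i ω,
    R.y (k + 1) i ω = mix W (fun j => R.y k j ω) i + R.g (k + 1) i ω - R.g k i ω

/-- Row `i` of `∇𝐟^η(𝐱_k)`, the exact gradient `∇fᵢ^η(x_{i,k})`. -/
def gradRow (R : Run Ω m n p) (P : MPEC m n p d) (z : Vec n → Vec p) (η : ℝ) (k : ℕ) (ω : Ω)
    (i : Fin m) : Vec n :=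
  gradient (smooth η (P.fi z i)) (R.x k i ω)

/-- The auxiliary trackers, driven by the exact gradients of the smoothed objectives. -/
def yU (R : Run Ω m n p) (P : MPEC m n p d) (z : Vec n → Vec p)
    (W : Matrix (Fin m) (Fin m) ℝ) (η : ℝ) : ℕ → Ω → Fin m → Vec n
  | 0, ω => R.gradRow P z η 0 ω
  | k + 1, ω => fun i => mix W (yU R P z W η k ω) i + R.gradRow P z η (k + 1) ω i
      - R.gradRow P z η k ω i

/-- `‖x_k - 𝟏 x̄_k‖²`, the consensus violation. -/
def cons (R : Run Ω m n p) (k : ℕ) (ω : Ω) : ℝ := consSq fun i => R.x k i ω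

/-- `‖∇f^η(x̄_k)‖²`. -/
def gradSq (R : Run Ω m n p) (P : MPEC m n p d) (z : Vec n → Vec p) (η : ℝ) (k : ℕ) (ω : Ω) :
    ℝ :=
  ‖gradient (smooth η (P.f z)) (rowMean fun i => R.x k i ω)‖ ^ 2

/-- Squared norm of the average of the auxiliary trackers. -/
def yUMeanSq (R : Run Ω m n p) (P : MPEC m n p d) (z : Vec n → Vec p)
    (W : Matrix (Fin m) (Fin m) ℝ) (η : ℝ) (k : ℕ) (ω : Ω) : ℝ :=
  ‖rowMean (R.yU P z W η k ω)‖ ^ 2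

/-- The Lyapunov function `𝐋(𝐱_k)` with weight `Q`. -/
def lyap [MeasurableSpace Ω] (R : Run Ω m n p) (μ : Measure Ω) (P : MPEC m n p d)
    (z : Vec n → Vec p) (W : Matrix (Fin m) (Fin m) ℝ) (η Q : ℝ) (k : ℕ) : ℝ :=
  ∫ ω, smooth η (P.f z) (rowMean fun i => R.x k i ω) ∂μ + ∫ ω, R.cons k ω ∂μ
    + Q * ∫ ω, consSq (R.yU P z W η k ω) ∂μ

end Run

/-- `(1/K) ∑_{k<K} 𝔼[q_k]`. -/
def avgE {Ω : Type*} [MeasurableSpace Ω] (μ : Measure Ω) (K : ℕ) (q : ℕ → Ω → ℝ) : ℝ :=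
  (K : ℝ)⁻¹ * ∑ k ∈ Finset.range K, ∫ ω, q k ω ∂μ

/-! ### Constants -/

/-- The scalars of the analysis. -/
structure Consts where
  (η L Lt ρ α β μF LF ν D γh Γ : ℝ)

namespace Consts

/-- The ranges of the scalars; `(1 + β) ρ² < 1` is `β < ρ⁻² - 1`, also when `ρ = 0`. -/
structure Admissible (c : Consts) : Prop where
  η_pos : 0 < c.η
  L_pos : 0 < c.L
  Lt_nonneg : 0 ≤ c.Lt
  ρ_lt : c.ρ < 1
  α_pos : 0 < c.α
  β_pos : 0 < c.β
  β_lt : c.β < 2 / 3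
  β_ρ : (1 + c.β) * c.ρ ^ 2 < 1
  μF_pos : 0 < c.μF
  γh_gt : 1 / (2 * c.μF) < c.γh
  Γ_pos : 0 < c.Γ

variable (c : Consts) (m n : ℕ)

def T₁ : ℝ :=
  (√(1 + 16 * c.α * (1 - 3 * c.β / 4) * (1 + 1 / c.β) ^ 2) - 1)
    / (8 * c.L * n * c.α / c.η * (1 + 1 / c.β) ^ 2)

def a : ℝ :=
  -(4 * c.α * c.L ^ 2 * n ^ 2 / c.η ^ 2) * (1 + 1 / c.β) ^ 2 * (2 * c.L * n / (m * c.η))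
      * ((1 - 3 * c.β / 2) * c.η / (2 * c.L * n))
    - 2 * c.L ^ 2 * n ^ 2 / (m * c.η ^ 2)

def b : ℝ :=
  -(c.L ^ 2 * n ^ 2 / (2 * c.β * m * c.η ^ 2)) + c.L * n * (2 - c.β) / (m * c.η)
    - 4 * c.α * c.L ^ 2 * n ^ 2 / c.η ^ 2 * (1 + 1 / c.β) ^ 2
    - c.α * c.L ^ 2 * n ^ 2 / c.η ^ 2 * c.ρ ^ 2 * (1 + c.β) * (1 + 1 / c.β)

def cc : ℝ := 1 - (1 + c.β) * c.ρ ^ 2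

/-- The positive root of `a γ² + b γ + cc` (note `a < 0 < cc`). -/
def T₂ : ℝ :=
  (-√(c.b m n ^ 2 - 4 * c.a m n * c.cc) - c.b m n) / (2 * c.a m n)

def dd : ℝ := 2 * c.L * n / c.η + 3 * (1 + 1 / c.β)

def T₃ : ℝ :=
  (√(c.dd n ^ 2 + 16 * c.α * c.L ^ 2 * n ^ 2 / c.η ^ 2 * (1 + 1 / c.β) ^ 2
        * (c.α - (1 + c.β) * c.ρ ^ 2 * c.α)) - c.dd n)
    / (8 * c.L ^ 2 * n ^ 2 * c.α / c.η ^ 2 * (1 + 1 / c.β) ^ 2)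

def C₀ : ℝ := min (c.T₁ n) (min (c.T₂ m n) (c.T₃ n))

/-- The stepsize `γ = C₀ / √K`. -/
def γ (K : ℕ) : ℝ := c.C₀ m n / √(K : ℝ)

/-- The Lyapunov weight `Q = α γ`. -/
def Q (K : ℕ) : ℝ := c.α * c.γ m n K

/-- The weight `C₁` at stepsize `γ`, with `Q = α γ`. -/
def C₁ (K : ℕ) : ℝ :=
  2 - 3 * c.β / 2 - 2 * c.L * n * c.γ m n K / c.η
    - 8 * c.Q m n K * c.L ^ 2 * n ^ 2 * c.γ m n K / c.η ^ 2 * (1 + 1 / c.β) ^ 2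

/-- The weight `C₂` at stepsize `γ`, with `Q = α γ`. -/
def C₂ (K : ℕ) : ℝ :=
  1 - c.γ m n K / (2 * c.β) * (c.L ^ 2 * n ^ 2 / (m * c.η ^ 2))
    - 2 * c.L * n / (m * c.η)
      * (-c.γ m n K + c.γ m n K * c.β / 2 + c.L * n * c.γ m n K ^ 2 / c.η)
    - (1 + c.β) * c.ρ ^ 2
    - 4 * c.Q m n K * c.L ^ 2 * n ^ 2 / c.η ^ 2 * (1 + 1 / c.β) ^ 2
    - c.Q m n K * c.L ^ 2 * n ^ 2 / c.η ^ 2 * c.ρ ^ 2 * (1 + c.β) * (1 + 1 / c.β)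
    - 2 * c.Q m n K * c.L * n / (m * c.η)
      * (4 * c.L ^ 2 * n ^ 2 * c.γ m n K ^ 2 / c.η ^ 2) * (1 + 1 / c.β) ^ 2

/-- The factor of the lower-level error. -/
def θ : ℝ := 4 / c.β * (4 * c.Lt ^ 2 * n ^ 2 / c.η ^ 2)

/-- `K` is large enough (this says `γ ≤ (1 - 3β/2) η / (2 L n)`). -/
def LargeK (K : ℕ) : Prop :=
  1 ≤ K ∧ c.C₀ m n ^ 2 * ((1 - 3 * c.β / 2) ^ 2)⁻¹ * (4 * c.L ^ 2 * n ^ 2 / c.η ^ 2) ≤ K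

end Consts

end

-- The constant κ may depend on every scalar of the problem but not on K or on the run. So it
-- suffices to bound each of the three averages (squared mean tracker, squared gradient at the mean,
-- consensus error) by a constant times (Δ/C₀ + 1)/√K, where Δ is the initial Lyapunov gap. The
-- weighted inequalities follow because C₁ ≤ 2 and C₂/C₀ are bounded (`C₁_le`, `C₂_le`), and the θ/K
-- term is nonnegative slack. Nonnegativity of C₀, C₁, C₂ is algebra: T₁ and T₂ are roots of
-- quadratics in γ.
--
-- Four facts carry the averages. (i) Smoothing: for Lipschitz h the function h^η has the gradient
-- `sphereGrad`, by the divergence theorem on the ball (`integral_ball_lineDeriv`,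
-- `hasGradientAt_smooth`). This gradient is bounded and Lipschitz, and the estimator with exact
-- lower-level solutions is unbiased for it (`integral_inner_exactG`). (ii) Lower level: projected
-- stochastic approximation with steps γ̂/(t+Γ) has mean squared error O(1/t) (`exists_saBound_le`).
-- About √(k+1) steps therefore give the estimator a mean squared error O(1/√(k+1)) relative to the
-- exact one (`g_sub_exactG_moments`), and these errors sum to O(√K). (iii) Consensus: mixing
-- shrinks disagreement by ρ² in square (`consSq_mix_le`). Gradients with bounded second moments
-- thus keep the trackers at bounded mean squared distance from consensus (`tracking_bound`), and
-- the consensus error X_k of the iterates satisfies X_{k+1} ≤ q X_k + O(γ²) with q = (1+β)ρ² < 1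
-- (`integral_cons_succ_le`). (iv) Descent: the expected smoothed objective at the mean iterate
-- falls by multiples of γ times both squared gradients, up to γ X_k, γ/√(k+1) and γ²
-- (`integral_smooth_succ_le`).
--
-- These recursions are summed in `exists_average_bound`. The lower bound on the Lyapunov function
-- is needed only at k = 0, where it gives Δ ≥ 0, at k = 1, where with the contraction it bounds X_0
-- by Δ, and at k = K, where it bounds the total drop of the objective.

noncomputable section

-- Signs and sizes of the scalar constants.

namespace Consts

variable {c : Consts} {m n : ℕ}

lemma Admissible.one_sub_pos (hc : c.Admissible) : 0 < 1 - 3 * c.β / 2 := by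
  linarith [hc.β_lt]

lemma Admissible.cc_pos (hc : c.Admissible) : 0 < c.cc := by
  have := hc.β_ρ
  unfold cc; linarith

lemma Admissible.sq_fac_pos (hc : c.Admissible) : 0 < 1 + 1 / c.β := by
  have := hc.β_pos
  positivity

lemma T₁_pos (hn : 0 < n) (hc : c.Admissible) : 0 < c.T₁ n := by
  have h1 := hc.η_pos; have h2 := hc.L_pos; have h3 := hc.α_pos
  have h4 := hc.sq_fac_pos; have h5 := hc.β_lt
  have hn' : (0 : ℝ) < n := Nat.cast_pos.2 hn
  unfold T₁
  refine div_pos ?_ (by positivity)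
  have : 0 < 1 - 3 * c.β / 4 := by linarith
  have h : (1 : ℝ) < √(1 + 16 * c.α * (1 - 3 * c.β / 4) * (1 + 1 / c.β) ^ 2) := by
    apply Real.lt_sqrt_of_sq_lt
    have : 0 < 16 * c.α * (1 - 3 * c.β / 4) * (1 + 1 / c.β) ^ 2 := by positivity
    linarith
  linarith

lemma a_neg (hm : 0 < m) (hn : 0 < n) (hc : c.Admissible) : c.a m n < 0 := by
  have h1 := hc.η_pos; have h2 := hc.L_pos; have h3 := hc.α_pos
  have h4 := hc.sq_fac_pos; have h5 := hc.one_sub_pos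
  have hn' : (0 : ℝ) < n := Nat.cast_pos.2 hn
  have hm' : (0 : ℝ) < m := Nat.cast_pos.2 hm
  have e1 : 0 < (4 * c.α * c.L ^ 2 * n ^ 2 / c.η ^ 2) * (1 + 1 / c.β) ^ 2
      * (2 * c.L * n / (m * c.η)) * ((1 - 3 * c.β / 2) * c.η / (2 * c.L * n)) := by positivity
  have e2 : 0 < 2 * c.L ^ 2 * n ^ 2 / (m * c.η ^ 2) := by positivity
  unfold a
  linarith

lemma sqrt_disc_gt (hm : 0 < m) (hn : 0 < n) (hc : c.Admissible) :
    |c.b m n| < √(c.b m n ^ 2 - 4 * c.a m n * c.cc) := by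
  rw [← Real.sqrt_sq_eq_abs]
  apply Real.sqrt_lt_sqrt (sq_nonneg _)
  nlinarith [mul_pos_of_neg_of_neg (a_neg hm hn hc) (neg_lt_zero.2 hc.cc_pos)]

lemma T₂_pos (hm : 0 < m) (hn : 0 < n) (hc : c.Admissible) : 0 < c.T₂ m n := by
  unfold T₂
  apply div_pos_of_neg_of_neg
  · linarith [sqrt_disc_gt hm hn hc, neg_abs_le (c.b m n)]
  · linarith [a_neg hm hn hc]

lemma T₃_pos (hn : 0 < n) (hc : c.Admissible) : 0 < c.T₃ n := by
  have h1 := hc.η_pos; have h2 := hc.L_pos; have h3 := hc.α_pos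
  have h4 := hc.sq_fac_pos; have h5 := hc.β_ρ
  have hn' : (0 : ℝ) < n := Nat.cast_pos.2 hn
  unfold T₃
  refine div_pos ?_ (by positivity)
  have h6 : 0 < c.α - (1 + c.β) * c.ρ ^ 2 * c.α := by nlinarith
  have : 0 < 16 * c.α * c.L ^ 2 * n ^ 2 / c.η ^ 2 * (1 + 1 / c.β) ^ 2
        * (c.α - (1 + c.β) * c.ρ ^ 2 * c.α) := by positivity
  have : √(c.dd n ^ 2) < √(c.dd n ^ 2 + 16 * c.α * c.L ^ 2 * n ^ 2 / c.η ^ 2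
      * (1 + 1 / c.β) ^ 2 * (c.α - (1 + c.β) * c.ρ ^ 2 * c.α)) :=
    Real.sqrt_lt_sqrt (sq_nonneg _) (by linarith)
  rw [Real.sqrt_sq_eq_abs] at this
  linarith [le_abs_self (c.dd n)]

lemma C₀_pos (hm : 0 < m) (hn : 0 < n) (hc : c.Admissible) : 0 < c.C₀ m n :=
  lt_min (T₁_pos hn hc) (lt_min (T₂_pos hm hn hc) (T₃_pos hn hc))

lemma γ_pos (hm : 0 < m) (hn : 0 < n) (hc : c.Admissible) {K : ℕ} (hK : 1 ≤ K) :
    0 < c.γ m n K :=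
  div_pos (C₀_pos hm hn hc) (Real.sqrt_pos.2 (by exact_mod_cast hK))

lemma γ_le_C₀ (hm : 0 < m) (hn : 0 < n) (hc : c.Admissible) {K : ℕ} (hK : 1 ≤ K) :
    c.γ m n K ≤ c.C₀ m n :=
  div_le_self (C₀_pos hm hn hc).le (Real.one_le_sqrt.2 (by exact_mod_cast hK))

lemma γ_le_of_largeK (hm : 0 < m) (hn : 0 < n) (hc : c.Admissible) {K : ℕ}
    (hK : c.LargeK m n K) : c.γ m n K ≤ (1 - 3 * c.β / 2) * c.η / (2 * c.L * n) := by
  have h1 := hc.η_pos; have h2 := hc.L_pos; have h5 := hc.one_sub_pos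
  have hn' : (0 : ℝ) < n := Nat.cast_pos.2 hn
  have hK0 : (0 : ℝ) < K := by exact_mod_cast hK.1
  have h := hK.2
  unfold γ
  rw [div_le_iff₀ (Real.sqrt_pos.2 hK0)]
  have hC := C₀_pos hm hn hc
  set A := (1 - 3 * c.β / 2) * c.η / (2 * c.L * n) with hA
  have hA0 : 0 < A := by positivity
  have e : c.C₀ m n ^ 2 * ((1 - 3 * c.β / 2) ^ 2)⁻¹ * (4 * c.L ^ 2 * n ^ 2 / c.η ^ 2)
      = (c.C₀ m n / A) ^ 2 := by
    rw [hA]; field_simp; ring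
  rw [e] at h
  have := Real.le_sqrt_of_sq_le h
  rwa [div_le_iff₀ hA0, mul_comm] at this

/-- With Q = αγ, C₁ is a concave quadratic in γ whose positive root is T₁, so γ ≤ C₀ ≤ T₁ suffices.
-/
lemma C₁_nonneg (hm : 0 < m) (hn : 0 < n) (hc : c.Admissible) {K : ℕ}
    (hK : c.LargeK m n K) : 0 ≤ c.C₁ m n K := by
  have h1 := hc.η_pos; have h2 := hc.L_pos; have h3 := hc.α_pos
  have h4 := hc.sq_fac_pos; have h5 := hc.β_lt
  have hn' : (0 : ℝ) < n := Nat.cast_pos.2 hn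
  have hγ0 := γ_pos hm hn hc hK.1
  have hγ : c.γ m n K ≤ c.T₁ n := (γ_le_C₀ hm hn hc hK.1).trans (min_le_left _ _)
  unfold T₁ at hγ
  rw [le_div_iff₀ (by positivity)] at hγ
  unfold C₁ Q
  set g := c.γ m n K
  set s := 1 + 1 / c.β
  have h7 : 0 ≤ 1 + 16 * c.α * (1 - 3 * c.β / 4) * s ^ 2 := by
    have : 0 < 1 - 3 * c.β / 4 := by linarith
    positivity
  have h8 : g * (8 * c.L * n * c.α / c.η * s ^ 2) + 1
      ≤ √(1 + 16 * c.α * (1 - 3 * c.β / 4) * s ^ 2) := by linarith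
  rw [Real.le_sqrt (by positivity) h7] at h8
  -- Completing the square in γ, which exposes the discriminant under the root in T₁.
  have e : 2 - 3 * c.β / 2 - 2 * c.L * n * g / c.η - 8 * (c.α * g) * c.L ^ 2 * n ^ 2 * g / c.η ^ 2 * s ^ 2
     = (1 + 16 * c.α * (1 - 3 * c.β / 4) * s ^ 2
        - (g * (8 * c.L * n * c.α / c.η * s ^ 2) + 1) ^ 2) / (8 * c.α * s ^ 2) := by
    field_simp; ring
  rw [e]
  exact div_nonneg (by linarith) (by positivity)

/-- C₂ is cubic in γ. Bounding one factor γ of the cubic term by (1 - 3β/2)η/(2Ln), which is what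
`LargeK` provides, leaves the quadratic aγ² + bγ + cc with positive root T₂. -/
lemma C₂_nonneg (hm : 0 < m) (hn : 0 < n) (hc : c.Admissible) {K : ℕ}
    (hK : c.LargeK m n K) : 0 ≤ c.C₂ m n K := by
  have h1 := hc.η_pos; have h2 := hc.L_pos; have h3 := hc.α_pos
  have h4 := hc.sq_fac_pos; have h5 := hc.one_sub_pos
  have hn' : (0 : ℝ) < n := Nat.cast_pos.2 hn
  have hm' : (0 : ℝ) < m := Nat.cast_pos.2 hm
  have hγ0 := γ_pos hm hn hc hK.1
  have hγ : c.γ m n K ≤ c.T₂ m n :=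
    (γ_le_C₀ hm hn hc hK.1).trans ((min_le_right _ _).trans (min_le_left _ _))
  have hγ2 := γ_le_of_largeK hm hn hc hK
  have ha := a_neg hm hn hc
  have hcc := hc.cc_pos
  have hs := sqrt_disc_gt hm hn hc
  have hquad : 0 ≤ c.a m n * c.γ m n K ^ 2 + c.b m n * c.γ m n K + c.cc := by
    set S := √(c.b m n ^ 2 - 4 * c.a m n * c.cc) with hS
    have hSS : S ^ 2 = c.b m n ^ 2 - 4 * c.a m n * c.cc := by
      rw [hS, Real.sq_sqrt]; nlinarith
    unfold T₂ at hγ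
    rw [← hS, le_div_iff_of_neg (by linarith)] at hγ
    have hb : c.b m n < S := lt_of_le_of_lt (le_abs_self _) hs
    have e : 4 * c.a m n * (c.a m n * c.γ m n K ^ 2 + c.b m n * c.γ m n K + c.cc)
        = (2 * c.a m n * c.γ m n K + c.b m n) ^ 2 - S ^ 2 := by rw [hSS]; ring
    have : (2 * c.a m n * c.γ m n K + c.b m n) ^ 2 - S ^ 2 ≤ 0 := by
      have f1 : 2 * c.a m n * c.γ m n K + c.b m n ≤ S := by nlinarith
      nlinarith
    nlinarith
  refine hquad.trans ?_
  unfold C₂ Q cc a b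
  set g := c.γ m n K
  set s := 1 + 1 / c.β
  set A := (1 - 3 * c.β / 2) * c.η / (2 * c.L * n)
  -- This is exactly the amount by which C₂ exceeds the quadratic.
  have key : 0 ≤ (4 * c.α * c.L ^ 2 * n ^ 2 / c.η ^ 2) * s ^ 2 * (2 * c.L * n / (m * c.η)) * g ^ 2
      * (A - g) := by
    have : 0 ≤ A - g := by linarith
    positivity
  have hβ := hc.β_pos
  have e : (1 - g / (2 * c.β) * (c.L ^ 2 * n ^ 2 / (m * c.η ^ 2))
    - 2 * c.L * n / (m * c.η) * (-g + g * c.β / 2 + c.L * n * g ^ 2 / c.η)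
    - (1 + c.β) * c.ρ ^ 2
    - 4 * (c.α * g) * c.L ^ 2 * n ^ 2 / c.η ^ 2 * s ^ 2
    - (c.α * g) * c.L ^ 2 * n ^ 2 / c.η ^ 2 * c.ρ ^ 2 * (1 + c.β) * s
    - 2 * (c.α * g) * c.L * n / (m * c.η)
      * (4 * c.L ^ 2 * n ^ 2 * g ^ 2 / c.η ^ 2) * s ^ 2)
     - ((-(4 * c.α * c.L ^ 2 * n ^ 2 / c.η ^ 2) * s ^ 2 * (2 * c.L * n / (m * c.η)) * A
        - 2 * c.L ^ 2 * n ^ 2 / (m * c.η ^ 2)) * g ^ 2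
      + (-(c.L ^ 2 * n ^ 2 / (2 * c.β * m * c.η ^ 2)) + c.L * n * (2 - c.β) / (m * c.η)
    - 4 * c.α * c.L ^ 2 * n ^ 2 / c.η ^ 2 * s ^ 2
    - c.α * c.L ^ 2 * n ^ 2 / c.η ^ 2 * c.ρ ^ 2 * (1 + c.β) * s) * g
      + (1 - (1 + c.β) * c.ρ ^ 2))
    = (4 * c.α * c.L ^ 2 * n ^ 2 / c.η ^ 2) * s ^ 2 * (2 * c.L * n / (m * c.η)) * g ^ 2
      * (A - g) := by
    generalize A = A
    field_simp; ring
  linarith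

lemma C₁_le (hm : 0 < m) (hn : 0 < n) (hc : c.Admissible) {K : ℕ}
    (hK : 1 ≤ K) : c.C₁ m n K ≤ 2 := by
  have h1 := hc.η_pos; have h2 := hc.L_pos; have h3 := hc.α_pos
  have h4 := hc.sq_fac_pos; have h5 := hc.β_pos
  have hn' : (0 : ℝ) < n := Nat.cast_pos.2 hn
  have hγ0 := γ_pos hm hn hc hK
  unfold C₁ Q
  set g := c.γ m n K
  have e1 : 0 ≤ 2 * c.L * n * g / c.η := by positivity
  have e2 : 0 ≤ 8 * (c.α * g) * c.L ^ 2 * n ^ 2 * g / c.η ^ 2 * (1 + 1 / c.β) ^ 2 := by positivity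
  linarith

/-- Besides the 1, only the summand -γ inside the bracket raises C₂; all other terms are dropped and
γ ≤ C₀ is used. -/
lemma C₂_le (hm : 0 < m) (hn : 0 < n) (hc : c.Admissible) {K : ℕ}
    (hK : 1 ≤ K) : c.C₂ m n K ≤ 1 + 2 * c.L * n / (m * c.η) * c.C₀ m n := by
  have h1 := hc.η_pos; have h2 := hc.L_pos; have h3 := hc.α_pos
  have h4 := hc.sq_fac_pos; have h5 := hc.β_pos
  have hn' : (0 : ℝ) < n := Nat.cast_pos.2 hn
  have hm' : (0 : ℝ) < m := Nat.cast_pos.2 hm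
  have hγ0 := γ_pos hm hn hc hK
  have hγ1 := γ_le_C₀ hm hn hc hK
  unfold C₂ Q
  set g := c.γ m n K
  have e1 : 0 ≤ g / (2 * c.β) * (c.L ^ 2 * n ^ 2 / (m * c.η ^ 2)) := by positivity
  have e2 : 0 ≤ 2 * c.L * n / (m * c.η) * (g * c.β / 2 + c.L * n * g ^ 2 / c.η) := by positivity
  have e3 : 0 ≤ (1 + c.β) * c.ρ ^ 2 := by positivity
  have e4 : 0 ≤ 4 * (c.α * g) * c.L ^ 2 * n ^ 2 / c.η ^ 2 * (1 + 1 / c.β) ^ 2 := by positivity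
  have e5 : 0 ≤ (c.α * g) * c.L ^ 2 * n ^ 2 / c.η ^ 2 * c.ρ ^ 2 * (1 + c.β) * (1 + 1 / c.β) := by
    positivity
  have e6 : 0 ≤ 2 * (c.α * g) * c.L * n / (m * c.η)
      * (4 * c.L ^ 2 * n ^ 2 * g ^ 2 / c.η ^ 2) * (1 + 1 / c.β) ^ 2 := by positivity
  have e7 : 2 * c.L * n / (m * c.η) * g ≤ 2 * c.L * n / (m * c.η) * c.C₀ m n := by gcongr
  linarith

lemma θ_nonneg (hc : c.Admissible) : 0 ≤ c.θ n := by
  have := hc.β_pos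
  unfold θ; positivity

end Consts

-- The divergence theorem on the unit ball for Lipschitz functions.

lemma hasFDerivAt_norm_of_ne {E : Type*} [NormedAddCommGroup E] [InnerProductSpace ℝ E]
    {x : E} (hx : x ≠ 0) :
    HasFDerivAt (fun y : E => ‖y‖) (‖x‖⁻¹ • innerSL ℝ x) x := by
  have h := (hasStrictFDerivAt_norm_sq x).hasFDerivAt.sqrt (by simpa using hx)
  have e : (fun y : E => √(‖y‖ ^ 2)) = fun y => ‖y‖ := by
    ext y; exact Real.sqrt_sq (norm_nonneg y)
  rw [e] at h
  refine h.congr_fderiv ?_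
  rw [Real.sqrt_sq (norm_nonneg x)]
  ext w
  have := norm_ne_zero_iff.2 hx
  simp
  field_simp

section Divergence

open Metric Set Filter Topology
open scoped NNReal

/-- The cone max(R - ‖x‖, 0) is the test function of the divergence theorem: its gradient is -x/‖x‖
inside the ball and 0 outside. The direction -w is the one that integration by parts produces, and
the excluded points form a null set. -/
lemma lineDeriv_max_sub_norm {E : Type*} [NormedAddCommGroup E] [InnerProductSpace ℝ E] {R : ℝ} {x : E} (hx : x ≠ 0) (hR : ‖x‖ ≠ R) (w : E) :
    lineDeriv ℝ (fun y : E => max (R - ‖y‖) 0) x (-w)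
      = (ball (0 : E) R).indicator (fun y => inner ℝ (‖y‖⁻¹ • y) w) x := by
  rcases lt_or_gt_of_ne hR with h | h
  · have hd : HasFDerivAt (fun y : E => max (R - ‖y‖) 0) (-(‖x‖⁻¹ • innerSL ℝ x)) x := by
      refine ((hasFDerivAt_norm_of_ne hx).const_sub R).congr_of_eventuallyEq ?_
      have : ∀ᶠ y in 𝓝 x, ‖y‖ < R := continuous_norm.continuousAt.eventually_lt_const h
      filter_upwards [this] with y hy
      exact max_eq_left (by linarith)
    rw [(hd.hasLineDerivAt (-w)).lineDeriv, indicator_of_mem (by simpa using h)]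
    simp [inner_smul_left]
  · have hd : HasFDerivAt (fun y : E => max (R - ‖y‖) 0) (0 : E →L[ℝ] ℝ) x := by
      refine (hasFDerivAt_const (0 : ℝ) x).congr_of_eventuallyEq ?_
      have : ∀ᶠ y in 𝓝 x, R < ‖y‖ := continuous_norm.continuousAt.eventually_const_lt h
      filter_upwards [this] with y hy
      exact max_eq_right (by linarith)
    rw [(hd.hasLineDerivAt (-w)).lineDeriv, indicator_of_notMem (by simpa using h.le)]
    simp

lemma lipschitzWith_max_sub_norm {E : Type*} [NormedAddCommGroup E] (R : ℝ) : LipschitzWith 1 fun x : E => max (R - ‖x‖) 0 := by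
  have h : LipschitzWith 1 fun x : E => R - ‖x‖ := by
    refine LipschitzWith.of_dist_le_mul fun x y => ?_
    rw [Real.dist_eq, sub_sub_sub_cancel_left, NNReal.coe_one, one_mul, dist_comm, dist_eq_norm]
    exact abs_norm_sub_norm_le y x
  exact h.max_const 0

variable {E : Type*} [NormedAddCommGroup E] [InnerProductSpace ℝ E] [FiniteDimensional ℝ E]
  [MeasurableSpace E] [BorelSpace E]

/-- Polar coordinates: away from the origin, x ↦ (x/‖x‖, ‖x‖) is measure preserving onto the product
of the sphere measure and the density r^(dim - 1), and Fubini applies. -/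
lemma integral_eq_integral_sphere_Ioi [Nontrivial E] {f : E → ℝ} (hf : Integrable f) :
    ∫ x, f x = ∫ r in Ioi (0 : ℝ), r ^ (Module.finrank ℝ E - 1) *
      ∫ θ : sphere (0 : E) 1, f (r • (θ : E)) ∂(volume : Measure E).toSphere := by
  have hmp := (volume : Measure E).measurePreserving_homeomorphUnitSphereProd
  have hemb := (homeomorphUnitSphereProd E).measurableEmbedding
  set F : sphere (0 : E) 1 × Ioi (0 : ℝ) → ℝ := fun p => f ((p.2 : ℝ) • (p.1 : E)) with hF
  have hFc : ∀ x : ({0}ᶜ : Set E), F (homeomorphUnitSphereProd E x) = f x := by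
    intro x
    have hx : ‖(x : E)‖ ≠ 0 := norm_ne_zero_iff.2 x.2
    simp [hF, smul_smul, hx]
  have hint : Integrable F ((volume : Measure E).toSphere.prod
      (Measure.volumeIoiPow (Module.finrank ℝ E - 1))) := by
    rw [← hmp.integrable_comp_emb hemb]
    have : (F ∘ homeomorphUnitSphereProd E) = f ∘ (Subtype.val : ({0}ᶜ : Set E) → E) := by
      ext x; exact hFc x
    rw [this, ← integrableOn_iff_comap_subtypeVal (measurableSet_singleton _).compl]
    exact hf.integrableOn
  calc
    ∫ x, f x = ∫ x : ({0}ᶜ : Set E), f x ∂((volume : Measure E).comap (↑)) := by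
      rw [integral_subtype_comap (measurableSet_singleton _).compl f, restrict_compl_singleton]
    _ = ∫ p, F p ∂((volume : Measure E).toSphere.prod
          (Measure.volumeIoiPow (Module.finrank ℝ E - 1))) := by
      rw [← hmp.integral_comp hemb]
      exact integral_congr_ae (.of_forall fun x => (hFc x).symm)
    _ = ∫ r : Ioi (0 : ℝ), (∫ θ : sphere (0 : E) 1, f ((r : ℝ) • (θ : E))
          ∂(volume : Measure E).toSphere) ∂(Measure.volumeIoiPow (Module.finrank ℝ E - 1)) := by
      rw [integral_prod_symm _ hint]
    _ = _ := by
      set G : ℝ → ℝ := fun r => ∫ θ : sphere (0 : E) 1, f (r • (θ : E))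
          ∂(volume : Measure E).toSphere
      simp only [Measure.volumeIoiPow, ENNReal.ofReal]
      rw [integral_withDensity_eq_integral_smul,
        integral_subtype_comap measurableSet_Ioi
          fun a ↦ Real.toNNReal (a ^ (Module.finrank ℝ E - 1)) • G a,
        setIntegral_congr_fun measurableSet_Ioi fun x hx ↦ ?_]
      · rw [NNReal.smul_def, Real.coe_toNNReal _ (pow_nonneg hx.out.le _), smul_eq_mul]
      · exact (measurable_subtype_coe.pow_const _).real_toNNReal

lemma integrableOn_ball_mul_inner_normalize {g : E → ℝ} (hg : Continuous g) (R : ℝ) (w : E) :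
    IntegrableOn (fun x => g x * inner ℝ (‖x‖⁻¹ • x) w) (ball (0 : E) R) := by
  have h1 : IntegrableOn g (closedBall (0 : E) R) :=
    hg.continuousOn.integrableOn_compact (isCompact_closedBall _ _)
  refine ((h1.mono_set ball_subset_closedBall).mul_const ‖w‖).mono ?_ (.of_forall fun x => ?_)
  · have : Measurable fun x : E => inner ℝ (‖x‖⁻¹ • x) w := by fun_prop
    exact (hg.measurable.mul this).aestronglyMeasurable
  · rw [norm_mul, norm_mul, norm_norm]
    gcongr
    refine (norm_inner_le_norm _ _).trans ?_
    rw [norm_smul, norm_inv, norm_norm]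
    exact mul_le_of_le_one_left (norm_nonneg _) (inv_mul_le_one)

lemma continuous_integral_sphere {g : E → ℝ} (hg : Continuous g) (w : E) :
    Continuous fun r : ℝ => ∫ θ : sphere (0 : E) 1, g (r • (θ : E)) * inner ℝ (θ : E) w
      ∂(volume : Measure E).toSphere := by
  have hk : CompactSpace (sphere (0 : E) 1) := isCompact_iff_compactSpace.1 (isCompact_sphere _ _)
  have := continuous_parametric_integral_of_continuous (μ := (volume : Measure E).toSphere)
    (f := fun (r : ℝ) (θ : sphere (0 : E) 1) => g (r • (θ : E)) * inner ℝ (θ : E) w)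
    (by unfold Function.uncurry; fun_prop) (s := univ) isCompact_univ
  simpa using this

lemma integral_ball_mul_inner_normalize [Nontrivial E] {g : E → ℝ} (hg : Continuous g) {R : ℝ}
    (hR : 0 ≤ R) (w : E) :
    ∫ x in ball (0 : E) R, g x * inner ℝ (‖x‖⁻¹ • x) w
      = ∫ r in (0 : ℝ)..R, r ^ (Module.finrank ℝ E - 1) *
        ∫ θ : sphere (0 : E) 1, g (r • (θ : E)) * inner ℝ (θ : E) w
          ∂(volume : Measure E).toSphere := by
  have hi := integrableOn_ball_mul_inner_normalize hg R w
  rw [← integral_indicator measurableSet_ball, integral_eq_integral_sphere_Ioi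
    ((integrable_indicator_iff measurableSet_ball).2 hi), intervalIntegral.integral_of_le hR,
    integral_Ioc_eq_integral_Ioo]
  rw [setIntegral_eq_of_subset_of_forall_sdiff_eq_zero measurableSet_Ioi
    (fun r (hr : r ∈ Ioo 0 R) => hr.1)]
  · refine setIntegral_congr_fun measurableSet_Ioo fun r hr => ?_
    have hr0 : 0 < r := hr.1
    congr 1
    refine integral_congr_ae (.of_forall fun θ => ?_)
    have hθ : ‖(θ : E)‖ = 1 := by simp
    simp only
    rw [indicator_of_mem]
    · rw [norm_smul, hθ, mul_one, Real.norm_of_nonneg hr0.le, smul_smul,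
        inv_mul_cancel₀ hr0.ne', one_smul]
    · simpa [norm_smul, abs_of_pos hr0] using hr.2
  · rintro r ⟨hr0, hr1⟩
    have hr0 : 0 < r := hr0
    have hr1 : R ≤ r := not_lt.1 fun h => hr1 ⟨hr0, h⟩
    rw [integral_eq_zero_of_ae, mul_zero]
    refine .of_forall fun θ => ?_
    apply indicator_of_notMem
    simpa [norm_smul, abs_of_pos hr0] using hr1

/-- Integration by parts for two Lipschitz functions, one of them the compactly supported cone. -/
lemma integral_lineDeriv_mul_max_sub_norm [Nontrivial E] {g : E → ℝ} {C : ℝ≥0}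
    (hg : LipschitzWith C g) {R : ℝ} (w : E) :
    ∫ x, lineDeriv ℝ g x w * max (R - ‖x‖) 0
      = ∫ x in ball (0 : E) R, g x * inner ℝ (‖x‖⁻¹ • x) w := by
  have hcs : HasCompactSupport fun x : E => max (R - ‖x‖) 0 := by
    refine HasCompactSupport.intro (isCompact_closedBall (0 : E) R) fun x hx => ?_
    have : R < ‖x‖ := by simpa using hx
    exact max_eq_right (by linarith)
  rw [LipschitzWith.integral_lineDeriv_mul_eq hg (lipschitzWith_max_sub_norm R) hcs,
    ← integral_indicator measurableSet_ball]
  refine integral_congr_ae ?_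
  have h1 : ∀ᵐ x : E, x ∉ sphere (0 : E) R :=
    measure_eq_zero_iff_ae_notMem.1 (Measure.addHaar_sphere _ _ _)
  have h2 : ∀ᵐ x : E, x ≠ 0 := by
    simpa using measure_eq_zero_iff_ae_notMem.1 (measure_singleton (μ := volume) (0 : E))
  filter_upwards [h1, h2] with x hx hx0
  rw [lineDeriv_max_sub_norm hx0 (by simpa using hx)]
  by_cases h : x ∈ ball (0 : E) R
  · rw [indicator_of_mem h, indicator_of_mem h, mul_comm]
  · rw [indicator_of_notMem h, indicator_of_notMem h, zero_mul]

/-- The R-derivative of the cone is the indicator of the ball of radius R off its sphere, so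
differentiating under the integral recovers the ball integral. -/
lemma hasDerivAt_integral_lineDeriv_mul_max {g : E → ℝ} {C : ℝ≥0}
    (hg : LipschitzWith C g) (w : E) :
    HasDerivAt (fun R : ℝ => ∫ x, lineDeriv ℝ g x w * max (R - ‖x‖) 0)
      (∫ x in ball (0 : E) 1, lineDeriv ℝ g x w) 1 := by
  rw [← integral_indicator measurableSet_ball]
  have hm : AEStronglyMeasurable (fun x => lineDeriv ℝ g x w) volume :=
    aestronglyMeasurable_lineDeriv hg.continuous volume
  have hloc := hg.locallyIntegrable_lineDeriv (μ := volume) w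
  have hcs : ∀ R : ℝ, HasCompactSupport fun x : E => max (R - ‖x‖) 0 := fun R => by
    refine HasCompactSupport.intro (isCompact_closedBall (0 : E) R) fun x hx => ?_
    have : R < ‖x‖ := by simpa using hx
    exact max_eq_right (by linarith)
  have hball : IntegrableOn (fun x => |lineDeriv ℝ g x w|) (ball (0 : E) 2) :=
    ((hloc.integrableOn_isCompact (isCompact_closedBall (0 : E) 2)).mono_set
      ball_subset_closedBall).abs
  -- For R < 2 every cone vanishes outside the ball of radius 2, so the dominating function can be
  -- cut off there.
  refine (hasDerivAt_integral_of_dominated_loc_of_lip (s := ball (1 : ℝ) 1)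
    (bound := (ball (0 : E) 2).indicator fun x => |lineDeriv ℝ g x w|)
    (ball_mem_nhds _ one_pos) (.of_forall fun R => ?_) ?_ ?_ ?_ ?_ ?_).2
  · exact hm.mul (lipschitzWith_max_sub_norm R).continuous.aestronglyMeasurable
  · have := hloc.integrable_smul_right_of_hasCompactSupport
      (lipschitzWith_max_sub_norm (1 : ℝ)).continuous (hcs 1)
    simpa [smul_eq_mul] using this
  · exact hm.indicator measurableSet_ball
  · refine .of_forall fun x => LipschitzOnWith.of_dist_le_mul fun R hR R' hR' => ?_
    by_cases hx : x ∈ ball (0 : E) 2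
    · rw [indicator_of_mem hx, Real.dist_eq, ← mul_sub, abs_mul, Real.coe_nnabs, abs_abs]
      gcongr
      refine (abs_max_sub_max_le_abs _ _ _).trans ?_
      rw [Real.dist_eq]; simp
    · have hx : 2 ≤ ‖x‖ := by simpa using hx
      have hR2 : R < 2 := by have := hR; rw [Real.ball_eq_Ioo] at this; linarith [this.2]
      have hR2' : R' < 2 := by have := hR'; rw [Real.ball_eq_Ioo] at this; linarith [this.2]
      rw [max_eq_right (by linarith), max_eq_right (by linarith)]
      simp only [mul_zero, dist_self]
      positivity
  · exact (integrable_indicator_iff measurableSet_ball).2 hball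
  · have h1 : ∀ᵐ x : E, x ∉ sphere (0 : E) 1 :=
      measure_eq_zero_iff_ae_notMem.1 (Measure.addHaar_sphere_of_ne_zero _ _ one_ne_zero)
    filter_upwards [h1] with x hx
    have hx : ‖x‖ ≠ 1 := by simpa using hx
    rcases lt_or_gt_of_ne hx with h | h
    · rw [indicator_of_mem (by simpa using h)]
      have : HasDerivAt (fun R : ℝ => lineDeriv ℝ g x w * (R - ‖x‖)) (lineDeriv ℝ g x w * 1) 1 :=
        ((hasDerivAt_id 1).sub_const _).const_mul _
      rw [mul_one] at this
      refine this.congr_of_eventuallyEq ?_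
      filter_upwards [eventually_gt_nhds h] with R hR
      rw [max_eq_left (by linarith)]
    · rw [indicator_of_notMem (by simpa using h.le)]
      refine (hasDerivAt_const (1 : ℝ) (0 : ℝ)).congr_of_eventuallyEq ?_
      filter_upwards [eventually_lt_nhds h] with R hR
      rw [max_eq_right (by linarith), mul_zero]

/-- The divergence theorem on the unit ball for the constant field `w` times a Lipschitz function. -/
lemma integral_ball_lineDeriv [Nontrivial E] {g : E → ℝ} {C : ℝ≥0}
    (hg : LipschitzWith C g) (w : E) :
    ∫ x in ball (0 : E) 1, lineDeriv ℝ g x w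
      = ∫ θ : sphere (0 : E) 1, g θ * inner ℝ (θ : E) w ∂(volume : Measure E).toSphere := by
  have h1 := hasDerivAt_integral_lineDeriv_mul_max hg w
  set Φ : ℝ → ℝ := fun r => r ^ (Module.finrank ℝ E - 1) *
        ∫ θ : sphere (0 : E) 1, g (r • (θ : E)) * inner ℝ (θ : E) w
          ∂(volume : Measure E).toSphere with hΦ
  have hc : Continuous Φ := by
    have := continuous_integral_sphere hg.continuous w
    fun_prop
  have h2 : HasDerivAt (fun R => ∫ r in (0 : ℝ)..R, Φ r) (Φ 1) 1 :=
    intervalIntegral.integral_hasDerivAt_right (hc.intervalIntegrable _ _)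
      (hc.stronglyMeasurableAtFilter _ _) hc.continuousAt
  have h3 : (fun R : ℝ => ∫ x, lineDeriv ℝ g x w * max (R - ‖x‖) 0)
      =ᶠ[𝓝 1] fun R => ∫ r in (0 : ℝ)..R, Φ r := by
    filter_upwards [eventually_gt_nhds one_pos] with R hR
    rw [integral_lineDeriv_mul_max_sub_norm hg,
      integral_ball_mul_inner_normalize hg.continuous hR.le]
  -- The cone integral is a function of R with two descriptions near R = 1; equating its two
  -- derivatives at 1 is the theorem.
  rw [h1.unique (h2.congr_of_eventuallyEq h3)]
  simp [hΦ]

end Divergence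

-- The gradient of the smoothed function as a sphere integral.

section Smoothing

open Metric Set Filter Topology
open scoped NNReal

/-- By Rademacher g is differentiable almost everywhere with bounded derivative, so one may
differentiate under the integral; the divergence theorem then moves the derivative off g onto the
sphere. -/
lemma hasGradientAt_integral_ball_add {E : Type*} [NormedAddCommGroup E] [InnerProductSpace ℝ E]
    [FiniteDimensional ℝ E] [MeasurableSpace E] [BorelSpace E] [Nontrivial E]
    {g : E → ℝ} {C : ℝ≥0} (hg : LipschitzWith C g) :
    HasGradientAt (fun y => ∫ u in ball (0 : E) 1, g (y + u))
      (∫ θ : sphere (0 : E) 1, g θ • (θ : E) ∂(volume : Measure E).toSphere) 0 := by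
  have hk : CompactSpace (sphere (0 : E) 1) := isCompact_iff_compactSpace.1 (isCompact_sphere _ _)
  have hfin : volume (ball (0 : E) 1) < ⊤ := measure_ball_lt_top
  have hfm : IsFiniteMeasure (volume.restrict (ball (0 : E) 1)) := isFiniteMeasure_restrict.2 hfin.ne
  have hdiff : ∀ᵐ u ∂(volume.restrict (ball (0 : E) 1)), DifferentiableAt ℝ g u :=
    ae_restrict_of_ae hg.ae_differentiableAt
  obtain ⟨hi, hd⟩ := hasFDerivAt_integral_of_dominated_loc_of_lip (𝕜 := ℝ) (s := univ)
    (μ := volume.restrict (ball (0 : E) 1))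
    (F := fun y u => g (y + u)) (F' := fun u => fderiv ℝ g u) (x₀ := (0 : E))
    (bound := fun _ => (C : ℝ)) univ_mem
    (.of_forall fun y => (hg.continuous.comp (continuous_const_add y)).aestronglyMeasurable)
    (by
      simp only [zero_add]
      exact (hg.continuous.continuousOn.integrableOn_compact (isCompact_closedBall (0 : E) 1)).mono_set
        ball_subset_closedBall)
    (measurable_fderiv ℝ g).aestronglyMeasurable
    (.of_forall fun u => by
      have : Real.nnabs (C : ℝ) = C := by ext; simp
      rw [this]
      refine LipschitzWith.lipschitzOnWith (LipschitzWith.of_dist_le_mul fun a b => ?_)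
      simpa using hg.dist_le_mul (a + u) (b + u))
    (integrable_const _)
    (by
      filter_upwards [hdiff] with u hu
      have h1 : HasFDerivAt g (fderiv ℝ g u) (0 + u) := by rw [zero_add]; exact hu.hasFDerivAt
      exact (hasFDerivAt_comp_add_right u).2 h1)
  rw [hasGradientAt_iff_hasFDerivAt]
  refine hd.congr_fderiv ?_
  ext w
  rw [ContinuousLinearMap.integral_apply hi]
  have hint : Integrable (fun θ : sphere (0 : E) 1 => g θ • (θ : E)) (volume : Measure E).toSphere := by
    have hc : Continuous fun θ : sphere (0 : E) 1 => g θ • (θ : E) :=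
      (hg.continuous.comp continuous_subtype_val).smul continuous_subtype_val
    exact hc.integrable_of_hasCompactSupport (HasCompactSupport.of_compactSpace _)
  rw [InnerProductSpace.toDual_apply_apply, real_inner_comm, ← integral_inner hint]
  have e1 : ∫ u in ball (0 : E) 1, fderiv ℝ g u w = ∫ u in ball (0 : E) 1, lineDeriv ℝ g u w := by
    refine integral_congr_ae ?_
    filter_upwards [hdiff] with u hu
    exact (hu.lineDeriv_eq_fderiv).symm
  rw [e1, integral_ball_lineDeriv hg]
  refine integral_congr_ae (.of_forall fun θ => ?_)
  simp [inner_smul_right, real_inner_comm]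

lemma integral_sphereLaw {n : ℕ} (η : ℝ) {F : Type*} [NormedAddCommGroup F] [NormedSpace ℝ F]
    {f : Vec n → F} (hf : StronglyMeasurable f) :
    ∫ v, f v ∂sphereLaw n η = ((volume : Measure (Vec n)).toSphere.real univ)⁻¹ •
      ∫ θ : sphere (0 : Vec n) 1, f (η • (θ : Vec n)) ∂(volume : Measure (Vec n)).toSphere := by
  unfold sphereLaw
  rw [integral_map (by fun_prop) hf.aestronglyMeasurable, integral_smul_measure]
  simp [Measure.real]

lemma isProbabilityMeasure_sphereLaw {n : ℕ} (hn : 0 < n) (η : ℝ) :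
    IsProbabilityMeasure (sphereLaw n η) := by
  have : NeZero n := ⟨hn.ne'⟩
  have h : IsProbabilityMeasure ((((volume : Measure (Vec n)).toSphere univ)⁻¹) •
      (volume : Measure (Vec n)).toSphere) := by
    refine ⟨?_⟩
    rw [Measure.smul_apply, smul_eq_mul, ENNReal.inv_mul_cancel]
    · exact Measure.measure_univ_ne_zero.2 (volume : Measure (Vec n)).toSphere_ne_zero
    · exact measure_ne_top _ _
  exact Measure.isProbabilityMeasure_map (by fun_prop)

lemma ae_norm_sphereLaw {n : ℕ} {η : ℝ} (hη : 0 ≤ η) : ∀ᵐ v ∂sphereLaw n η, ‖v‖ = η := by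
  unfold sphereLaw
  rw [ae_map_iff (by fun_prop) (measurableSet_eq_fun (by fun_prop) (by fun_prop))]
  exact .of_forall fun θ => by simp [norm_smul, abs_of_nonneg hη]

/-- The zeroth-order representation of the gradient of the smoothed function. -/
def sphereGrad {n : ℕ} (η : ℝ) (h : Vec n → ℝ) (x : Vec n) : Vec n :=
  ∫ v, ((n : ℝ) * h (x + v) / η) • (‖v‖⁻¹ • v) ∂sphereLaw n η

/-- The substitution y ↦ (y - x)/η reduces to the unit ball at 0. The factor n in the estimator is
the ratio of the sphere's total mass to the volume of the ball. -/
lemma hasGradientAt_smooth {n : ℕ} (hn : 0 < n) {η : ℝ} (hη : 0 < η) {h : Vec n → ℝ} {C : ℝ≥0}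
    (hh : LipschitzWith C h) (x : Vec n) :
    HasGradientAt (smooth η h) (sphereGrad η h x) x := by
  have : NeZero n := ⟨hn.ne'⟩
  set g : Vec n → ℝ := fun u => h (x + η • u) with hg
  have hgl : LipschitzWith (C * ‖η‖₊) g := by
    refine LipschitzWith.of_dist_le_mul fun a b => ?_
    refine (hh.dist_le_mul _ _).trans_eq ?_
    simp [dist_smul₀, mul_assoc]
  have h1 := hasGradientAt_integral_ball_add hgl
  rw [hasGradientAt_iff_hasFDerivAt] at h1 ⊢
  set V := ∫ θ : sphere (0 : Vec n) 1, g θ • (θ : Vec n) ∂(volume : Measure (Vec n)).toSphere with hV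
  have h2 : HasFDerivAt (fun y : Vec n => η⁻¹ • (y - x)) (η⁻¹ • ContinuousLinearMap.id ℝ (Vec n)) x :=
    ((hasFDerivAt_id x).sub_const x).const_smul η⁻¹
  have h0 : η⁻¹ • (x - x) = 0 := by simp
  have h1' : HasFDerivAt (fun y => ∫ u in ball (0 : Vec n) 1, g (y + u))
      (InnerProductSpace.toDual ℝ (Vec n) V) (η⁻¹ • (x - x)) := by rw [h0]; exact h1
  have h3 := (h1'.comp x h2).const_smul ((volume : Measure (Vec n)).real (ball 0 1))⁻¹
  have e1 : smooth η h = fun y => ((volume : Measure (Vec n)).real (ball 0 1))⁻¹ •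
      ((fun y => ∫ u in ball (0 : Vec n) 1, g (y + u)) ∘ fun y : Vec n => η⁻¹ • (y - x)) y := by
    ext y
    have hae : (closedBall (0 : Vec n) 1 : Set (Vec n)) =ᵐ[volume] ball (0 : Vec n) 1 := by
      rw [← ball_union_sphere]
      exact union_ae_eq_left_of_ae_eq_empty (ae_eq_empty.2 (Measure.addHaar_sphere _ _ _))
    unfold smooth
    rw [setAverage_eq, Function.comp_apply, setIntegral_congr_set hae, measureReal_congr hae]
    congr 2
    ext u
    simp only [hg]
    congr 1
    rw [smul_add, smul_inv_smul₀ hη.ne']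
    abel
  rw [e1]
  refine h3.congr_fderiv ?_
  ext w
  have hmeas : StronglyMeasurable fun v : Vec n => ((n : ℝ) * h (x + v) / η) • (‖v‖⁻¹ • v) := by
    have := hh.continuous.measurable
    exact (by fun_prop : Measurable _).stronglyMeasurable
  have e2 : sphereGrad η h x
      = (((volume : Measure (Vec n)).real (ball 0 1))⁻¹ * η⁻¹) • V := by
    unfold sphereGrad
    rw [integral_sphereLaw η hmeas, Measure.toSphere_real_apply_univ, hV]
    have : ∀ θ : sphere (0 : Vec n) 1, ((n : ℝ) * h (x + η • (θ : Vec n)) / η) •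
        (‖η • (θ : Vec n)‖⁻¹ • η • (θ : Vec n)) = ((n : ℝ) / η) • (g θ • (θ : Vec n)) := by
      intro θ
      have : ‖η • (θ : Vec n)‖ = η := by simp [norm_smul, abs_of_pos hη]
      rw [this, inv_smul_smul₀ hη.ne', smul_smul, hg]
      congr 1; ring
    simp_rw [this]
    rw [integral_smul, smul_smul]
    congr 1
    have hn' : (n : ℝ) ≠ 0 := Nat.cast_ne_zero.2 hn.ne'
    rw [finrank_euclideanSpace_fin]
    field_simp
  rw [e2]
  simp [mul_assoc]

end Smoothing

-- Size, Lipschitz continuity and descent for smoothed gradients.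

section SmoothingBounds

open Metric Set Filter Topology
open scoped NNReal

variable {n : ℕ} {η : ℝ} {h : Vec n → ℝ} {C : ℝ≥0}

lemma gradient_smooth (hn : 0 < n) (hη : 0 < η) (hh : LipschitzWith C h) (x : Vec n) :
    gradient (smooth η h) x = sphereGrad η h x :=
  (hasGradientAt_smooth hn hη hh x).gradient

lemma differentiable_smooth (hn : 0 < n) (hη : 0 < η) (hh : LipschitzWith C h) :
    Differentiable ℝ (smooth η h) := fun x =>
  (hasGradientAt_smooth hn hη hh x).differentiableAt

lemma norm_normalize_le (v : Vec n) : ‖‖v‖⁻¹ • v‖ ≤ 1 := by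
  rw [norm_smul, norm_inv, norm_norm]
  exact inv_mul_le_one

lemma integrable_sphereGrad (hn : 0 < n) (hη : 0 < η) (hh : LipschitzWith C h) (x : Vec n) :
    Integrable (fun v => ((n : ℝ) * h (x + v) / η) • (‖v‖⁻¹ • v)) (sphereLaw n η) := by
  have := isProbabilityMeasure_sphereLaw hn η
  have hmeas : Measurable fun v : Vec n => ((n : ℝ) * h (x + v) / η) • (‖v‖⁻¹ • v) := by
    have := hh.continuous.measurable
    fun_prop
  refine Integrable.of_bound hmeas.aestronglyMeasurable (n * (|h x| + C * η) / η) ?_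
  filter_upwards [ae_norm_sphereLaw hη.le] with v hv
  rw [norm_smul, Real.norm_eq_abs, abs_div, abs_mul, Nat.abs_cast, abs_of_pos hη]
  refine (mul_le_of_le_one_right (by positivity) (norm_normalize_le v)).trans ?_
  have h1 : |h (x + v)| ≤ |h x| + C * η := by
    have h2 := hh.dist_le_mul (x + v) x
    rw [Real.dist_eq, dist_eq_norm, add_sub_cancel_left, hv] at h2
    have := abs_sub_abs_le_abs_sub (h (x + v)) (h x)
    linarith
  gcongr

/-- The integral is the gradient formula for a constant function, whose smoothing is constant. -/
lemma integral_normalize_sphereLaw (hn : 0 < n) (hη : 0 < η) (a : ℝ) :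
    ∫ v, ((n : ℝ) * a / η) • (‖v‖⁻¹ • v) ∂sphereLaw n η = 0 := by
  have h1 := hasGradientAt_smooth hn hη (h := fun _ : Vec n => a) (LipschitzWith.const a) 0
  have e : smooth η (fun _ : Vec n => a) = fun _ => a := by
    ext x
    unfold smooth
    refine setAverage_const ?_ ?_ a
    · exact (measure_closedBall_pos _ _ one_pos).ne'
    · exact measure_closedBall_lt_top.ne
  rw [e] at h1
  exact h1.unique (hasGradientAt_const 0 a)

/-- A baseline value can be subtracted at no cost. With a = h(x) the integrand is bounded by nC and
has the shape of the algorithm's finite difference. -/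
lemma sphereGrad_eq_sub (hn : 0 < n) (hη : 0 < η) (hh : LipschitzWith C h) (x : Vec n) (a : ℝ) :
    sphereGrad η h x = ∫ v, ((n : ℝ) * (h (x + v) - a) / η) • (‖v‖⁻¹ • v) ∂sphereLaw n η := by
  have h1 := integrable_sphereGrad hn hη hh x
  have h2 := integrable_sphereGrad hn hη (LipschitzWith.const (α := Vec n) a) x
  have : ∀ v : Vec n, ((n : ℝ) * (h (x + v) - a) / η) • (‖v‖⁻¹ • v)
      = ((n : ℝ) * h (x + v) / η) • (‖v‖⁻¹ • v) - ((n : ℝ) * a / η) • (‖v‖⁻¹ • v) := by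
    intro v; rw [← sub_smul]; congr 1; ring
  simp_rw [this]
  rw [integral_sub h1 h2, integral_normalize_sphereLaw hn hη, sub_zero]
  rfl

lemma norm_sphereGrad_le (hn : 0 < n) (hη : 0 < η) (hh : LipschitzWith C h) (x : Vec n) :
    ‖sphereGrad η h x‖ ≤ n * C := by
  have := isProbabilityMeasure_sphereLaw hn η
  rw [sphereGrad_eq_sub hn hη hh x (h x)]
  refine (norm_integral_le_of_norm_le_const (C := n * C) ?_).trans (by simp)
  filter_upwards [ae_norm_sphereLaw hη.le] with v hv
  rw [norm_smul, Real.norm_eq_abs, abs_div, abs_mul, Nat.abs_cast, abs_of_pos hη]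
  refine (mul_le_of_le_one_right (by positivity) (norm_normalize_le v)).trans ?_
  rw [div_le_iff₀ hη, mul_assoc]
  gcongr
  have h2 := hh.dist_le_mul (x + v) x
  rwa [Real.dist_eq, dist_eq_norm, add_sub_cancel_left, hv] at h2

lemma norm_sphereGrad_sub_le (hn : 0 < n) (hη : 0 < η) (hh : LipschitzWith C h) (x y : Vec n) :
    ‖sphereGrad η h x - sphereGrad η h y‖ ≤ n * C / η * ‖x - y‖ := by
  have := isProbabilityMeasure_sphereLaw hn η
  unfold sphereGrad
  rw [← integral_sub (integrable_sphereGrad hn hη hh x) (integrable_sphereGrad hn hη hh y)]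
  refine (norm_integral_le_of_norm_le_const (C := n * C / η * ‖x - y‖) (.of_forall fun v => ?_)).trans
    (by simp)
  rw [← sub_smul, ← sub_div, ← mul_sub, norm_smul, Real.norm_eq_abs, abs_div, abs_mul, Nat.abs_cast,
    abs_of_pos hη]
  refine (mul_le_of_le_one_right (by positivity) (norm_normalize_le v)).trans ?_
  have h2 := hh.dist_le_mul (x + v) (y + v)
  rw [Real.dist_eq, dist_add_right, dist_eq_norm] at h2
  calc (n : ℝ) * |h (x + v) - h (y + v)| / η ≤ n * (C * ‖x - y‖) / η := by gcongr
    _ = _ := by ring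

lemma continuous_sphereGrad (hn : 0 < n) (hη : 0 < η) (hh : LipschitzWith C h) :
    Continuous (sphereGrad η h) := by
  refine (LipschitzWith.of_dist_le_mul (K := Real.toNNReal (n * C / η)) fun x y => ?_).continuous
  rw [dist_eq_norm, dist_eq_norm, Real.coe_toNNReal _ (by positivity)]
  exact norm_sphereGrad_sub_le hn hη hh x y

lemma abs_smooth_sub_le (hn : 0 < n) (hη : 0 < η) (hh : LipschitzWith C h) (x y : Vec n) :
    |smooth η h y - smooth η h x| ≤ n * C * ‖y - x‖ := by
  refine convex_univ.norm_image_sub_le_of_norm_hasFDerivWithin_le (𝕜 := ℝ)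
    (f := smooth η h) (f' := fun z => InnerProductSpace.toDual ℝ (Vec n) (sphereGrad η h z))
    (fun z _ => (hasGradientAt_smooth hn hη hh z).hasFDerivAt.hasFDerivWithinAt) (fun z _ => ?_)
    (mem_univ _) (mem_univ _)
  rw [LinearIsometryEquiv.norm_map]
  exact norm_sphereGrad_le hn hη hh z

/-- Mean value inequality on the ball around x of radius ‖y - x‖, where the gradient varies by at
most (nC/η)‖y - x‖. The factor 1/2 of the sharp descent lemma is not needed. -/
lemma smooth_le_add_inner (hn : 0 < n) (hη : 0 < η) (hh : LipschitzWith C h) (x y : Vec n) :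
    smooth η h y ≤ smooth η h x + inner ℝ (sphereGrad η h x) (y - x)
      + n * C / η * ‖y - x‖ ^ 2 := by
  have := (convex_closedBall x ‖y - x‖).norm_image_sub_le_of_norm_hasFDerivWithin_le' (𝕜 := ℝ)
    (f := smooth η h) (f' := fun z => InnerProductSpace.toDual ℝ (Vec n) (sphereGrad η h z))
    (φ := InnerProductSpace.toDual ℝ (Vec n) (sphereGrad η h x)) (C := n * C / η * ‖y - x‖)
    (fun z _ => (hasGradientAt_smooth hn hη hh z).hasFDerivAt.hasFDerivWithinAt) (fun z hz => ?_)
    (mem_closedBall_self (norm_nonneg _)) (y := y) (by simp [dist_eq_norm])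
  · rw [Real.norm_eq_abs, InnerProductSpace.toDual_apply_apply] at this
    have := (abs_le.1 this).2
    nlinarith
  · rw [← map_sub, LinearIsometryEquiv.norm_map]
    refine (norm_sphereGrad_sub_le hn hη hh z x).trans ?_
    rw [mem_closedBall, dist_eq_norm] at hz
    gcongr

lemma sphereGrad_mean {m : ℕ} (hn : 0 < n) (hη : 0 < η) {f : Fin m → Vec n → ℝ}
    (hf : ∀ i, LipschitzWith C (f i)) (x : Vec n) :
    sphereGrad η (fun x => (m : ℝ)⁻¹ * ∑ i, f i x) x
      = (m : ℝ)⁻¹ • ∑ i, sphereGrad η (f i) x := by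
  unfold sphereGrad
  rw [← integral_finsetSum _ fun i _ => integrable_sphereGrad hn hη (hf i) x, ← integral_smul]
  congr 1
  ext1 v
  rw [← Finset.sum_smul, smul_smul ((m : ℝ)⁻¹)]
  congr 1
  rw [← Finset.sum_div, ← Finset.mul_sum]
  ring

end SmoothingBounds

-- Contraction of disagreement under mixing.

section Consensus

variable {m n : ℕ}

lemma bddAbove_eigAbs (W : Matrix (Fin m) (Fin m) ℝ) :
    BddAbove {r : ℝ | ∃ (l : ℝ) (u : Fin m → ℝ),
      u ≠ 0 ∧ ∑ i, u i = 0 ∧ W.mulVec u = l • u ∧ r = |l|} := by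
  set T := LinearMap.toContinuousLinearMap (Matrix.toLin' W)
  refine ⟨‖T‖, ?_⟩
  rintro r ⟨l, u, hu, -, he, rfl⟩
  have h := T.le_opNorm u
  have e : T u = l • u := he
  rw [e, norm_smul] at h
  exact le_of_mul_le_mul_right h (norm_pos_iff.2 hu)

/-- The sum-zero vectors form an invariant subspace. The symmetric restriction has an orthonormal
eigenbasis there, and each of its eigenvalues is among those over which `secondEigAbs` takes the
supremum. -/
lemma sum_sq_mulVec_le {W : Matrix (Fin m) (Fin m) ℝ} (hs : W.IsSymm)
    (hd : W ∈ doublyStochastic ℝ (Fin m)) {u : Fin m → ℝ} (hu : ∑ i, u i = 0) :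
    ∑ i, W.mulVec u i ^ 2 ≤ secondEigAbs W ^ 2 * ∑ i, u i ^ 2 := by
  rw [mem_doublyStochastic_iff_sum] at hd
  set T := Matrix.toEuclideanLin W with hT
  have hsym : T.IsSymmetric := by
    rw [hT, Matrix.isSymmetric_toEuclideanLin_iff]
    simpa [Matrix.IsHermitian] using hs.eq
  let V : Submodule ℝ (EuclideanSpace ℝ (Fin m)) :=
    LinearMap.ker (∑ i, (LinearMap.proj i : (Fin m → ℝ) →ₗ[ℝ] ℝ) ∘ₗ
      (WithLp.linearEquiv 2 ℝ (Fin m → ℝ)).toLinearMap)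
  have hmem : ∀ v : EuclideanSpace ℝ (Fin m), v ∈ V ↔ ∑ i, v i = 0 := by
    intro v; simp [V, LinearMap.mem_ker]
  have hTapp : ∀ (v : EuclideanSpace ℝ (Fin m)) i, T v i = W.mulVec (WithLp.ofLp v) i := by
    intro v i; simp [hT]
  have hinv : ∀ v ∈ V, T v ∈ V := by
    intro v hv
    rw [hmem] at hv ⊢
    simp_rw [hTapp, Matrix.mulVec, dotProduct]
    rw [Finset.sum_comm]
    simp_rw [← Finset.sum_mul, hd.2.2, one_mul]
    exact hv
  have hsym' := hsym.restrict_invariant hinv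
  set T' := T.restrict hinv with hT'
  set b := hsym'.eigenvectorBasis rfl with hb
  have hlam : ∀ i, |hsym'.eigenvalues rfl i| ≤ secondEigAbs W := by
    intro i
    refine le_csSup (bddAbove_eigAbs W) ⟨hsym'.eigenvalues rfl i,
      WithLp.ofLp ((b i : V) : EuclideanSpace ℝ (Fin m)), ?_, ?_, ?_, rfl⟩
    · intro h
      apply b.orthonormal.ne_zero i
      apply Subtype.ext
      exact (WithLp.ofLp_eq_zero 2).1 h
    · exact (hmem _).1 (b i).2
    · have h := hsym'.apply_eigenvectorBasis rfl i
      have h2 := congrArg (fun z : V => WithLp.ofLp (z : EuclideanSpace ℝ (Fin m))) h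
      ext j
      have h3 := congrFun h2 j
      rw [← hTapp]
      simpa [hT', -LinearMap.IsSymmetric.apply_eigenvectorBasis] using h3
  set v : V := ⟨WithLp.toLp 2 u, (hmem _).2 hu⟩ with hv
  have e1 : ∑ i, W.mulVec u i ^ 2 = ‖T' v‖ ^ 2 := by
    have : ‖T' v‖ = ‖T (WithLp.toLp 2 u)‖ := rfl
    rw [this, EuclideanSpace.norm_sq_eq]
    simp [hTapp]
  have e2 : ∑ i, u i ^ 2 = ‖v‖ ^ 2 := by
    have : ‖v‖ = ‖(WithLp.toLp 2 u : EuclideanSpace ℝ (Fin m))‖ := rfl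
    rw [this, EuclideanSpace.norm_sq_eq]
    simp
  rw [e1, e2, ← b.repr.norm_map, ← b.repr.norm_map v, EuclideanSpace.norm_sq_eq,
    EuclideanSpace.norm_sq_eq, Finset.mul_sum]
  refine Finset.sum_le_sum fun i _ => ?_
  rw [hb, hsym'.eigenvectorBasis_apply_self_apply, norm_mul, mul_pow]
  gcongr
  exact hlam i

lemma rowMean_add (x y : Fin m → Vec n) :
    rowMean (fun i => x i + y i) = rowMean x + rowMean y := by
  simp [rowMean, Finset.sum_add_distrib]

lemma rowMean_sub (x y : Fin m → Vec n) :
    rowMean (fun i => x i - y i) = rowMean x - rowMean y := by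
  simp [rowMean, Finset.sum_sub_distrib, smul_sub]

lemma rowMean_smul (a : ℝ) (x : Fin m → Vec n) :
    rowMean (fun i => a • x i) = a • rowMean x := by
  simp [rowMean, ← Finset.smul_sum, smul_comm a]

lemma sum_eq_smul_rowMean (hm : 0 < m) (x : Fin m → Vec n) : ∑ i, x i = (m : ℝ) • rowMean x := by
  rw [rowMean, smul_inv_smul₀ (Nat.cast_ne_zero.2 hm.ne')]

lemma sum_sub_rowMean (hm : 0 < m) (x : Fin m → Vec n) : ∑ i, (x i - rowMean x) = 0 := by
  rw [Finset.sum_sub_distrib, sum_eq_smul_rowMean hm x]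
  simp [← Nat.cast_smul_eq_nsmul ℝ]

lemma consSq_nonneg (x : Fin m → Vec n) : 0 ≤ consSq x :=
  Finset.sum_nonneg fun _ _ => sq_nonneg _

lemma consSq_eq (hm : 0 < m) (x : Fin m → Vec n) :
    consSq x = ∑ i, ‖x i‖ ^ 2 - m * ‖rowMean x‖ ^ 2 := by
  unfold consSq
  simp_rw [norm_sub_sq_real]
  rw [Finset.sum_add_distrib, Finset.sum_sub_distrib, ← Finset.mul_sum, ← sum_inner,
    sum_eq_smul_rowMean hm x, inner_smul_left, real_inner_self_eq_norm_sq]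
  simp
  ring

lemma consSq_le_sum (hm : 0 < m) (x : Fin m → Vec n) : consSq x ≤ ∑ i, ‖x i‖ ^ 2 := by
  rw [consSq_eq hm]
  have : 0 ≤ (m : ℝ) * ‖rowMean x‖ ^ 2 := by positivity
  linarith

lemma norm_rowMean_sq_le (hm : 0 < m) (x : Fin m → Vec n) :
    ‖rowMean x‖ ^ 2 ≤ (m : ℝ)⁻¹ * ∑ i, ‖x i‖ ^ 2 := by
  have h := consSq_nonneg x
  have hm' : (0 : ℝ) < m := Nat.cast_pos.2 hm
  rw [consSq_eq hm] at h
  rw [← div_eq_inv_mul, le_div_iff₀ hm']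
  linarith

lemma consSq_smul (a : ℝ) (x : Fin m → Vec n) : consSq (fun i => a • x i) = a ^ 2 * consSq x := by
  unfold consSq
  rw [rowMean_smul, Finset.mul_sum]
  refine Finset.sum_congr rfl fun i _ => ?_
  rw [← smul_sub, norm_smul, mul_pow, Real.norm_eq_abs, sq_abs]

/-- Young's inequality with a weight: β is small enough that (1 + β)ρ² < 1, so mixing still
contracts after the split. -/
lemma norm_add_sq_le_weighted {E : Type*} [NormedAddCommGroup E] [InnerProductSpace ℝ E]
    {β : ℝ} (hβ : 0 < β) (x y : E) :
    ‖x + y‖ ^ 2 ≤ (1 + β) * ‖x‖ ^ 2 + (1 + 1 / β) * ‖y‖ ^ 2 := by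
  have h1 := norm_add_le x y
  have h2 : ‖x + y‖ ^ 2 ≤ (‖x‖ + ‖y‖) ^ 2 := by gcongr
  have h3 : 0 ≤ (β * ‖x‖ - ‖y‖) ^ 2 / β := by positivity
  have h4 : (β * ‖x‖ - ‖y‖) ^ 2 / β = β * ‖x‖ ^ 2 - 2 * ‖x‖ * ‖y‖ + 1 / β * ‖y‖ ^ 2 := by
    field_simp; ring
  nlinarith

lemma consSq_add_le {β : ℝ} (hβ : 0 < β) (x y : Fin m → Vec n) :
    consSq (fun i => x i + y i) ≤ (1 + β) * consSq x + (1 + 1 / β) * consSq y := by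
  unfold consSq
  rw [Finset.mul_sum, Finset.mul_sum, ← Finset.sum_add_distrib, rowMean_add]
  refine Finset.sum_le_sum fun i _ => ?_
  rw [add_sub_add_comm]
  exact norm_add_sq_le_weighted hβ _ _

lemma rowMean_mix {W : Matrix (Fin m) (Fin m) ℝ} (hd : W ∈ doublyStochastic ℝ (Fin m))
    (x : Fin m → Vec n) : rowMean (mix W x) = rowMean x := by
  rw [mem_doublyStochastic_iff_sum] at hd
  unfold rowMean mix
  rw [Finset.sum_comm]
  simp_rw [← Finset.sum_smul, hd.2.2, one_smul]

/-- Each coordinate column of x - 1x̄ sums to zero, so the spectral bound applies column by column.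
-/
lemma consSq_mix_le (hm : 0 < m) {W : Matrix (Fin m) (Fin m) ℝ} (hs : W.IsSymm)
    (hd : W ∈ doublyStochastic ℝ (Fin m)) (x : Fin m → Vec n) :
    consSq (mix W x) ≤ secondEigAbs W ^ 2 * consSq x := by
  have hd' := mem_doublyStochastic_iff_sum.1 hd
  have e : ∀ i, mix W x i - rowMean (mix W x) = ∑ j, W i j • (x j - rowMean x) := by
    intro i
    simp_rw [smul_sub, Finset.sum_sub_distrib, ← Finset.sum_smul, hd'.2.1, one_smul, rowMean_mix hd]
    rfl
  unfold consSq
  simp_rw [e, EuclideanSpace.norm_sq_eq, Real.norm_eq_abs, sq_abs]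
  rw [Finset.sum_comm, Finset.sum_comm (s := Finset.univ (α := Fin m)), Finset.mul_sum]
  refine Finset.sum_le_sum fun k _ => ?_
  have h := sum_sq_mulVec_le hs hd (u := fun i => (x i - rowMean x) k) (by
    have := congrArg (fun z : Vec n => z k) (sum_sub_rowMean hm x)
    simpa using this)
  simpa [Matrix.mulVec, dotProduct] using h

lemma consSq_mix_add_le (hm : 0 < m) {W : Matrix (Fin m) (Fin m) ℝ} (hs : W.IsSymm)
    (hd : W ∈ doublyStochastic ℝ (Fin m)) {β : ℝ} (hβ : 0 < β) (x y : Fin m → Vec n) :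
    consSq (fun i => mix W x i + y i)
      ≤ (1 + β) * secondEigAbs W ^ 2 * consSq x + (1 + 1 / β) * consSq y := by
  refine (consSq_add_le hβ _ _).trans ?_
  rw [mul_assoc]
  gcongr
  exact consSq_mix_le hm hs hd x

end Consensus

-- The lower-level variational inequality and its stochastic approximation.

section LowerLevel

open Filter Topology

variable {m n p d : ℕ}

lemma enorm_sq_eq_ofReal {E : Type*} [NormedAddCommGroup E] (x : E) :
    ‖x‖ₑ ^ 2 = ENNReal.ofReal (‖x‖ ^ 2) := by
  rw [ENNReal.ofReal_pow (norm_nonneg x), ofReal_norm]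

lemma isNearest_proj {C : Set (Vec p)} (hne : C.Nonempty) (hcl : IsClosed C) (hcv : Convex ℝ C)
    (u : Vec p) : IsNearest C u (proj C u) := by
  have h : ∃ y, IsNearest C u y := by
    obtain ⟨y, hy, hyu⟩ := exists_norm_eq_iInf_of_complete_convex hne hcl.isComplete hcv u
    refine ⟨y, hy, fun w hw => ?_⟩
    rw [hyu]
    exact ciInf_le ⟨0, by rintro _ ⟨w, rfl⟩; exact norm_nonneg _⟩ (⟨w, hw⟩ : C)
  unfold proj
  rw [dif_pos h]
  exact h.choose_spec

lemma IsNearest.inner_le_zero {C : Set (Vec p)} (hcv : Convex ℝ C) {u y w : Vec p}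
    (h : IsNearest C u y) (hw : w ∈ C) : inner ℝ (u - y) (w - y) ≤ 0 := by
  have : Nonempty C := ⟨⟨y, h.1⟩⟩
  refine (norm_eq_iInf_iff_real_inner_le_zero hcv h.1).1 (le_antisymm ?_ ?_) w hw
  · exact le_ciInf fun w => h.2 w w.2
  · exact ciInf_le ⟨0, by rintro _ ⟨w, rfl⟩; exact norm_nonneg _⟩ (⟨y, h.1⟩ : C)

/-- A solution z is the projection of z - aΦ(z), and projection is nonexpansive. -/
lemma norm_sub_visol_le {C : Set (Vec p)} (hcv : Convex ℝ C) {Φ : Vec p → Vec p} {u y z : Vec p}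
    (h : IsNearest C u y) (hz : IsVISol C Φ z) {a : ℝ} (ha : 0 ≤ a) :
    ‖y - z‖ ≤ ‖u - (z - a • Φ z)‖ := by
  have h1 := h.inner_le_zero hcv hz.1
  have h2 := mul_nonneg ha (hz.2 y h.1)
  have h3 : ‖y - z‖ ^ 2 ≤ inner ℝ (u - (z - a • Φ z)) (y - z) := by
    have e : u - (z - a • Φ z) = (u - y) + (y - z) + a • Φ z := by abel
    rw [e, inner_add_left, inner_add_left, real_inner_self_eq_norm_sq, inner_smul_left]
    have e2 : inner ℝ (u - y) (y - z) = - inner ℝ (u - y) (z - y) := by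
      rw [← inner_neg_right, neg_sub]
    rw [e2]
    simp only [conj_trivial]
    linarith
  have h4 := h3.trans (real_inner_le_norm _ _)
  by_contra hlt
  push Not at hlt
  nlinarith [norm_nonneg (u - (z - a • Φ z))]

namespace MPEC

variable {P : MPEC m n p d} {z : Vec n → Vec p} {μF LF ν : ℝ}

lemma LowerMonotone.isNearest (hL : P.LowerMonotone μF LF ν) (x : Vec n) (u : Vec p) :
    IsNearest (P.Z x) u (proj (P.Z x) u) :=
  isNearest_proj (hL.nonempty x) (hL.closed x) (hL.convex x) u

lemma LowerMonotone.norm_sq_sub_smul_le (hL : P.LowerMonotone μF LF ν) {a : ℝ} (ha : 0 ≤ a)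
    (x : Vec n) (z₁ z₂ : Vec p) :
    ‖(z₁ - z₂) - a • (P.F x z₁ - P.F x z₂)‖ ^ 2
      ≤ (1 - 2 * a * μF + a ^ 2 * LF ^ 2) * ‖z₁ - z₂‖ ^ 2 := by
  have h1 := hL.strong_mono x z₁ z₂
  have h2 := hL.lipschitz x z₁ z₂
  have h3 : ‖P.F x z₁ - P.F x z₂‖ ^ 2 ≤ LF ^ 2 * ‖z₁ - z₂‖ ^ 2 := by
    rw [← mul_pow]; gcongr
  rw [norm_sub_sq_real, inner_smul_right, norm_smul, mul_pow, Real.norm_eq_abs, sq_abs,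
    real_inner_comm]
  nlinarith [mul_le_mul_of_nonneg_left h1 ha, mul_le_mul_of_nonneg_left h3 (sq_nonneg a)]

/-- Split the sample into mean and noise: the mean part contracts by strong monotonicity, the cross
term with the centred noise integrates to zero, and the noise adds a²ν². Truncating the factor at 0
keeps it nonnegative without comparing LF and μF. -/
lemma lintegral_proj_step_le (hW : P.WellPosed z) (hL : P.LowerMonotone μF LF ν)
    (hz : ∀ x, IsVISol (P.Z x) (P.F x) (z x)) {a : ℝ} (ha : 0 ≤ a) (x : Vec n) {z' : Vec p}
    (hz' : z' ∈ P.Z x) :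
    ∫⁻ s, ‖proj (P.Z x) (z' - a • P.Fs x z' s) - z x‖ₑ ^ 2 ∂P.lawζ
      ≤ ENNReal.ofReal (max (1 - 2 * a * μF + a ^ 2 * LF ^ 2) 0) * ‖z' - z x‖ₑ ^ 2
        + ENNReal.ofReal (a ^ 2 * ν ^ 2) := by
  have hprob := hW.prob_ζ
  set A := (z' - z x) - a • (P.F x z' - P.F x (z x)) with hA
  set N : Vec d → Vec p := fun s => P.Fs x z' s - P.F x z' with hN
  have hNi : Integrable N P.lawζ := (hW.int_F x z').sub (integrable_const _)
  have hN0 : ∫ s, N s ∂P.lawζ = 0 := by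
    rw [hN, integral_sub (hW.int_F x z') (integrable_const _)]
    simp [F]
  have hvar := hL.variance x z' hz'
  have hN2 : Integrable (fun s => ‖N s‖ ^ 2) P.lawζ := by
    refine ⟨(hNi.aestronglyMeasurable.norm.pow 2), ?_⟩
    rw [hasFiniteIntegral_iff_ofReal (.of_forall fun s => sq_nonneg _)]
    simp_rw [← enorm_sq_eq_ofReal]
    exact hvar.trans_lt ENNReal.ofReal_lt_top
  have hN2le : ∫ s, ‖N s‖ ^ 2 ∂P.lawζ ≤ ν ^ 2 := by
    rw [integral_eq_lintegral_of_nonneg_ae (.of_forall fun s => sq_nonneg _)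
      hN2.aestronglyMeasurable]
    simp_rw [← enorm_sq_eq_ofReal]
    exact ENNReal.toReal_le_of_le_ofReal (sq_nonneg _) hvar
  have hpt : ∀ s, ‖proj (P.Z x) (z' - a • P.Fs x z' s) - z x‖ₑ ^ 2
      ≤ ENNReal.ofReal (‖A‖ ^ 2 - 2 * a * inner ℝ A (N s) + a ^ 2 * ‖N s‖ ^ 2) := by
    intro s
    have h := norm_sub_visol_le (hL.convex x) (hL.isNearest x (z' - a • P.Fs x z' s)) (hz x) ha
    have e : z' - a • P.Fs x z' s - (z x - a • P.F x (z x)) = A - a • N s := by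
      simp only [hA, hN, smul_sub]; abel
    rw [e] at h
    rw [enorm_sq_eq_ofReal]
    apply ENNReal.ofReal_le_ofReal
    calc _ ≤ ‖A - a • N s‖ ^ 2 := by gcongr
      _ = _ := by
        rw [norm_sub_sq_real, inner_smul_right, norm_smul, mul_pow, Real.norm_eq_abs, sq_abs]
        ring
  have hi1 : Integrable (fun s => 2 * a * inner ℝ A (N s)) P.lawζ := (hNi.const_inner A).const_mul _
  have hi2 : Integrable (fun s => a ^ 2 * ‖N s‖ ^ 2) P.lawζ := hN2.const_mul _
  refine (lintegral_mono hpt).trans ?_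
  rw [← ofReal_integral_eq_lintegral_ofReal]
  · rw [enorm_sq_eq_ofReal, ← ENNReal.ofReal_mul (le_max_right _ _),
      ← ENNReal.ofReal_add (by positivity) (by positivity)]
    apply ENNReal.ofReal_le_ofReal
    have hi3 : Integrable (fun s => ‖A‖ ^ 2 - 2 * a * inner ℝ A (N s)) P.lawζ :=
      (integrable_const _).sub hi1
    rw [integral_add hi3 hi2, integral_sub (integrable_const _) hi1,
      integral_const_mul, integral_const_mul, integral_inner hNi, hN0]
    have h4 := hL.norm_sq_sub_smul_le ha x z' (z x)
    simp only [integral_const, probReal_univ, one_smul, inner_zero_right, mul_zero, sub_zero]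
    refine add_le_add (h4.trans ?_) ?_
    · gcongr; exact le_max_left _ _
    · gcongr
  · exact ((integrable_const _).sub hi1).add hi2
  · refine .of_forall fun s => ?_
    have : ‖A - a • N s‖ ^ 2 = ‖A‖ ^ 2 - 2 * a * inner ℝ A (N s) + a ^ 2 * ‖N s‖ ^ 2 := by
      rw [norm_sub_sq_real, inner_smul_right, norm_smul, mul_pow, Real.norm_eq_abs, sq_abs]
      ring
    simp only [← this]
    exact sq_nonneg _

lemma WellPosed.measurable_F (hW : P.WellPosed z) :
    Measurable fun q : Vec n × Vec p => P.F q.1 q.2 := by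
  have := hW.prob_ζ
  have h : StronglyMeasurable fun r : (Vec n × Vec p) × Vec d => P.Fs r.1.1 r.1.2 r.2 := by
    have := hW.meas_F.comp (f := fun r : (Vec n × Vec p) × Vec d => (r.1.1, r.1.2, r.2))
      (by fun_prop)
    exact this.stronglyMeasurable
  exact h.integral_prod_right'.measurable

/-- The exact projection iteration for the lower-level problem. -/
def exactIter (P : MPEC m n p d) (a : ℝ) : ℕ → Vec n → Vec p
  | 0, x => proj (P.Z x) 0
  | t + 1, x => proj (P.Z x) (exactIter P a t x - a • P.F x (exactIter P a t x))

/-- The solution map is given only pointwise. It is the pointwise limit of exact projection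
iterates, which are measurable in x. -/
lemma measurable_visol (hμ : 0 < μF) (hW : P.WellPosed z) (hL : P.LowerMonotone μF LF ν)
    (hz : ∀ x, IsVISol (P.Z x) (P.F x) (z x)) : Measurable z := by
  -- The summand μF² keeps the denominator positive even if LF = 0 and makes aμF ≤ 1; the squared
  -- error then contracts by 1 - aμF.
  set a := μF / (LF ^ 2 + μF ^ 2) with ha
  have hden : 0 < LF ^ 2 + μF ^ 2 := by positivity
  have ha0 : 0 ≤ a := by positivity
  set r := 1 - a * μF with hr
  have hr1 : r < 1 := by
    have : 0 < a * μF := by positivity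
    linarith
  have hr0 : 0 ≤ r := by
    have : a * μF ≤ 1 := by
      rw [ha, div_mul_eq_mul_div, div_le_one hden]
      nlinarith [sq_nonneg LF]
    linarith
  have hstep : 1 - 2 * a * μF + a ^ 2 * LF ^ 2 ≤ r := by
    have h1 : a * (LF ^ 2 + μF ^ 2) = μF := by rw [ha]; field_simp
    have h2 : a * LF ^ 2 ≤ μF := by nlinarith [mul_nonneg ha0 (sq_nonneg μF)]
    nlinarith
  have hmeas : ∀ t, Measurable (P.exactIter a t) := by
    intro t
    induction t with
    | zero => exact hW.meas_proj.comp (measurable_id.prodMk measurable_const)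
    | succ t ih =>
      have h1 := hW.measurable_F.comp (measurable_id.prodMk ih)
      exact hW.meas_proj.comp (measurable_id.prodMk (ih.sub (h1.const_smul a)))
  refine measurable_of_tendsto_metrizable hmeas (tendsto_pi_nhds.2 fun x => ?_)
  have hb : ∀ t, ‖P.exactIter a t x - z x‖ ^ 2 ≤ r ^ t * ‖P.exactIter a 0 x - z x‖ ^ 2 := by
    intro t
    induction t with
    | zero => simp
    | succ t ih =>
      have h := norm_sub_visol_le (hL.convex x) (hL.isNearest x (P.exactIter a t x
        - a • P.F x (P.exactIter a t x))) (hz x) ha0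
      have e : P.exactIter a t x - a • P.F x (P.exactIter a t x) - (z x - a • P.F x (z x))
          = (P.exactIter a t x - z x) - a • (P.F x (P.exactIter a t x) - P.F x (z x)) := by
        rw [smul_sub]; abel
      rw [e] at h
      have h2 := hL.norm_sq_sub_smul_le ha0 x (P.exactIter a t x) (z x)
      calc ‖P.exactIter a (t + 1) x - z x‖ ^ 2 ≤ _ := by
            rw [exactIter]
            exact pow_le_pow_left₀ (norm_nonneg _) h 2
        _ ≤ _ := h2
        _ ≤ r * ‖P.exactIter a t x - z x‖ ^ 2 := by gcongr
        _ ≤ r * (r ^ t * ‖P.exactIter a 0 x - z x‖ ^ 2) := by gcongr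
        _ = _ := by ring
  have h0 : Tendsto (fun t => ‖P.exactIter a t x - z x‖ ^ 2) atTop (𝓝 0) := by
    refine squeeze_zero (fun t => sq_nonneg _) hb ?_
    simpa using (tendsto_pow_atTop_nhds_zero_of_lt_one hr0 hr1).mul_const
      (‖P.exactIter a 0 x - z x‖ ^ 2)
  rw [tendsto_iff_norm_sub_tendsto_zero]
  have := h0.sqrt
  simpa [Real.sqrt_sq] using this

end MPEC

/-- The bound on the mean squared error of the lower-level stochastic approximation after `t`
steps. -/
def saBound (μF LF ν D γh Γ : ℝ) : ℕ → ℝ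
  | 0 => max D 0
  | t + 1 => max (1 - 2 * (γh / (t + Γ)) * μF + (γh / (t + Γ)) ^ 2 * LF ^ 2) 0
      * saBound μF LF ν D γh Γ t + (γh / (t + Γ)) ^ 2 * ν ^ 2

lemma saBound_nonneg (μF LF ν D γh Γ : ℝ) (t : ℕ) : 0 ≤ saBound μF LF ν D γh Γ t := by
  induction t with
  | zero => exact le_max_right _ _
  | succ t ih => unfold saBound; positivity

lemma exists_saBound_le {μF LF ν D γh Γ : ℝ} (hμ : 0 < μF) (hγ : 1 / (2 * μF) < γh) (hΓ : 0 < Γ) :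
    ∃ C, 0 ≤ C ∧ ∀ t, saBound μF LF ν D γh Γ t ≤ C / (t + Γ) := by
  set e := saBound μF LF ν D γh Γ with he
  set a := 2 * γh * μF with ha
  set b := γh ^ 2 * LF ^ 2 with hb
  set d := γh ^ 2 * ν ^ 2 with hd
  have ha1 : 1 < a := by rw [div_lt_iff₀ (by positivity)] at hγ; linarith
  have hb0 : 0 ≤ b := by positivity
  have hd0 : 0 ≤ d := by positivity
  -- Beyond T, with s = t + Γ, the factor 1 - a/s + b/s² is nonnegative and b ≤ (a - 1)s/2.
  obtain ⟨T, hT⟩ := exists_nat_ge (2 * b / (a - 1) + a)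
  -- The sum covers the first T + 1 errors; the other term makes d ≤ C(a - 1)/2. Thus b and d each
  -- use half of the margin a - 1 > 0 in the induction.
  set C := 2 * d / (a - 1) + ∑ t ∈ Finset.range (T + 1), e t * (t + Γ) with hC
  have hterm : ∀ t, 0 ≤ e t * ((t : ℝ) + Γ) := fun t =>
    mul_nonneg (saBound_nonneg _ _ _ _ _ _ t) (by positivity)
  have hd1 : 0 ≤ 2 * d / (a - 1) := div_nonneg (by positivity) (by linarith)
  have hsum : 0 ≤ ∑ t ∈ Finset.range (T + 1), e t * ((t : ℝ) + Γ) :=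
    Finset.sum_nonneg fun t _ => hterm t
  have hC0 : 0 ≤ C := by positivity
  have hsmall : ∀ t ≤ T, e t ≤ C / (t + Γ) := by
    intro t ht
    rw [le_div_iff₀ (by positivity)]
    have := Finset.single_le_sum (f := fun t : ℕ => e t * ((t : ℝ) + Γ)) (fun t _ => hterm t)
      (Finset.mem_range.2 (Nat.lt_succ_of_le ht))
    linarith
  refine ⟨C, hC0, fun t => ?_⟩
  induction t with
  | zero => exact hsmall 0 (Nat.zero_le _)
  | succ t ih =>
    rcases Nat.lt_or_ge T (t + 1) with h | h
    · have htT : (T : ℝ) ≤ t := by exact_mod_cast Nat.lt_succ_iff.1 h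
      set s := (t : ℝ) + Γ with hs
      have hb1 : 0 ≤ 2 * b / (a - 1) := div_nonneg (by positivity) (by linarith)
      have hs0 : 0 < s := by positivity
      have hsa : a ≤ s := by linarith
      have hsb : 2 * b / (a - 1) ≤ s := by linarith
      rw [div_le_iff₀ (by linarith)] at hsb
      have hq : 1 - 2 * (γh / s) * μF + (γh / s) ^ 2 * LF ^ 2 = 1 - a / s + b / s ^ 2 := by
        rw [ha, hb]; field_simp
      have hq0 : 0 ≤ 1 - a / s + b / s ^ 2 := by
        have : a / s ≤ 1 := (div_le_one hs0).2 hsa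
        have : 0 ≤ b / s ^ 2 := by positivity
        linarith
      have hstep : e (t + 1) = (1 - a / s + b / s ^ 2) * e t + d / s ^ 2 := by
        have : e (t + 1) = max (1 - 2 * (γh / s) * μF + (γh / s) ^ 2 * LF ^ 2) 0 * e t
            + (γh / s) ^ 2 * ν ^ 2 := rfl
        rw [this, hq, max_eq_left hq0, hd]
        congr 1
        field_simp
      have hCd : 2 * d ≤ C * (a - 1) := by
        have : 2 * d / (a - 1) ≤ C := by linarith
        rwa [div_le_iff₀ (by linarith)] at this
      rw [hstep]
      calc (1 - a / s + b / s ^ 2) * e t + d / s ^ 2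
          ≤ (1 - a / s + b / s ^ 2) * (C / s) + d / s ^ 2 := by gcongr
        _ = (C * (s ^ 2 - a * s + b) + d * s) / s ^ 3 := by field_simp
        _ ≤ C * (s - 1) / s ^ 2 := by
          rw [div_le_div_iff₀ (by positivity) (by positivity)]
          have : C * (s ^ 2 - a * s + b) + d * s ≤ C * (s - 1) * s := by nlinarith
          calc _ ≤ C * (s - 1) * s * s ^ 2 := by gcongr
            _ = _ := by ring
        _ ≤ C / (s + 1) := by
          rw [div_le_div_iff₀ (by positivity) (by positivity)]
          nlinarith
        _ = C / ((t + 1 : ℕ) + Γ) := by rw [hs]; push_cast; ring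
    · exact hsmall _ h

end LowerLevel

-- Which sources of randomness determine which quantities.

section Information

open Filter Topology

/-- Freezing: the joint law is a product, so Tonelli averages over the fresh sample with the past
held fixed. It replaces conditional expectations throughout. -/
lemma lintegral_comp_prod_of_indepFun {Ω α β : Type*} {mΩ : MeasurableSpace Ω}
    [MeasurableSpace α] [MeasurableSpace β] {μ : Measure Ω} [IsFiniteMeasure μ] {X : Ω → α}
    {Y : Ω → β} (hX : Measurable X) (hY : Measurable Y) (h : IndepFun X Y μ)
    {Φ : α × β → ℝ≥0∞} (hΦ : Measurable Φ) :
    ∫⁻ ω, Φ (X ω, Y ω) ∂μ = ∫⁻ ω, ∫⁻ y, Φ (X ω, y) ∂(μ.map Y) ∂μ := by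
  have h1 := (indepFun_iff_map_prod_eq_prod_map_map hX.aemeasurable hY.aemeasurable).1 h
  rw [← lintegral_map (f := Φ) hΦ (hX.prodMk hY), h1, lintegral_prod _ hΦ.aemeasurable,
    lintegral_map (f := fun x => ∫⁻ y, Φ (x, y) ∂(μ.map Y)) hΦ.lintegral_prod_right' hX]

variable {Ω : Type*} {m n p d : ℕ}

namespace Source

/-- The sources revealed before iteration `k`. -/
def past (k : ℕ) : Set (Source m)
  | .init => True
  | .xi _ l => l < k
  | .dir _ l => l < k
  | .zeta _ l _ _ => l < k

/-- The sources known when the lower-level calls of iteration `k` are made. -/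
def knownSet (k : ℕ) : Set (Source m) := {s | s.knownAt k}

/-- The sources revealed after `t` steps of the lower-level call `b` of agent `i` in
iteration `k`. -/
def duringCall (k : ℕ) (i : Fin m) (b : Bool) (t : ℕ) : Set (Source m) :=
  knownSet k ∪ {s | ∃ t' < t, s = zeta i k b t'}

/-- The sources that determine the lower-level outputs of iteration `k`. -/
def afterCalls (k : ℕ) : Set (Source m) :=
  knownSet k ∪ {s | ∃ i b t, s = zeta i k b t}

lemma past_mono {k l : ℕ} (h : k ≤ l) : (past k : Set (Source m)) ⊆ past l := by
  intro s hs
  cases s with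
  | init => exact trivial
  | xi i j => exact lt_of_lt_of_le (b := k) hs h
  | dir i j => exact lt_of_lt_of_le (b := k) hs h
  | zeta i j b t => exact lt_of_lt_of_le (b := k) hs h

lemma past_subset_knownSet (k : ℕ) : (past k : Set (Source m)) ⊆ knownSet k := by
  intro s hs
  cases s with
  | init => exact trivial
  | xi i j => exact hs
  | dir i j => exact le_of_lt (b := k) hs
  | zeta i j b t => exact hs

lemma knownSet_subset_past (k : ℕ) : (knownSet k : Set (Source m)) ⊆ past (k + 1) := by
  intro s hs
  cases s with
  | init => exact trivial
  | xi i j => exact Nat.lt_succ_of_lt hs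
  | dir i j => exact Nat.lt_succ_of_le hs
  | zeta i j b t => exact Nat.lt_succ_of_lt hs

lemma afterCalls_subset_past (k : ℕ) : (afterCalls k : Set (Source m)) ⊆ past (k + 1) := by
  rintro s (hs | ⟨i, b, t, rfl⟩)
  · exact knownSet_subset_past k hs
  · exact Nat.lt_succ_self k

lemma duringCall_subset_afterCalls (k : ℕ) (i : Fin m) (b : Bool) (t : ℕ) :
    duringCall k i b t ⊆ afterCalls k := by
  rintro s (hs | ⟨t', -, rfl⟩)
  · exact Or.inl hs
  · exact Or.inr ⟨i, b, t', rfl⟩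

lemma zeta_notMem_duringCall (k : ℕ) (i : Fin m) (b : Bool) (t : ℕ) :
    zeta i k b t ∉ duringCall k i b t := by
  rintro (h | ⟨r, hr, h⟩)
  · exact lt_irrefl k h
  · cases h
    exact lt_irrefl _ hr

lemma xi_notMem_afterCalls (k : ℕ) (i : Fin m) : xi i k ∉ afterCalls k := by
  rintro (h | ⟨j, b, t, h⟩)
  · exact lt_irrefl k h
  · cases h

lemma xi_notMem_knownSet (k : ℕ) (i : Fin m) : xi i k ∉ knownSet k := fun h => lt_irrefl k h

lemma dir_notMem_past (k : ℕ) (i : Fin m) : dir i k ∉ past k := fun h => lt_irrefl k h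

end Source

namespace Samples

/-- The σ-algebra generated by a set of sources. -/
@[reducible] def sig (S : Samples Ω m n d) (A : Set (Source m)) : MeasurableSpace Ω :=
  ⨆ s ∈ A, S.sigma s

variable {S : Samples Ω m n d}

lemma sig_mono {A B : Set (Source m)} (h : A ⊆ B) : S.sig A ≤ S.sig B :=
  biSup_mono h

lemma sigma_le_sig {A : Set (Source m)} {s : Source m} (h : s ∈ A) : S.sigma s ≤ S.sig A :=
  le_biSup S.sigma h

variable [mΩ : MeasurableSpace Ω] {μ : Measure Ω} {P : MPEC m n p d} {η : ℝ}

lemma IsIID.sigma_le (hS : S.IsIID μ P η) (s : Source m) : S.sigma s ≤ mΩ := by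
  cases s with
  | init => exact hS.init_le
  | xi i k => exact (hS.meas_ξ i k).comap_le
  | dir i k => exact (hS.meas_v i k).comap_le
  | zeta i k b t => exact (hS.meas_ζ i k b t).comap_le

lemma IsIID.sig_le (hS : S.IsIID μ P η) (A : Set (Source m)) : S.sig A ≤ mΩ :=
  iSup₂_le fun s _ => hS.sigma_le s

lemma IsIID.indepFun (hS : S.IsIID μ P η) {A : Set (Source m)} {s : Source m} (hs : s ∉ A)
    {α β : Type*} [MeasurableSpace α] [MeasurableSpace β] {X : Ω → α} {Y : Ω → β}
    (hX : Measurable[S.sig A] X) (hY : Measurable[S.sigma s] Y) : IndepFun X Y μ := by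
  have h := indep_iSup_of_disjoint hS.sigma_le hS.indep (S := A) (T := {s})
    (Set.disjoint_singleton_right.2 hs)
  rw [IndepFun_iff_Indep]
  refine indep_of_indep_of_le_left (indep_of_indep_of_le_right h ?_) hX.comap_le
  exact hY.comap_le.trans (sigma_le_sig (Set.mem_singleton s))

end Samples

section Comp

variable {mΩ : MeasurableSpace Ω} {P : MPEC m n p d} {z : Vec n → Vec p}

lemma measurable_mix {W : Matrix (Fin m) (Fin m) ℝ} {x : Fin m → Ω → Vec n}
    (hx : ∀ i, Measurable (x i)) (i : Fin m) : Measurable fun ω => mix W (fun j => x j ω) i :=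
  Finset.measurable_sum _ fun j _ => (hx j).const_smul (W i j)

lemma MPEC.WellPosed.measurable_gHat (hW : P.WellPosed z) (η : ℝ) (i : Fin m)
    {x v : Ω → Vec n} {z₁ z₂ : Ω → Vec p} {s : Ω → Vec d} (hx : Measurable x) (hv : Measurable v)
    (hz₁ : Measurable z₁) (hz₂ : Measurable z₂) (hs : Measurable s) :
    Measurable fun ω => P.gHat η i (x ω) (v ω) (z₁ ω) (z₂ ω) (s ω) := by
  have h1 := (hW.meas_h i).comp ((hx.add hv).prodMk (hz₂.prodMk hs))
  have h2 := (hW.meas_h i).comp (hx.prodMk (hz₁.prodMk hs))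
  have h3 : Measurable fun ω => ‖v ω‖⁻¹ • v ω := by fun_prop
  exact (((h1.sub h2).const_mul (n : ℝ)).div_const η).smul h3

lemma MPEC.WellPosed.measurable_lowerIter (hW : P.WellPosed z) (γh Γ : ℝ) {x : Ω → Vec n}
    {z₀ : Ω → Vec p} {ζ : ℕ → Ω → Vec d} (hx : Measurable x) (hz₀ : Measurable z₀) {t : ℕ}
    (hζ : ∀ r < t, Measurable (ζ r)) :
    Measurable fun ω => P.lowerIter γh Γ (x ω) (z₀ ω) (fun r => ζ r ω) t := by
  induction t with
  | zero => exact hz₀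
  | succ t ih =>
    have ih' := ih fun r hr => hζ r (hr.trans (Nat.lt_succ_self t))
    have h1 := hW.meas_F.comp (hx.prodMk (ih'.prodMk (hζ t (Nat.lt_succ_self t))))
    exact hW.meas_proj.comp (hx.prodMk (ih'.sub (h1.const_smul (γh / ((t : ℝ) + Γ)))))

end Comp

lemma MPEC.LowerMonotone.lowerIter_mem {P : MPEC m n p d} {μF LF ν : ℝ}
    (hL : P.LowerMonotone μF LF ν) (γh Γ : ℝ) {x : Vec n} {z₀ : Vec p} (hz₀ : z₀ ∈ P.Z x)
    (ζ : ℕ → Vec d) (t : ℕ) : P.lowerIter γh Γ x z₀ ζ t ∈ P.Z x := by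
  cases t with
  | zero => exact hz₀
  | succ t => exact (hL.isNearest x _).1

namespace Run

lemma measurable_query_of {S : Samples Ω m n d} {R : Run Ω m n p} {k : ℕ} {i : Fin m} (hx : Measurable[S.sig (Source.past k)] (R.x k i))
    (b : Bool) : Measurable[S.sig (Source.knownSet k)] (R.query S k i b) := by
  have h1 : Measurable[S.sig (Source.knownSet k)] (R.x k i) :=
    hx.mono (Samples.sig_mono (Source.past_subset_knownSet k)) le_rfl
  have h2 : Measurable[S.sig (Source.knownSet k)] (S.v i k) :=
    (comap_measurable (S.v i k)).mono
      (Samples.sigma_le_sig (s := Source.dir i k) (le_refl k)) le_rfl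
  cases b with
  | false => exact h1
  | true => exact h1.add h2

variable [mΩ : MeasurableSpace Ω] {μ : Measure Ω} {P : MPEC m n p d}
  {z : Vec n → Vec p} {S : Samples Ω m n d} {W : Matrix (Fin m) (Fin m) ℝ}
  {γ η γh Γ D : ℝ} {R : Run Ω m n p}

lemma measurable_lowerIter_of (hW : P.WellPosed z) (hR : R.IsRun μ P z S W γ η γh Γ D) {k : ℕ}
    {i : Fin m} (hx : Measurable[S.sig (Source.past k)] (R.x k i)) (b : Bool) (t : ℕ) :
    Measurable[S.sig (Source.duringCall k i b t)] fun ω =>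
      P.lowerIter γh Γ (R.query S k i b ω) (R.z₀ k i b ω) (fun r => S.ζ i k b r ω) t := by
  have hle : S.sig (Source.knownSet k) ≤ S.sig (Source.duringCall k i b t) :=
    Samples.sig_mono Set.subset_union_left
  refine hW.measurable_lowerIter γh Γ ((measurable_query_of hx b).mono hle le_rfl)
    (Measurable.mono (hR.start_meas k i b) hle le_rfl) fun r hr => ?_
  exact (comap_measurable (S.ζ i k b r)).mono
    (Samples.sigma_le_sig (s := Source.zeta i k b r) (Or.inr ⟨r, hr, rfl⟩)) le_rfl

lemma measurable_lowerOut_of (hW : P.WellPosed z) (hR : R.IsRun μ P z S W γ η γh Γ D) {k : ℕ}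
    {i : Fin m} (hx : Measurable[S.sig (Source.past k)] (R.x k i)) (b : Bool) :
    Measurable[S.sig (Source.afterCalls k)] (R.lowerOut P S γh Γ k i b) :=
  (measurable_lowerIter_of hW hR hx b _).mono
    (Samples.sig_mono (Source.duringCall_subset_afterCalls k i b _)) le_rfl

lemma measurable_g_of (hW : P.WellPosed z) (hR : R.IsRun μ P z S W γ η γh Γ D) {k : ℕ}
    {i : Fin m} (hx : Measurable[S.sig (Source.past k)] (R.x k i)) :
    Measurable[S.sig (Source.past (k + 1))] (R.g k i) := by
  have e : R.g k i = fun ω => P.gHat η i (R.x k i ω) (S.v i k ω)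
    (R.lowerOut P S γh Γ k i false ω) (R.lowerOut P S γh Γ k i true ω) (S.ξ i k ω) :=
    funext fun ω => hR.g_eq k i ω
  have hle := Samples.sig_mono (S := S) (Source.afterCalls_subset_past k)
  rw [e]
  refine hW.measurable_gHat η i
    (hx.mono (Samples.sig_mono (Source.past_mono (Nat.le_succ k))) le_rfl)
    ((comap_measurable (S.v i k)).mono
      (Samples.sigma_le_sig (s := Source.dir i k) (Nat.lt_succ_self k)) le_rfl)
    ((measurable_lowerOut_of hW hR hx false).mono hle le_rfl)
    ((measurable_lowerOut_of hW hR hx true).mono hle le_rfl)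
    ((comap_measurable (S.ξ i k)).mono
      (Samples.sigma_le_sig (s := Source.xi i k) (Nat.lt_succ_self k)) le_rfl)

/-- The induction is joint because x_{k+1} uses y_k. The index shift is essential: x_k is fixed
before iteration k, while y_k already contains the samples of iteration k through g_k. -/
lemma measurable_x_y (hW : P.WellPosed z) (hR : R.IsRun μ P z S W γ η γh Γ D) (k : ℕ) :
    (∀ i, Measurable[S.sig (Source.past k)] (R.x k i)) ∧
      ∀ i, Measurable[S.sig (Source.past (k + 1))] (R.y k i) := by
  induction k with
  | zero =>
    have hx : ∀ i, Measurable[S.sig (Source.past 0)] (R.x 0 i) := fun i =>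
      (hR.init_meas i).mono (Samples.sigma_le_sig (s := Source.init) trivial) le_rfl
    refine ⟨hx, fun i => ?_⟩
    rw [show R.y 0 i = R.g 0 i from funext fun ω => hR.y_zero i ω]
    exact measurable_g_of hW hR (hx i)
  | succ k ih =>
    have hx : ∀ i, Measurable[S.sig (Source.past (k + 1))] (R.x (k + 1) i) := by
      intro i
      rw [show R.x (k + 1) i = fun ω => mix W (fun j => R.x k j ω) i - γ • R.y k i ω from
        funext fun ω => hR.x_succ k i ω]
      refine Measurable.sub (measurable_mix (fun j => ?_) i) ((ih.2 i).const_smul γ)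
      exact (ih.1 j).mono (Samples.sig_mono (Source.past_mono (Nat.le_succ k))) le_rfl
    refine ⟨hx, fun i => ?_⟩
    rw [show R.y (k + 1) i = fun ω => mix W (fun j => R.y k j ω) i + R.g (k + 1) i ω - R.g k i ω
      from funext fun ω => hR.y_succ k i ω]
    have hle := Samples.sig_mono (S := S) (Source.past_mono (Nat.le_succ (k + 1)))
    refine Measurable.sub (Measurable.add (measurable_mix (fun j => (ih.2 j).mono hle le_rfl) i)
      (measurable_g_of hW hR (hx i))) ?_
    exact (measurable_g_of hW hR (ih.1 i)).mono hle le_rfl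

lemma measurable_x (hW : P.WellPosed z) (hR : R.IsRun μ P z S W γ η γh Γ D) (k : ℕ) (i : Fin m) :
    Measurable[S.sig (Source.past k)] (R.x k i) := (measurable_x_y hW hR k).1 i

lemma measurable_g (hW : P.WellPosed z) (hR : R.IsRun μ P z S W γ η γh Γ D) (k : ℕ) (i : Fin m) :
    Measurable[S.sig (Source.past (k + 1))] (R.g k i) :=
  measurable_g_of hW hR (measurable_x hW hR k i)

lemma measurable_query (hW : P.WellPosed z) (hR : R.IsRun μ P z S W γ η γh Γ D) (k : ℕ)
    (i : Fin m) (b : Bool) : Measurable[S.sig (Source.knownSet k)] (R.query S k i b) :=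
  measurable_query_of (measurable_x hW hR k i) b

lemma measurable_lowerOut (hW : P.WellPosed z) (hR : R.IsRun μ P z S W γ η γh Γ D) (k : ℕ)
    (i : Fin m) (b : Bool) :
    Measurable[S.sig (Source.afterCalls k)] (R.lowerOut P S γh Γ k i b) :=
  measurable_lowerOut_of hW hR (measurable_x hW hR k i) b

/-- The query point and the t-th iterate are independent of the sample ζ_t, so the one-step estimate
can be applied with both frozen. This yields the recursion that defines `saBound`. -/
lemma lintegral_lowerIter_sub_le [IsProbabilityMeasure μ] {μF LF ν : ℝ} (hμF : 0 < μF)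
    (hγh : 0 ≤ γh) (hΓ : 0 < Γ)
    (hW : P.WellPosed z) (hL : P.LowerMonotone μF LF ν)
    (hz : ∀ x, IsVISol (P.Z x) (P.F x) (z x)) (hS : S.IsIID μ P η)
    (hR : R.IsRun μ P z S W γ η γh Γ D) (k : ℕ) (i : Fin m) (b : Bool) (t : ℕ) :
    ∫⁻ ω, ‖P.lowerIter γh Γ (R.query S k i b ω) (R.z₀ k i b ω) (fun r => S.ζ i k b r ω) t
      - z (R.query S k i b ω)‖ₑ ^ 2 ∂μ ≤ ENNReal.ofReal (saBound μF LF ν D γh Γ t) := by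
  have hzm := MPEC.measurable_visol hμF hW hL hz
  induction t with
  | zero =>
    exact (hR.start_dist k i b).trans (ENNReal.ofReal_le_ofReal (le_max_left _ _))
  | succ t ih =>
    set a := γh / ((t : ℝ) + Γ) with ha
    have ha0 : 0 ≤ a := by positivity
    set It := fun ω => P.lowerIter γh Γ (R.query S k i b ω) (R.z₀ k i b ω)
      (fun r => S.ζ i k b r ω) t with hIt
    have hItm : Measurable[S.sig (Source.duringCall k i b t)] It :=
      measurable_lowerIter_of hW hR (measurable_x hW hR k i) b t
    have hqm : Measurable[S.sig (Source.duringCall k i b t)] (R.query S k i b) :=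
      (measurable_query hW hR k i b).mono (Samples.sig_mono Set.subset_union_left) le_rfl
    have hXm : Measurable[S.sig (Source.duringCall k i b t)] fun ω => (R.query S k i b ω, It ω) :=
      hqm.prodMk hItm
    have hind := hS.indepFun (Source.zeta_notMem_duringCall k i b t) hXm
      (comap_measurable (S.ζ i k b t))
    set Φ : (Vec n × Vec p) × Vec d → ℝ≥0∞ := fun r =>
      ‖proj (P.Z r.1.1) (r.1.2 - a • P.Fs r.1.1 r.1.2 r.2) - z r.1.1‖ₑ ^ 2 with hΦ
    have hΦm : Measurable Φ := by
      have h1 : Measurable fun r : (Vec n × Vec p) × Vec d => P.Fs r.1.1 r.1.2 r.2 :=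
        hW.meas_F.comp (f := fun r : (Vec n × Vec p) × Vec d => (r.1.1, r.1.2, r.2))
          (by fun_prop)
      have h2 : Measurable fun r : (Vec n × Vec p) × Vec d =>
          proj (P.Z r.1.1) (r.1.2 - a • P.Fs r.1.1 r.1.2 r.2) :=
        hW.meas_proj.comp (f := fun r : (Vec n × Vec p) × Vec d =>
          (r.1.1, r.1.2 - a • P.Fs r.1.1 r.1.2 r.2)) (by fun_prop)
      have h3 : Measurable fun r : (Vec n × Vec p) × Vec d => z r.1.1 :=
        hzm.comp (by fun_prop)
      exact (h2.sub h3).enorm.pow_const 2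
    have hle := hS.sig_le (Source.duringCall k i b t)
    have hItm' : Measurable It := hItm.mono hle le_rfl
    have hqm' : Measurable (R.query S k i b) := hqm.mono hle le_rfl
    calc _ = ∫⁻ ω, Φ ((R.query S k i b ω, It ω), S.ζ i k b t ω) ∂μ := rfl
      _ = ∫⁻ ω, ∫⁻ s, Φ ((R.query S k i b ω, It ω), s) ∂(μ.map (S.ζ i k b t)) ∂μ :=
        lintegral_comp_prod_of_indepFun (hXm.mono hle le_rfl) (hS.meas_ζ i k b t) hind hΦm
      _ ≤ ∫⁻ ω, (ENNReal.ofReal (max (1 - 2 * a * μF + a ^ 2 * LF ^ 2) 0)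
            * ‖It ω - z (R.query S k i b ω)‖ₑ ^ 2 + ENNReal.ofReal (a ^ 2 * ν ^ 2)) ∂μ := by
        refine lintegral_mono fun ω => ?_
        rw [hS.law_ζ]
        exact P.lintegral_proj_step_le hW hL hz ha0 _
          (hL.lowerIter_mem γh Γ (hR.start_mem k i b ω) _ t)
      _ = ENNReal.ofReal (max (1 - 2 * a * μF + a ^ 2 * LF ^ 2) 0)
            * ∫⁻ ω, ‖It ω - z (R.query S k i b ω)‖ₑ ^ 2 ∂μ + ENNReal.ofReal (a ^ 2 * ν ^ 2) := by
        rw [lintegral_add_right _ measurable_const, lintegral_const_mul]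
        · simp
        · exact (hItm'.sub (hzm.comp hqm')).enorm.pow_const 2
      _ ≤ ENNReal.ofReal (max (1 - 2 * a * μF + a ^ 2 * LF ^ 2) 0)
            * ENNReal.ofReal (saBound μF LF ν D γh Γ t) + ENNReal.ofReal (a ^ 2 * ν ^ 2) := by
        gcongr
      _ = ENNReal.ofReal (saBound μF LF ν D γh Γ (t + 1)) := by
        rw [← ENNReal.ofReal_mul (le_max_right _ _), ← ENNReal.ofReal_add
          (mul_nonneg (le_max_right _ _) (saBound_nonneg _ _ _ _ _ _ _)) (by positivity)]
        rfl

end Run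

end Information

-- Moments and unbiasedness of the zeroth-order estimators.

section Estimators

open Filter Topology
open scoped NNReal

variable {Ω : Type*} {m n p d : ℕ}

lemma memLp_two_of_lintegral_le {Ω E : Type*} {mΩ : MeasurableSpace Ω} {μ : Measure Ω}
    [NormedAddCommGroup E] {f : Ω → E} (hf : AEStronglyMeasurable f μ) {B : ℝ}
    (h : ∫⁻ ω, ‖f ω‖ₑ ^ 2 ∂μ ≤ ENNReal.ofReal B) : MemLp f 2 μ := by
  rw [memLp_two_iff_integrable_sq_norm hf]
  refine ⟨hf.norm.pow 2, ?_⟩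
  rw [hasFiniteIntegral_iff_ofReal (.of_forall fun s => sq_nonneg _)]
  simp_rw [← enorm_sq_eq_ofReal]
  exact h.trans_lt ENNReal.ofReal_lt_top

lemma integral_norm_sq_le_of_lintegral_le {Ω E : Type*} {mΩ : MeasurableSpace Ω} {μ : Measure Ω}
    [NormedAddCommGroup E] {f : Ω → E} (hf : AEStronglyMeasurable f μ) {B : ℝ} (hB : 0 ≤ B)
    (h : ∫⁻ ω, ‖f ω‖ₑ ^ 2 ∂μ ≤ ENNReal.ofReal B) : ∫ ω, ‖f ω‖ ^ 2 ∂μ ≤ B := by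
  rw [integral_eq_lintegral_of_nonneg_ae (.of_forall fun s => sq_nonneg _) (hf.norm.pow 2)]
  simp_rw [← enorm_sq_eq_ofReal]
  exact ENNReal.toReal_le_of_le_ofReal hB h

lemma integral_comp_prod_of_indepFun {Ω α β : Type*} {mΩ : MeasurableSpace Ω}
    [MeasurableSpace α] [MeasurableSpace β] {μ : Measure Ω} [IsFiniteMeasure μ] {X : Ω → α}
    {Y : Ω → β} (hX : Measurable X) (hY : Measurable Y) (h : IndepFun X Y μ)
    {Φ : α × β → ℝ} (hΦ : Measurable Φ) (hi : Integrable (fun ω => Φ (X ω, Y ω)) μ) :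
    ∫ ω, Φ (X ω, Y ω) ∂μ = ∫ ω, ∫ y, Φ (X ω, y) ∂(μ.map Y) ∂μ := by
  have h1 := (indepFun_iff_map_prod_eq_prod_map_map hX.aemeasurable hY.aemeasurable).1 h
  have hm := (hX.prodMk hY).aemeasurable (μ := μ)
  have hi' : Integrable Φ ((μ.map X).prod (μ.map Y)) := by
    rw [← h1, integrable_map_measure hΦ.aestronglyMeasurable hm]
    exact hi
  rw [← integral_map (f := Φ) hm hΦ.aestronglyMeasurable, h1, integral_prod _ hi',
    integral_map hX.aemeasurable]
  exact hΦ.stronglyMeasurable.integral_prod_right'.aestronglyMeasurable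

namespace MPEC

variable {P : MPEC m n p d} {z : Vec n → Vec p} {Lt L : ℝ}

lemma lipschitzWith_fi (hL0 : 0 < L) (hW : P.WellPosed z) (hU : P.UpperLipschitz z Lt L)
    (i : Fin m) : LipschitzWith L.toNNReal (P.fi z i) := by
  have := hW.prob_ξ i
  obtain ⟨l, hlm, hl, hl2⟩ := hU.implicit
  refine LipschitzWith.of_dist_le_mul fun x y => ?_
  rw [Real.coe_toNNReal _ hL0.le, Real.dist_eq, dist_eq_norm]
  have hmem := memLp_two_of_lintegral_le (hlm i).aestronglyMeasurable (hl2 i)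
  have hsq := integral_norm_sq_le_of_lintegral_le (hlm i).aestronglyMeasurable (sq_nonneg L) (hl2 i)
  have hli : Integrable (l i) (P.lawξ i) := hmem.integrable one_le_two
  have hsqi := (memLp_two_iff_integrable_sq_norm (hlm i).aestronglyMeasurable).1 hmem
  have hint : ∫ s, l i s ∂P.lawξ i ≤ L := by
    -- The mean is bounded by the root mean square through l ≤ l²/(2L) + L/2, which is where L > 0
    -- enters.
    have : ∫ s, l i s ∂P.lawξ i ≤ ∫ s, ((2 * L)⁻¹ * ‖l i s‖ ^ 2 + L / 2) ∂P.lawξ i := by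
      refine integral_mono hli ((hsqi.const_mul _).add (integrable_const _)) fun s => ?_
      have h2 : ‖l i s‖ ^ 2 = l i s ^ 2 := by rw [Real.norm_eq_abs, sq_abs]
      simp only [h2]
      have h3 : 0 ≤ (2 * L)⁻¹ * (l i s - L) ^ 2 := by positivity
      have h4 : (2 * L)⁻¹ * (l i s - L) ^ 2 = (2 * L)⁻¹ * l i s ^ 2 + L / 2 - l i s := by
        field_simp; ring
      linarith
    refine this.trans ?_
    rw [integral_add (hsqi.const_mul _) (integrable_const _), integral_const_mul]
    simp only [integral_const, probReal_univ, one_smul]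
    calc (2 * L)⁻¹ * ∫ s, ‖l i s‖ ^ 2 ∂P.lawξ i + L / 2 ≤ (2 * L)⁻¹ * L ^ 2 + L / 2 := by gcongr
      _ = L := by field_simp; ring
  unfold fi
  rw [← integral_sub (hW.int_h i x) (hW.int_h i y)]
  calc |∫ s, (P.h i x (z x) s - P.h i y (z y) s) ∂P.lawξ i|
      ≤ ∫ s, |P.h i x (z x) s - P.h i y (z y) s| ∂P.lawξ i := abs_integral_le_integral_abs
    _ ≤ ∫ s, l i s * ‖x - y‖ ∂P.lawξ i :=
      integral_mono ((hW.int_h i x).sub (hW.int_h i y)).abs (hli.mul_const _) fun s => hl i x y s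
    _ = (∫ s, l i s ∂P.lawξ i) * ‖x - y‖ := integral_mul_const _ _
    _ ≤ L * ‖x - y‖ := by gcongr

lemma lipschitzWith_f (hm : 0 < m) (hL0 : 0 < L) (hW : P.WellPosed z)
    (hU : P.UpperLipschitz z Lt L) : LipschitzWith L.toNNReal (P.f z) := by
  have hm' : (0 : ℝ) < m := Nat.cast_pos.2 hm
  refine LipschitzWith.of_dist_le_mul fun x y => ?_
  rw [Real.dist_eq]
  unfold f
  rw [← mul_sub, ← Finset.sum_sub_distrib, abs_mul, abs_of_pos (inv_pos.2 hm'), inv_mul_le_iff₀ hm']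
  refine (Finset.abs_sum_le_sum_abs _ _).trans ?_
  refine (Finset.sum_le_card_nsmul _ _ (L.toNNReal * dist x y) fun i _ => ?_).trans_eq (by simp)
  have := (lipschitzWith_fi hL0 hW hU i).dist_le_mul x y
  rwa [Real.dist_eq] at this

end MPEC

namespace Run

/-- The gradient estimator evaluated with exact lower-level solutions. -/
def exactG (R : Run Ω m n p) (P : MPEC m n p d) (S : Samples Ω m n d) (z : Vec n → Vec p) (η : ℝ)
    (k : ℕ) (i : Fin m) (ω : Ω) : Vec n :=
  P.gHat η i (R.x k i ω) (S.v i k ω) (z (R.x k i ω)) (z (R.x k i ω + S.v i k ω)) (S.ξ i k ω)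

variable [mΩ : MeasurableSpace Ω] {μ : Measure Ω} {P : MPEC m n p d}
  {z : Vec n → Vec p} {S : Samples Ω m n d} {W : Matrix (Fin m) (Fin m) ℝ}
  {γ η γh Γ D Lt L : ℝ} {R : Run Ω m n p}

lemma ae_norm_v (hη : 0 < η) (hS : S.IsIID μ P η) (k : ℕ) (i : Fin m) :
    ∀ᵐ ω ∂μ, ‖S.v i k ω‖ = η := by
  have h := ae_norm_sphereLaw (n := n) hη.le
  rw [← hS.law_v i k] at h
  exact ae_of_ae_map (hS.meas_v i k).aemeasurable h

lemma measurable_x' (hW : P.WellPosed z) (hS : S.IsIID μ P η)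
    (hR : R.IsRun μ P z S W γ η γh Γ D) (k : ℕ) (i : Fin m) : Measurable (R.x k i) :=
  (measurable_x hW hR k i).mono (hS.sig_le _) le_rfl

lemma measurable_g' (hW : P.WellPosed z) (hS : S.IsIID μ P η)
    (hR : R.IsRun μ P z S W γ η γh Γ D) (k : ℕ) (i : Fin m) : Measurable (R.g k i) :=
  (measurable_g hW hR k i).mono (hS.sig_le _) le_rfl

lemma measurable_exactG (hzm : Measurable z) (hW : P.WellPosed z) (hS : S.IsIID μ P η)
    (hR : R.IsRun μ P z S W γ η γh Γ D) (k : ℕ) (i : Fin m) : Measurable (R.exactG P S z η k i) := by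
  have hx := measurable_x' hW hS hR k i
  have hv := hS.meas_v i k
  exact hW.measurable_gHat η i hx hv (hzm.comp hx) (hzm.comp (hx.add hv)) (hS.meas_ξ i k)

/-- Almost surely ‖v‖ = η, so the implicit Lipschitz bound cancels the division by η and leaves n
times the random modulus. -/
lemma lintegral_exactG_sq_le (hη : 0 < η) (hU : P.UpperLipschitz z Lt L) (hS : S.IsIID μ P η)
    (k : ℕ) (i : Fin m) :
    ∫⁻ ω, ‖R.exactG P S z η k i ω‖ₑ ^ 2 ∂μ ≤ ENNReal.ofReal (n ^ 2 * L ^ 2) := by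
  obtain ⟨l, hlm, hl, hl2⟩ := hU.implicit
  calc ∫⁻ ω, ‖R.exactG P S z η k i ω‖ₑ ^ 2 ∂μ
      ≤ ∫⁻ ω, ENNReal.ofReal (n ^ 2) * ‖l i (S.ξ i k ω)‖ₑ ^ 2 ∂μ := by
        refine lintegral_mono_ae ?_
        filter_upwards [ae_norm_v hη hS k i] with ω hv
        rw [enorm_sq_eq_ofReal, enorm_sq_eq_ofReal, ← ENNReal.ofReal_mul (by positivity), ← mul_pow]
        apply ENNReal.ofReal_le_ofReal
        gcongr
        unfold exactG MPEC.gHat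
        rw [norm_smul, Real.norm_eq_abs, abs_div, abs_mul, Nat.abs_cast, abs_of_pos hη]
        refine (mul_le_of_le_one_right (by positivity) (norm_normalize_le _)).trans ?_
        rw [div_le_iff₀ hη, mul_assoc]
        have h1 := hl i (R.x k i ω + S.v i k ω) (R.x k i ω) (S.ξ i k ω)
        rw [add_sub_cancel_left, hv] at h1
        gcongr
        refine h1.trans ?_
        gcongr
        exact le_abs_self _
    _ = ENNReal.ofReal (n ^ 2) * ∫⁻ s, ‖l i s‖ₑ ^ 2 ∂P.lawξ i := by
        rw [← hS.law_ξ i k, lintegral_map ((hlm i).enorm.pow_const 2) (hS.meas_ξ i k),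
          lintegral_const_mul]
        exact (((hlm i).comp (hS.meas_ξ i k)).enorm.pow_const 2)
    _ ≤ ENNReal.ofReal (n ^ 2) * ENNReal.ofReal (L ^ 2) := by gcongr; exact hl2 i
    _ = _ := by rw [← ENNReal.ofReal_mul (by positivity)]

/-- The lower-level errors do not involve ξ_{i,k}, so the expectation of squared modulus times
squared errors factorizes. The 4 is 2 from squaring a sum of two errors times 2 for the two calls.
-/
lemma lintegral_g_sub_exactG_sq_le [IsProbabilityMeasure μ] {μF LF ν : ℝ} (hμF : 0 < μF)
    (hη : 0 < η) (hγh : 0 ≤ γh) (hΓ : 0 < Γ)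
    (hW : P.WellPosed z) (hL : P.LowerMonotone μF LF ν) (hU : P.UpperLipschitz z Lt L)
    (hz : ∀ x, IsVISol (P.Z x) (P.F x) (z x)) (hS : S.IsIID μ P η)
    (hR : R.IsRun μ P z S W γ η γh Γ D) (k : ℕ) (i : Fin m) :
    ∫⁻ ω, ‖R.g k i ω - R.exactG P S z η k i ω‖ₑ ^ 2 ∂μ
      ≤ ENNReal.ofReal (4 * (n / η) ^ 2 * Lt ^ 2
          * saBound μF LF ν D γh Γ (Nat.sqrt (k + 1) + 1)) := by
  obtain ⟨l, hlm, hl, hl2⟩ := hU.lower_var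
  have hzm := MPEC.measurable_visol hμF hW hL hz
  set e : Bool → Ω → Vec p := fun b ω => R.lowerOut P S γh Γ k i b ω - z (R.query S k i b ω)
    with he
  have hem : ∀ b, Measurable[S.sig (Source.afterCalls k)] (e b) := fun b =>
    (measurable_lowerOut hW hR k i b).sub (hzm.comp ((measurable_query hW hR k i b).mono
      (Samples.sig_mono Set.subset_union_left) le_rfl))
  have hem' : ∀ b, Measurable (e b) := fun b => (hem b).mono (hS.sig_le _) le_rfl
  have heb : ∀ b, ∫⁻ ω, ‖e b ω‖ₑ ^ 2 ∂μ
      ≤ ENNReal.ofReal (saBound μF LF ν D γh Γ (Nat.sqrt (k + 1) + 1)) := fun b =>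
    lintegral_lowerIter_sub_le hμF hγh hΓ hW hL hz hS hR k i b _
  set U : Ω → ℝ≥0∞ := fun ω => ‖e false ω‖ₑ ^ 2 + ‖e true ω‖ₑ ^ 2 with hU'
  have hUm : Measurable[S.sig (Source.afterCalls k)] U :=
    Measurable.add ((measurable_enorm.comp (hem false)).pow_const 2)
      ((measurable_enorm.comp (hem true)).pow_const 2)
  have hVm : Measurable[S.sigma (Source.xi i k)] fun ω => ‖l i (S.ξ i k ω)‖ₑ ^ 2 :=
    (measurable_enorm.comp ((hlm i).comp (comap_measurable (S.ξ i k)))).pow_const 2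
  have hind := hS.indepFun (Source.xi_notMem_afterCalls k i) hUm hVm
  have hUm' : Measurable U := hUm.mono (hS.sig_le _) le_rfl
  have hVm' : Measurable fun ω => ‖l i (S.ξ i k ω)‖ₑ ^ 2 := hVm.mono (hS.sigma_le _) le_rfl
  calc ∫⁻ ω, ‖R.g k i ω - R.exactG P S z η k i ω‖ₑ ^ 2 ∂μ
      ≤ ∫⁻ ω, ENNReal.ofReal (2 * (n / η) ^ 2) * (U * fun ω => ‖l i (S.ξ i k ω)‖ₑ ^ 2) ω ∂μ := by
        refine lintegral_mono fun ω => ?_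
        simp only [hU', Pi.mul_apply]
        simp_rw [enorm_sq_eq_ofReal]
        rw [← ENNReal.ofReal_add (by positivity) (by positivity),
          ← ENNReal.ofReal_mul (by positivity), ← ENNReal.ofReal_mul (by positivity)]
        apply ENNReal.ofReal_le_ofReal
        set a := l i (S.ξ i k ω)
        have h1 := hl i (R.x k i ω) (R.lowerOut P S γh Γ k i false ω) (z (R.x k i ω)) (S.ξ i k ω)
        have h2 := hl i (R.x k i ω + S.v i k ω) (R.lowerOut P S γh Γ k i true ω)
          (z (R.x k i ω + S.v i k ω)) (S.ξ i k ω)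
        have h1' : _ ≤ ‖a‖ * ‖e false ω‖ := h1.trans (by gcongr; exact Real.le_norm_self _; exact le_rfl)
        have h2' : _ ≤ ‖a‖ * ‖e true ω‖ := h2.trans (by gcongr; exact Real.le_norm_self _; exact le_rfl)
        have hkey : ‖R.g k i ω - R.exactG P S z η k i ω‖
            ≤ n / η * (‖a‖ * (‖e false ω‖ + ‖e true ω‖)) := by
          rw [hR.g_eq]
          unfold exactG MPEC.gHat
          rw [← sub_smul, norm_smul, Real.norm_eq_abs, ← sub_div, ← mul_sub, abs_div, abs_mul,
            Nat.abs_cast, abs_of_pos hη]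
          refine (mul_le_of_le_one_right (by positivity) (norm_normalize_le _)).trans ?_
          rw [mul_div_right_comm]
          gcongr
          rw [sub_sub_sub_comm]
          refine (abs_sub _ _).trans ?_
          linarith
        calc ‖R.g k i ω - R.exactG P S z η k i ω‖ ^ 2
            ≤ (n / η * (‖a‖ * (‖e false ω‖ + ‖e true ω‖))) ^ 2 := by gcongr
          _ = (n / η) ^ 2 * ‖a‖ ^ 2 * (‖e false ω‖ + ‖e true ω‖) ^ 2 := by ring
          _ ≤ (n / η) ^ 2 * ‖a‖ ^ 2 * (2 * (‖e false ω‖ ^ 2 + ‖e true ω‖ ^ 2)) := by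
            gcongr
            exact add_sq_le
          _ = _ := by ring
    _ = ENNReal.ofReal (2 * (n / η) ^ 2) * ((∫⁻ ω, U ω ∂μ) * ∫⁻ s, ‖l i s‖ₑ ^ 2 ∂P.lawξ i) := by
        rw [lintegral_const_mul _ (hUm'.mul hVm'),
          lintegral_mul_eq_lintegral_mul_lintegral_of_indepFun hUm' hVm' hind,
          ← hS.law_ξ i k, lintegral_map ((hlm i).enorm.pow_const 2) (hS.meas_ξ i k)]
    _ ≤ ENNReal.ofReal (2 * (n / η) ^ 2)
          * (ENNReal.ofReal (2 * saBound μF LF ν D γh Γ (Nat.sqrt (k + 1) + 1))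
            * ENNReal.ofReal (Lt ^ 2)) := by
        gcongr
        · rw [hU', lintegral_add_left ((hem' false).enorm.pow_const 2), two_mul,
            ENNReal.ofReal_add (saBound_nonneg _ _ _ _ _ _ _) (saBound_nonneg _ _ _ _ _ _ _)]
          exact add_le_add (heb false) (heb true)
        · exact hl2 i
    _ = _ := by
        rw [← ENNReal.ofReal_mul (mul_nonneg two_pos.le (saBound_nonneg _ _ _ _ _ _ _)),
          ← ENNReal.ofReal_mul (by positivity)]
        congr 1; ring

/-- Two freezings: averaging ξ_{i,k} with x and v held fixed turns h̃ᵢ into fᵢ; then averaging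
v_{i,k} with the past held fixed gives the sphere formula for the gradient. Boundedness of the test
vector supplies integrability. -/
lemma integral_inner_exactG [IsProbabilityMeasure μ] (hn : 0 < n) (hη : 0 < η) (hL0 : 0 < L)
    (hzm : Measurable z) (hW : P.WellPosed z) (hU : P.UpperLipschitz z Lt L) (hS : S.IsIID μ P η)
    (hR : R.IsRun μ P z S W γ η γh Γ D) (k : ℕ) (i : Fin m) {a : Ω → Vec n}
    (ha : Measurable[S.sig (Source.past k)] a) {A : ℝ} (hA : ∀ ω, ‖a ω‖ ≤ A) :
    ∫ ω, inner ℝ (a ω) (R.exactG P S z η k i ω) ∂μ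
      = ∫ ω, inner ℝ (a ω) (sphereGrad η (P.fi z i) (R.x k i ω)) ∂μ := by
  have hlip := MPEC.lipschitzWith_fi hL0 hW hU i
  have hpv := isProbabilityMeasure_sphereLaw hn η
  have hxm := measurable_x hW hR k i
  have ha' : Measurable a := ha.mono (hS.sig_le _) le_rfl
  have hxm' := measurable_x' hW hS hR k i
  have hv := hS.meas_v i k
  have hle := Samples.sig_mono (S := S) (Source.past_subset_knownSet k)
  have hvk : Measurable[S.sig (Source.knownSet k)] (S.v i k) :=
    (comap_measurable (S.v i k)).mono
      (Samples.sigma_le_sig (s := Source.dir i k) (le_refl k)) le_rfl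
  have hGm := measurable_exactG hzm hW hS hR k i
  have hG2 := memLp_two_of_lintegral_le hGm.aestronglyMeasurable
    (lintegral_exactG_sq_le (R := R) hη hU hS k i)
  have hint : Integrable (fun ω => inner ℝ (a ω) (R.exactG P S z η k i ω)) μ := by
    have hG1 : Integrable (R.exactG P S z η k i) μ := hG2.integrable one_le_two
    refine (hG1.norm.const_mul A).mono' (ha'.inner hGm).aestronglyMeasurable (.of_forall fun ω => ?_)
    exact (norm_inner_le_norm _ _).trans (by gcongr; exact hA ω)
  set Φ : (Vec n × Vec n × Vec n) × Vec d → ℝ := fun r =>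
    inner ℝ r.1.1 (P.gHat η i r.1.2.1 r.1.2.2 (z r.1.2.1) (z (r.1.2.1 + r.1.2.2)) r.2) with hΦ
  have hΦm : Measurable Φ := by
    refine Measurable.inner (by fun_prop) ?_
    exact hW.measurable_gHat η i (by fun_prop) (by fun_prop) (hzm.comp (by fun_prop))
      (hzm.comp (by fun_prop)) (by fun_prop)
  have hX1 : Measurable[S.sig (Source.knownSet k)] fun ω => (a ω, R.x k i ω, S.v i k ω) :=
    (ha.mono hle le_rfl).prodMk ((hxm.mono hle le_rfl).prodMk hvk)
  have h1 := integral_comp_prod_of_indepFun (hX1.mono (hS.sig_le _) le_rfl) (hS.meas_ξ i k)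
    (hS.indepFun (Source.xi_notMem_knownSet k i) hX1 (comap_measurable (S.ξ i k))) hΦm hint
  have h2 : ∀ ω, ∫ s, Φ ((a ω, R.x k i ω, S.v i k ω), s) ∂(μ.map (S.ξ i k))
      = inner ℝ (a ω) (((n : ℝ) * (P.fi z i (R.x k i ω + S.v i k ω) - P.fi z i (R.x k i ω)) / η)
        • (‖S.v i k ω‖⁻¹ • S.v i k ω)) := by
    intro ω
    rw [hS.law_ξ]
    simp only [hΦ, MPEC.gHat, inner_smul_right]
    rw [integral_mul_const, integral_div, integral_const_mul,
      integral_sub (hW.int_h i _) (hW.int_h i _)]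
    rfl
  set Ψ : (Vec n × Vec n) × Vec n → ℝ := fun r => inner ℝ r.1.1
    (((n : ℝ) * (P.fi z i (r.1.2 + r.2) - P.fi z i r.1.2) / η) • (‖r.2‖⁻¹ • r.2)) with hΨ
  have hfm : Measurable (P.fi z i) := hlip.continuous.measurable
  have hΨm : Measurable Ψ := by
    have e1 : Measurable fun r : (Vec n × Vec n) × Vec n => P.fi z i (r.1.2 + r.2) :=
      hfm.comp (by fun_prop)
    have e2 : Measurable fun r : (Vec n × Vec n) × Vec n => P.fi z i r.1.2 :=
      hfm.comp (by fun_prop)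
    refine Measurable.inner (by fun_prop) ?_
    exact (((e1.sub e2).const_mul _).div_const η).smul (by fun_prop)
  have hX2 : Measurable[S.sig (Source.past k)] fun ω => (a ω, R.x k i ω) := ha.prodMk hxm
  have hint2 : Integrable (fun ω => Ψ ((a ω, R.x k i ω), S.v i k ω)) μ := by
    refine Integrable.of_bound (hΨm.comp ((ha'.prodMk hxm').prodMk hv)).aestronglyMeasurable
      (A * (n * L)) ?_
    filter_upwards [ae_norm_v hη hS k i] with ω hω
    refine (norm_inner_le_norm _ _).trans ?_
    have hA1 := (norm_nonneg _).trans (hA ω)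
    refine mul_le_mul (hA ω) ?_ (norm_nonneg _) hA1
    rw [norm_smul, Real.norm_eq_abs, abs_div, abs_mul, Nat.abs_cast, abs_of_pos hη]
    refine (mul_le_of_le_one_right (by positivity) (norm_normalize_le _)).trans ?_
    rw [div_le_iff₀ hη, mul_assoc]
    gcongr
    have := hlip.dist_le_mul (R.x k i ω + S.v i k ω) (R.x k i ω)
    rwa [Real.dist_eq, dist_eq_norm, add_sub_cancel_left, hω, Real.coe_toNNReal _ hL0.le] at this
  have h3 := integral_comp_prod_of_indepFun (ha'.prodMk hxm') hv
    (hS.indepFun (Source.dir_notMem_past k i) hX2 (comap_measurable (S.v i k))) hΨm hint2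
  have h4 : ∀ ω, ∫ v, Ψ ((a ω, R.x k i ω), v) ∂(μ.map (S.v i k))
      = inner ℝ (a ω) (sphereGrad η (P.fi z i) (R.x k i ω)) := by
    intro ω
    rw [hS.law_v, sphereGrad_eq_sub hn hη hlip _ (P.fi z i (R.x k i ω)), integral_inner]
    have hi := (integrable_sphereGrad hn hη hlip (R.x k i ω)).sub
      (integrable_sphereGrad hn hη (LipschitzWith.const (α := Vec n) (P.fi z i (R.x k i ω)))
        (R.x k i ω))
    refine hi.congr (.of_forall fun v => ?_)
    simp only [Pi.sub_apply]
    rw [← sub_smul]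
    congr 1; ring
  calc _ = ∫ ω, Φ ((a ω, R.x k i ω, S.v i k ω), S.ξ i k ω) ∂μ := rfl
    _ = _ := h1
    _ = ∫ ω, Ψ ((a ω, R.x k i ω), S.v i k ω) ∂μ := integral_congr_ae (.of_forall h2)
    _ = _ := h3
    _ = _ := integral_congr_ae (.of_forall h4)

end Run

end Estimators

-- Deterministic recursions and the averaging argument.

section Recursions

lemma sum_inv_sqrt_le (K : ℕ) : ∑ k ∈ Finset.range K, 1 / √((k : ℝ) + 1) ≤ 2 * √(K : ℝ) := by
  induction K with
  | zero => simp
  | succ K ih =>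
    rw [Finset.sum_range_succ]
    have h1 : 0 < √((K : ℝ) + 1) := Real.sqrt_pos.2 (by positivity)
    have h2 : √(K : ℝ) ^ 2 = K := Real.sq_sqrt (by positivity)
    have h3 : √((K : ℝ) + 1) ^ 2 = K + 1 := Real.sq_sqrt (by positivity)
    have h4 : 1 / √((K : ℝ) + 1) ≤ 2 * √((K : ℝ) + 1) - 2 * √(K : ℝ) := by
      rw [div_le_iff₀ h1]
      nlinarith [sq_nonneg (√((K : ℝ) + 1) - √(K : ℝ))]
    push_cast
    linarith

/-- Keeping the factor q in front of X 0 at every positive time is essential: the missing (1 - q) X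
0 is what later bounds the initial consensus error. -/
lemma contraction_le {q e : ℝ} (hq0 : 0 ≤ q) (hq1 : q < 1) {X : ℕ → ℝ} (hX0 : 0 ≤ X 0)
    (hX : ∀ k, X (k + 1) ≤ q * X k + e) (he : 0 ≤ e) (k : ℕ) :
    X (k + 1) ≤ q * X 0 + e / (1 - q) := by
  have h1 : 0 < 1 - q := by linarith
  have h3 : e / (1 - q) * (1 - q) = e := div_mul_cancel₀ _ h1.ne'
  have h2 : 0 ≤ e / (1 - q) := by positivity
  induction k with
  | zero => exact (hX 0).trans (by nlinarith)
  | succ k ih =>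
    have h4 : q * X (k + 1) ≤ q * (q * X 0 + e / (1 - q)) := by gcongr
    have h5 : q * (q * X 0) ≤ q * X 0 := mul_le_of_le_one_left (by positivity) hq1.le
    nlinarith [hX (k + 1)]

lemma sum_contraction_le {q e : ℝ} (hq1 : q < 1) {X : ℕ → ℝ} (hXn : ∀ k, 0 ≤ X k)
    (hX : ∀ k, X (k + 1) ≤ q * X k + e) (K : ℕ) :
    ∑ k ∈ Finset.range K, X k ≤ (X 0 + K * e) / (1 - q) := by
  rw [le_div_iff₀ (by linarith)]
  have h : (∑ k ∈ Finset.range K, X k) * (1 - q) + X K ≤ X 0 + K * e := by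
    induction K with
    | zero => simp
    | succ K ih =>
      rw [Finset.sum_range_succ]
      push_cast
      nlinarith [hX K]
  linarith [hXn K]

set_option maxHeartbeats 800000 in
/-- The averaging argument behind the convergence rate: consensus errors `X` that contract,
objective values `F` that descend along squared gradients `A` and `B`, and a Lyapunov function
`F + X + Q U` that is bounded below. -/
lemma exists_average_bound {q c₁ c₂ c₃ c₄ c₅ c₆ α C₀ : ℝ} (hq0 : 0 ≤ q) (hq1 : q < 1)
    (h₁ : 0 ≤ c₁) (h₂ : 0 ≤ c₂) (h₃ : 0 ≤ c₃) (h₄ : 0 ≤ c₄) (h₅ : 0 ≤ c₅) (h₆ : 0 ≤ c₆)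
    (hα : 0 ≤ α) (hC₀ : 0 < C₀) :
    ∃ κ, 0 ≤ κ ∧ ∀ (K : ℕ) (γ l Δ : ℝ) (F X A B U : ℕ → ℝ), 1 ≤ K → γ = C₀ / √(K : ℝ) →
      (∀ k, 0 ≤ X k) → (∀ k, 0 ≤ A k) → (∀ k, 0 ≤ B k) → (∀ k, 0 ≤ U k) → (∀ k, U k ≤ c₆) →
      (∀ k, X (k + 1) ≤ q * X k + γ ^ 2 * c₁) →
      (∀ k, F (k + 1) ≤ F k - γ / 4 * A k - γ / 2 * B k + γ * c₂ * X k
        + γ * c₃ * (1 / √((k : ℝ) + 1)) + γ ^ 2 * c₄) →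
      F 1 - F 0 ≤ γ * c₅ →
      (∀ k, l ≤ F k + X k + α * γ * U k) → Δ = F 0 + X 0 + α * γ * U 0 - l →
      0 ≤ Δ ∧
      (K : ℝ)⁻¹ * ∑ k ∈ Finset.range K, A k ≤ κ * (Δ / C₀ + 1) / √(K : ℝ) ∧
      (K : ℝ)⁻¹ * ∑ k ∈ Finset.range K, B k ≤ κ * (Δ / C₀ + 1) / √(K : ℝ) ∧
      (K : ℝ)⁻¹ * ∑ k ∈ Finset.range K, X k ≤ κ * (Δ / C₀ + 1) / √(K : ℝ) := by
  have hq : 0 < 1 - q := by linarith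
  set M := C₀ ^ 2 * c₁ / (1 - q) with hM
  set N := C₀ * c₅ + M + α * C₀ * c₆ with hN
  have hM0 : 0 ≤ M := by positivity
  have hN0 : 0 ≤ N := by positivity
  set k₁ := ((1 + N) / (1 - q) + C₀ ^ 2 * c₁) / (1 - q) with hk₁
  have hk₁0 : 0 ≤ k₁ := by positivity
  set k₂ := 1 + N + C₀ * c₂ * k₁ + 2 * c₃ * C₀ + C₀ ^ 2 * c₄ with hk₂
  have hk₂0 : 0 ≤ k₂ := by positivity
  -- 4k₂/C₀ comes from dividing the weight γ/4 = C₀/(4√K) out of the summed descent, k₁ from the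
  -- consensus sum; the factor 1 + C₀ turns Δ + 1 into Δ/C₀ + 1.
  refine ⟨(4 * k₂ / C₀ + k₁) * (1 + C₀), by positivity, ?_⟩
  intro K γ l Δ F X A B U hK hγ hX0 hA0 hB0 hU0 hU hX hF hF1 hl hΔ
  have hK1 : (1 : ℝ) ≤ K := by exact_mod_cast hK
  have hK0 : (0 : ℝ) < K := by linarith
  set r := √(K : ℝ) with hr
  have hr1 : 1 ≤ r := Real.one_le_sqrt.2 hK1
  have hr0 : 0 < r := by linarith
  have hrr : r ^ 2 = K := Real.sq_sqrt hK0.le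
  have hγ0 : 0 < γ := by rw [hγ]; positivity
  have hγr : γ * r = C₀ := by rw [hγ]; exact div_mul_cancel₀ _ hr0.ne'
  have hγC : γ ≤ C₀ := by nlinarith
  have hγK : γ ^ 2 * K = C₀ ^ 2 := by rw [← hrr, ← mul_pow, hγr]
  have hγ2 : γ ^ 2 ≤ C₀ ^ 2 := by gcongr
  have hΔ0 : 0 ≤ Δ := by rw [hΔ]; linarith [hl 0]
  set Y := Δ + 1 with hY
  have hY1 : 1 ≤ Y := by linarith
  have hXk : ∀ k, X (k + 1) ≤ q * X 0 + M := by
    intro k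
    refine (contraction_le hq0 hq1 (hX0 0) hX (by positivity) k).trans ?_
    rw [hM]; gcongr
  have hQU : ∀ k, α * γ * U k ≤ α * C₀ * c₆ := by
    intro k
    have := hU k
    have := hU0 k
    gcongr
  have hQU0 : ∀ k, 0 ≤ α * γ * U k := fun k => by have := hU0 k; positivity
  have hγ5 : γ * c₅ ≤ C₀ * c₅ := by gcongr
  -- The lower bound at time 1 gives X 0 ≤ Δ + (F 1 - F 0) + X 1 + αγU 1, and X 1 ≤ qX 0 + M;
  -- solving for X 0 bounds it by Δ up to constants.
  have hX0le : X 0 ≤ (1 + N) / (1 - q) * Y := by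
    rw [div_mul_eq_mul_div, le_div_iff₀ hq]
    have e1 := hl 1
    have e2 := hXk 0
    rw [zero_add] at e2
    have e3 := hQU 1
    have e4 := hQU0 0
    have e5 : X 0 * (1 - q) ≤ Δ + N := by rw [hN]; linarith
    have e6 : (1 + N) * Y = Δ + N + 1 + N * Δ := by rw [hY]; ring
    rw [e6]; linarith [mul_nonneg hN0 hΔ0]
  have hsumX : ∑ k ∈ Finset.range K, X k ≤ k₁ * Y := by
    refine (sum_contraction_le hq1 hX0 hX K).trans ?_
    rw [hk₁, div_mul_eq_mul_div]
    gcongr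
    have : (K : ℝ) * (γ ^ 2 * c₁) = C₀ ^ 2 * c₁ := by rw [← hγK]; ring
    rw [this, add_mul]
    have : C₀ ^ 2 * c₁ ≤ C₀ ^ 2 * c₁ * Y := le_mul_of_one_le_right (by positivity) hY1
    linarith
  -- The lower bound at time K; the X K that it brings in is absorbed by X 0, already contained in
  -- Δ.
  have hFK : F 0 - F K ≤ Δ + N := by
    obtain ⟨j, rfl⟩ : ∃ j, K = j + 1 := ⟨K - 1, by omega⟩
    have e1 := hl (j + 1)
    have e2 := hXk j
    have e3 := hQU (j + 1)
    have e4 := hQU0 0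
    have e5 : q * X 0 ≤ X 0 := mul_le_of_le_one_left (hX0 0) hq1.le
    have e6 : 0 ≤ C₀ * c₅ := by positivity
    rw [hN]; linarith
  have htel : γ / 4 * ∑ k ∈ Finset.range K, A k + γ / 2 * ∑ k ∈ Finset.range K, B k
      ≤ F 0 - F K + γ * c₂ * ∑ k ∈ Finset.range K, X k
        + γ * c₃ * ∑ k ∈ Finset.range K, 1 / √((k : ℝ) + 1) + K * (γ ^ 2 * c₄) := by
    have h := Finset.sum_le_sum fun k (_ : k ∈ Finset.range K) => hF k
    have h2 := Finset.sum_range_sub F K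
    rw [Finset.sum_sub_distrib] at h2
    simp only [Finset.sum_add_distrib, Finset.sum_sub_distrib, ← Finset.mul_sum, Finset.sum_const,
      Finset.card_range, nsmul_eq_mul] at h
    linarith
  have hmain : γ / 4 * ∑ k ∈ Finset.range K, A k + γ / 2 * ∑ k ∈ Finset.range K, B k ≤ k₂ * Y := by
    refine htel.trans ?_
    have e1 : γ * c₂ * ∑ k ∈ Finset.range K, X k ≤ C₀ * c₂ * (k₁ * Y) := by
      have := Finset.sum_nonneg fun k (_ : k ∈ Finset.range K) => hX0 k
      gcongr
    have e2 : γ * c₃ * ∑ k ∈ Finset.range K, 1 / √((k : ℝ) + 1) ≤ 2 * c₃ * C₀ := by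
      calc _ ≤ γ * c₃ * (2 * r) := by gcongr; exact sum_inv_sqrt_le K
        _ = 2 * c₃ * (γ * r) := by ring
        _ = _ := by rw [hγr]
    have e3 : (K : ℝ) * (γ ^ 2 * c₄) = C₀ ^ 2 * c₄ := by rw [← hγK]; ring
    have e4 : Δ + N ≤ (1 + N) * Y := by
      have e : (1 + N) * Y = Δ + N + 1 + N * Δ := by rw [hY]; ring
      rw [e]; linarith [mul_nonneg hN0 hΔ0]
    have e5 : 2 * c₃ * C₀ ≤ 2 * c₃ * C₀ * Y := le_mul_of_one_le_right (by positivity) hY1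
    have e6 : C₀ ^ 2 * c₄ ≤ C₀ ^ 2 * c₄ * Y := le_mul_of_one_le_right (by positivity) hY1
    rw [e3, hk₂]
    linarith
  have hYle : Y ≤ (1 + C₀) * (Δ / C₀ + 1) := by
    have e1 : (1 + C₀) * (Δ / C₀ + 1) = Δ / C₀ + 1 + Δ + C₀ := by field_simp; ring
    have e2 : 0 ≤ Δ / C₀ := by positivity
    rw [e1]; linarith
  have hconv : ∀ s : ℝ, γ / 4 * s ≤ k₂ * Y →
      (K : ℝ)⁻¹ * s ≤ (4 * k₂ / C₀ + k₁) * (1 + C₀) * (Δ / C₀ + 1) / r := by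
    intro s hs
    rw [inv_mul_le_iff₀ hK0, ← hrr, mul_div_assoc', le_div_iff₀ hr0]
    have e1 : s * C₀ ≤ 4 * k₂ * Y * r := by
      calc s * C₀ = 4 * r * (γ / 4 * s) := by rw [← hγr]; ring
        _ ≤ 4 * r * (k₂ * Y) := by gcongr
        _ = _ := by ring
    have e2 : s ≤ 4 * k₂ / C₀ * Y * r := by
      rw [div_mul_eq_mul_div, div_mul_eq_mul_div, le_div_iff₀ hC₀]; exact e1
    have e3 : 4 * k₂ / C₀ * Y ≤ (4 * k₂ / C₀ + k₁) * (1 + C₀) * (Δ / C₀ + 1) := by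
      rw [mul_assoc _ (1 + C₀)]
      gcongr
      linarith
    calc s * r ≤ 4 * k₂ / C₀ * Y * r * r := by gcongr
      _ ≤ (4 * k₂ / C₀ + k₁) * (1 + C₀) * (Δ / C₀ + 1) * r * r := by gcongr
      _ = _ := by ring
  have hA := Finset.sum_nonneg fun k (_ : k ∈ Finset.range K) => hA0 k
  have hB := Finset.sum_nonneg fun k (_ : k ∈ Finset.range K) => hB0 k
  refine ⟨hΔ0, hconv _ ?_, hconv _ ?_, ?_⟩
  · linarith [mul_nonneg hγ0.le hB]
  · linarith [mul_nonneg hγ0.le hA, mul_nonneg hγ0.le hB]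
  -- The consensus sum is bounded independently of K, so its average is O(1/K); this is weakened to
  -- 1/√K.
  · rw [inv_mul_le_iff₀ hK0, ← hrr, mul_div_assoc', le_div_iff₀ hr0]
    have e3 : k₁ * Y ≤ (4 * k₂ / C₀ + k₁) * (1 + C₀) * (Δ / C₀ + 1) := by
      rw [mul_assoc _ (1 + C₀)]
      gcongr
      have : 0 ≤ 4 * k₂ / C₀ := by positivity
      linarith
    have e4 : (0 : ℝ) ≤ (4 * k₂ / C₀ + k₁) * (1 + C₀) * (Δ / C₀ + 1) := by positivity
    calc (∑ k ∈ Finset.range K, X k) * r ≤ (4 * k₂ / C₀ + k₁) * (1 + C₀) * (Δ / C₀ + 1) * r := by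
          gcongr; exact hsumX.trans e3
      _ ≤ r ^ 2 * _ := by
        rw [mul_comm]
        gcongr
        nlinarith

end Recursions

-- Gradient tracking in mean square.

section Tracking

variable {Ω : Type*} {mΩ : MeasurableSpace Ω} {μ : Measure Ω} {m n : ℕ}

lemma memLp_mix {W : Matrix (Fin m) (Fin m) ℝ} {x : Fin m → Ω → Vec n}
    (hx : ∀ i, MemLp (x i) 2 μ) (i : Fin m) : MemLp (fun ω => mix W (fun j => x j ω) i) 2 μ :=
  memLp_finsetSum _ fun j _ => (hx j).const_smul (W i j)

lemma memLp_rowMean {x : Fin m → Ω → Vec n} (hx : ∀ i, MemLp (x i) 2 μ) :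
    MemLp (fun ω => rowMean fun i => x i ω) 2 μ :=
  (memLp_finsetSum _ fun j _ => hx j).const_smul (m : ℝ)⁻¹

lemma integrable_norm_sq {f : Ω → Vec n} (hf : MemLp f 2 μ) :
    Integrable (fun ω => ‖f ω‖ ^ 2) μ :=
  (memLp_two_iff_integrable_sq_norm hf.aestronglyMeasurable).1 hf

lemma integrable_consSq {x : Fin m → Ω → Vec n} (hx : ∀ i, MemLp (x i) 2 μ) :
    Integrable (fun ω => consSq fun i => x i ω) μ :=
  integrable_finsetSum _ fun i _ => integrable_norm_sq ((hx i).sub (memLp_rowMean hx))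

lemma integral_consSq_mix_add_le (hm : 0 < m) {W : Matrix (Fin m) (Fin m) ℝ} (hs : W.IsSymm)
    (hd : W ∈ doublyStochastic ℝ (Fin m)) {β : ℝ} (hβ : 0 < β) {x u : Fin m → Ω → Vec n}
    (hx : ∀ i, MemLp (x i) 2 μ) (hu : ∀ i, MemLp (u i) 2 μ) :
    ∫ ω, consSq (fun i => mix W (fun j => x j ω) i + u i ω) ∂μ
      ≤ (1 + β) * secondEigAbs W ^ 2 * ∫ ω, consSq (fun i => x i ω) ∂μ
        + (1 + 1 / β) * ∫ ω, consSq (fun i => u i ω) ∂μ := by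
  rw [← integral_const_mul, ← integral_const_mul, ← integral_add
    ((integrable_consSq hx).const_mul _) ((integrable_consSq hu).const_mul _)]
  refine integral_mono (integrable_consSq fun i => (memLp_mix hx i).add (hu i))
    (((integrable_consSq hx).const_mul _).add ((integrable_consSq hu).const_mul _)) fun ω => ?_
  exact consSq_mix_add_le hm hs hd hβ _ _

lemma integral_consSq_le_sum (hm : 0 < m) {u : Fin m → Ω → Vec n} (hu : ∀ i, MemLp (u i) 2 μ)
    {B : ℝ} (hB : ∀ i, ∫ ω, ‖u i ω‖ ^ 2 ∂μ ≤ B) : ∫ ω, consSq (fun i => u i ω) ∂μ ≤ m * B := by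
  calc ∫ ω, consSq (fun i => u i ω) ∂μ ≤ ∫ ω, ∑ i, ‖u i ω‖ ^ 2 ∂μ :=
        integral_mono (integrable_consSq hu)
          (integrable_finsetSum _ fun i _ => integrable_norm_sq (hu i)) fun ω => consSq_le_sum hm _
    _ = ∑ i, ∫ ω, ‖u i ω‖ ^ 2 ∂μ := integral_finsetSum _ fun i _ => integrable_norm_sq (hu i)
    _ ≤ ∑ _i : Fin m, B := Finset.sum_le_sum fun i _ => hB i
    _ = _ := by simp

lemma integral_norm_add_sq_le {f g : Ω → Vec n} (hf : MemLp f 2 μ) (hg : MemLp g 2 μ) :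
    ∫ ω, ‖f ω + g ω‖ ^ 2 ∂μ ≤ 2 * ∫ ω, ‖f ω‖ ^ 2 ∂μ + 2 * ∫ ω, ‖g ω‖ ^ 2 ∂μ := by
  rw [← integral_const_mul, ← integral_const_mul, ← integral_add
    ((integrable_norm_sq hf).const_mul _) ((integrable_norm_sq hg).const_mul _)]
  refine integral_mono (integrable_norm_sq (hf.add hg))
    (((integrable_norm_sq hf).const_mul _).add ((integrable_norm_sq hg).const_mul _)) fun ω => ?_
  have := norm_add_sq_le_weighted one_pos (f ω) (g ω)
  norm_num at this
  exact this

/-- Gradient tracking with bounded second moments keeps the trackers boundedly far from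
consensus. -/
lemma tracking_bound (hm : 0 < m) {W : Matrix (Fin m) (Fin m) ℝ} (hs : W.IsSymm)
    (hd : W ∈ doublyStochastic ℝ (Fin m)) {β : ℝ} (hβ : 0 < β)
    (hq : (1 + β) * secondEigAbs W ^ 2 < 1) {g y : ℕ → Fin m → Ω → Vec n}
    (hy0 : ∀ i ω, y 0 i ω = g 0 i ω)
    (hy : ∀ k i ω, y (k + 1) i ω = mix W (fun j => y k j ω) i + g (k + 1) i ω - g k i ω)
    (hg : ∀ k i, MemLp (g k i) 2 μ) {B : ℝ} (hB0 : 0 ≤ B)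
    (hB : ∀ k i, ∫ ω, ‖g k i ω‖ ^ 2 ∂μ ≤ B) (k : ℕ) :
    (∀ i, MemLp (y k i) 2 μ) ∧ (∀ ω, rowMean (fun i => y k i ω) = rowMean fun i => g k i ω) ∧
      ∫ ω, consSq (fun i => y k i ω) ∂μ
        ≤ m * B + (1 + 1 / β) * (m * (4 * B)) / (1 - (1 + β) * secondEigAbs W ^ 2) := by
  set q := (1 + β) * secondEigAbs W ^ 2 with hqd
  -- Successive gradients differ in mean square by at most 4B, for each of the m agents.
  set e := (1 + 1 / β) * (m * (4 * B)) with he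
  have hq1 : 0 < 1 - q := by linarith
  have hq0 : 0 ≤ q := by positivity
  have he0 : 0 ≤ e := by positivity
  have hE : e / (1 - q) * (1 - q) = e := div_mul_cancel₀ _ hq1.ne'
  have hE0 : 0 ≤ e / (1 - q) := by positivity
  have hmB : 0 ≤ m * B := by positivity
  induction k with
  | zero =>
    have e0 : ∀ i, y 0 i = g 0 i := fun i => funext fun ω => hy0 i ω
    simp_rw [e0]
    exact ⟨hg 0, fun _ => trivial, (integral_consSq_le_sum hm (hg 0) (hB 0)).trans (by linarith)⟩
  | succ k ih =>
    obtain ⟨ih1, ih2, ih3⟩ := ih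
    have hy' : ∀ i ω, y (k + 1) i ω = mix W (fun j => y k j ω) i + (g (k + 1) i ω - g k i ω) :=
      fun i ω => by rw [hy, add_sub_assoc]
    have hu : ∀ i, MemLp (fun ω => g (k + 1) i ω - g k i ω) 2 μ := fun i =>
      (hg (k + 1) i).sub (hg k i)
    have hub : ∀ i, ∫ ω, ‖g (k + 1) i ω - g k i ω‖ ^ 2 ∂μ ≤ 4 * B := by
      intro i
      have h1 := integral_norm_add_sq_le (hg (k + 1) i) (hg k i).neg
      simp only [Pi.neg_apply, ← sub_eq_add_neg, norm_neg] at h1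
      linarith [hB (k + 1) i, hB k i]
    refine ⟨fun i => ?_, fun ω => ?_, ?_⟩
    · rw [show y (k + 1) i = fun ω => mix W (fun j => y k j ω) i + (g (k + 1) i ω - g k i ω) from
        funext fun ω => hy' i ω]
      exact (memLp_mix ih1 i).add (hu i)
    -- Mixing preserves the row mean, so the mean of the trackers telescopes to the mean of the
    -- current gradients.
    · simp_rw [hy']
      rw [rowMean_add (mix W fun j => y k j ω), rowMean_mix hd, rowMean_sub, ih2]
      abel
    · simp_rw [hy']
      refine (integral_consSq_mix_add_le hm hs hd hβ ih1 hu).trans ?_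
      have h1 := integral_consSq_le_sum hm hu hub
      have h2 : (1 + 1 / β) * ∫ ω, consSq (fun i => g (k + 1) i ω - g k i ω) ∂μ ≤ e := by
        rw [he]; gcongr
      have h3 : q * ∫ ω, consSq (fun i => y k i ω) ∂μ ≤ q * (m * B + e / (1 - q)) := by gcongr
      nlinarith

end Tracking

-- One-step inequalities along a run.

section Descent

open Filter Topology
open scoped NNReal

variable {Ω : Type*} {m n p d : ℕ}

namespace Run

lemma gradRow_eq {P : MPEC m n p d} {z : Vec n → Vec p} {η Lt L : ℝ} {R : Run Ω m n p}
    (hn : 0 < n) (hη : 0 < η) (hL0 : 0 < L) (hW : P.WellPosed z)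
    (hU : P.UpperLipschitz z Lt L) (k : ℕ) (i : Fin m) (ω : Ω) :
    R.gradRow P z η k ω i = sphereGrad η (P.fi z i) (R.x k i ω) :=
  gradient_smooth hn hη (MPEC.lipschitzWith_fi hL0 hW hU i) _

lemma gradSq_eq {P : MPEC m n p d} {z : Vec n → Vec p} {η Lt L : ℝ} {R : Run Ω m n p}
    (hm : 0 < m) (hn : 0 < n) (hη : 0 < η) (hL0 : 0 < L) (hW : P.WellPosed z)
    (hU : P.UpperLipschitz z Lt L) (k : ℕ) (ω : Ω) :
    R.gradSq P z η k ω = ‖sphereGrad η (P.f z) (rowMean fun i => R.x k i ω)‖ ^ 2 := by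
  unfold gradSq
  rw [gradient_smooth hn hη (MPEC.lipschitzWith_f hm hL0 hW hU)]

variable [mΩ : MeasurableSpace Ω] {μ : Measure Ω} {P : MPEC m n p d}
  {z : Vec n → Vec p} {S : Samples Ω m n d} {W : Matrix (Fin m) (Fin m) ℝ}
  {γ η γh Γ D Lt L : ℝ} {R : Run Ω m n p}

lemma exactG_moments (hη : 0 < η) (hzm : Measurable z) (hW : P.WellPosed z)
    (hU : P.UpperLipschitz z Lt L) (hS : S.IsIID μ P η)
    (hR : R.IsRun μ P z S W γ η γh Γ D) (k : ℕ) (i : Fin m) :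
    MemLp (R.exactG P S z η k i) 2 μ ∧ ∫ ω, ‖R.exactG P S z η k i ω‖ ^ 2 ∂μ ≤ n ^ 2 * L ^ 2 := by
  have hm := (measurable_exactG hzm hW hS hR k i).aestronglyMeasurable (μ := μ)
  have h := lintegral_exactG_sq_le (R := R) hη hU hS k i
  exact ⟨memLp_two_of_lintegral_le hm h, integral_norm_sq_le_of_lintegral_le hm (by positivity) h⟩

lemma g_sub_exactG_moments [IsProbabilityMeasure μ] {μF LF ν C : ℝ} (hμF : 0 < μF)
    (hη : 0 < η) (hγh : 0 ≤ γh) (hΓ : 0 < Γ)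
    (hW : P.WellPosed z) (hL : P.LowerMonotone μF LF ν) (hU : P.UpperLipschitz z Lt L)
    (hz : ∀ x, IsVISol (P.Z x) (P.F x) (z x)) (hS : S.IsIID μ P η)
    (hR : R.IsRun μ P z S W γ η γh Γ D) (hC0 : 0 ≤ C)
    (hC : ∀ t : ℕ, saBound μF LF ν D γh Γ t ≤ C / (t + Γ)) (k : ℕ) (i : Fin m) :
    MemLp (fun ω => R.g k i ω - R.exactG P S z η k i ω) 2 μ ∧
      ∫ ω, ‖R.g k i ω - R.exactG P S z η k i ω‖ ^ 2 ∂μ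
        ≤ 4 * (n / η) ^ 2 * Lt ^ 2 * C * (1 / √((k : ℝ) + 1)) := by
  have hzm := MPEC.measurable_visol hμF hW hL hz
  have hm := ((measurable_g' hW hS hR k i).sub
    (measurable_exactG hzm hW hS hR k i)).aestronglyMeasurable (μ := μ)
  have h := lintegral_g_sub_exactG_sq_le hμF hη hγh hΓ hW hL hU hz hS hR k i
  refine ⟨memLp_two_of_lintegral_le hm h, (integral_norm_sq_le_of_lintegral_le hm
    (mul_nonneg (by positivity) (saBound_nonneg _ _ _ _ _ _ _)) h).trans ?_⟩
  have hs : 0 < √((k : ℝ) + 1) := Real.sqrt_pos.2 (by positivity)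
  -- The loop includes t = 0, so it makes ⌊√(k+1)⌋ + 1 ≥ √(k+1) steps.
  have hle : √((k : ℝ) + 1) ≤ ((Nat.sqrt (k + 1) + 1 : ℕ) : ℝ) + Γ := by
    have h1 : ((k : ℝ) + 1) ≤ ((Nat.sqrt (k + 1) + 1 : ℕ) : ℝ) ^ 2 := by
      have := (Nat.lt_succ_sqrt' (k + 1)).le
      exact_mod_cast this
    have := Real.sqrt_le_left (by positivity) |>.2 h1
    linarith
  rw [mul_assoc _ C]
  gcongr
  refine (hC _).trans ?_
  rw [mul_one_div]
  gcongr

lemma g_moments [IsProbabilityMeasure μ] {μF LF ν C : ℝ} (hμF : 0 < μF)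
    (hη : 0 < η) (hγh : 0 ≤ γh) (hΓ : 0 < Γ)
    (hW : P.WellPosed z) (hL : P.LowerMonotone μF LF ν) (hU : P.UpperLipschitz z Lt L)
    (hz : ∀ x, IsVISol (P.Z x) (P.F x) (z x)) (hS : S.IsIID μ P η)
    (hR : R.IsRun μ P z S W γ η γh Γ D) (hC0 : 0 ≤ C)
    (hC : ∀ t : ℕ, saBound μF LF ν D γh Γ t ≤ C / (t + Γ)) (k : ℕ) (i : Fin m) :
    MemLp (R.g k i) 2 μ ∧
      ∫ ω, ‖R.g k i ω‖ ^ 2 ∂μ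
        ≤ 2 * (4 * (n / η) ^ 2 * Lt ^ 2 * C) + 2 * (n ^ 2 * L ^ 2) := by
  have hzm := MPEC.measurable_visol hμF hW hL hz
  obtain ⟨h1, h2⟩ := exactG_moments hη hzm hW hU hS hR k i
  obtain ⟨h3, h4⟩ := g_sub_exactG_moments hμF hη hγh hΓ hW hL hU hz hS hR hC0 hC k i
  have e : ∀ ω, R.g k i ω = (R.g k i ω - R.exactG P S z η k i ω) + R.exactG P S z η k i ω :=
    fun ω => by abel
  have h5 : 1 / √((k : ℝ) + 1) ≤ 1 := by
    rw [div_le_one (Real.sqrt_pos.2 (by positivity))]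
    exact Real.one_le_sqrt.2 (by linarith [(Nat.cast_nonneg k : (0 : ℝ) ≤ k)])
  have h6 : 4 * (n / η) ^ 2 * Lt ^ 2 * C * (1 / √((k : ℝ) + 1)) ≤ 4 * (n / η) ^ 2 * Lt ^ 2 * C :=
    mul_le_of_le_one_right (by positivity) h5
  refine ⟨?_, ?_⟩
  · rw [funext e]
    exact h3.add h1
  · have h7 := integral_norm_add_sq_le h3 h1
    simp_rw [← e] at h7
    linarith

lemma memLp_x (hR : R.IsRun μ P z S W γ η γh Γ D) (hy : ∀ k i, MemLp (R.y k i) 2 μ) (k : ℕ) :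
    ∀ i, MemLp (R.x k i) 2 μ := by
  induction k with
  | zero => exact hR.init_sq
  | succ k ih =>
    intro i
    rw [show R.x (k + 1) i = fun ω => mix W (fun j => R.x k j ω) i - γ • R.y k i ω from
      funext fun ω => hR.x_succ k i ω]
    exact (memLp_mix ih i).sub ((hy k i).const_smul γ)

lemma rowMean_x_succ (hd : W ∈ doublyStochastic ℝ (Fin m)) (hR : R.IsRun μ P z S W γ η γh Γ D)
    (k : ℕ) (ω : Ω) : rowMean (fun i => R.x (k + 1) i ω)
      = rowMean (fun i => R.x k i ω) - γ • rowMean fun i => R.y k i ω := by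
  simp_rw [hR.x_succ]
  rw [rowMean_sub (mix W fun j => R.x k j ω), rowMean_mix hd, rowMean_smul]

/-- The perturbation of the mixing step is -γy, so the bounded disagreement of the trackers enters
with γ². -/
lemma integral_cons_succ_le (hm : 0 < m) (hs : W.IsSymm) (hd : W ∈ doublyStochastic ℝ (Fin m))
    {β : ℝ} (hβ : 0 < β) (hR : R.IsRun μ P z S W γ η γh Γ D)
    (hy : ∀ k i, MemLp (R.y k i) 2 μ) {B : ℝ} (hB : ∀ k, ∫ ω, consSq (fun i => R.y k i ω) ∂μ ≤ B)
    (k : ℕ) :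
    ∫ ω, R.cons (k + 1) ω ∂μ ≤ (1 + β) * secondEigAbs W ^ 2 * ∫ ω, R.cons k ω ∂μ
      + γ ^ 2 * ((1 + 1 / β) * B) := by
  have h := integral_consSq_mix_add_le hm hs hd hβ (memLp_x hR hy k)
    (u := fun i ω => (-γ) • R.y k i ω) (fun i => (hy k i).const_smul (-γ))
  unfold cons
  simp_rw [hR.x_succ, sub_eq_add_neg, ← neg_smul]
  refine h.trans ?_
  simp_rw [consSq_smul (-γ)]
  rw [integral_const_mul, neg_sq]
  have h2 : (1 + 1 / β) * (γ ^ 2 * ∫ ω, consSq (fun i => R.y k i ω) ∂μ)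
      ≤ (1 + 1 / β) * (γ ^ 2 * B) := by gcongr; exact hB k
  linarith

lemma gradRow_moments [IsProbabilityMeasure μ] (hn : 0 < n) (hη : 0 < η) (hL0 : 0 < L)
    (hW : P.WellPosed z) (hU : P.UpperLipschitz z Lt L) (hS : S.IsIID μ P η)
    (hR : R.IsRun μ P z S W γ η γh Γ D) (k : ℕ) (i : Fin m) :
    MemLp (fun ω => R.gradRow P z η k ω i) 2 μ ∧
      ∫ ω, ‖R.gradRow P z η k ω i‖ ^ 2 ∂μ ≤ (n * L) ^ 2 := by
  have hlip := MPEC.lipschitzWith_fi hL0 hW hU i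
  have hb : ∀ ω, ‖R.gradRow P z η k ω i‖ ≤ n * L := by
    intro ω
    rw [gradRow_eq hn hη hL0 hW hU]
    have := norm_sphereGrad_le hn hη hlip (R.x k i ω)
    rwa [Real.coe_toNNReal _ hL0.le] at this
  have hmeas : Measurable fun ω => R.gradRow P z η k ω i := by
    simp_rw [gradRow_eq hn hη hL0 hW hU]
    exact (continuous_sphereGrad hn hη hlip).measurable.comp (measurable_x' hW hS hR k i)
  have hmem : MemLp (fun ω => R.gradRow P z η k ω i) 2 μ :=
    MemLp.of_bound hmeas.aestronglyMeasurable _ (.of_forall hb)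
  refine ⟨hmem, ?_⟩
  calc _ ≤ ∫ _ω, ((n : ℝ) * L) ^ 2 ∂μ :=
        integral_mono (integrable_norm_sq hmem) (integrable_const _) fun ω =>
          pow_le_pow_left₀ (norm_nonneg _) (hb ω) 2
    _ = _ := by simp

/-- The smoothed objective is Lipschitz, hence of linear growth. -/
lemma integrable_smooth_rowMean [IsProbabilityMeasure μ] (hm : 0 < m) (hn : 0 < n) (hη : 0 < η)
    (hL0 : 0 < L) (hW : P.WellPosed z) (hU : P.UpperLipschitz z Lt L) {k : ℕ}
    (hx : ∀ i, MemLp (R.x k i) 2 μ) :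
    Integrable (fun ω => smooth η (P.f z) (rowMean fun i => R.x k i ω)) μ := by
  have hlip := MPEC.lipschitzWith_f hm hL0 hW hU
  have hmean := memLp_rowMean hx
  have hint := (hmean.integrable one_le_two).norm
  refine ((hint.const_mul (n * L)).add (integrable_const |smooth η (P.f z) 0|)).mono'
    ((differentiable_smooth hn hη hlip).continuous.comp_aestronglyMeasurable
      hmean.aestronglyMeasurable) (.of_forall fun ω => ?_)
  have h1 := abs_smooth_sub_le hn hη hlip 0 (rowMean fun i => R.x k i ω)
  rw [sub_zero, Real.coe_toNNReal _ hL0.le] at h1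
  have h2 := abs_sub_abs_le_abs_sub (smooth η (P.f z) (rowMean fun i => R.x k i ω))
    (smooth η (P.f z) 0)
  simp only [Pi.add_apply, Real.norm_eq_abs]
  linarith

lemma integral_norm_rowMean_sq_le (hm : 0 < m) {u : Fin m → Ω → Vec n}
    (hu : ∀ i, MemLp (u i) 2 μ) {B : ℝ} (hB : ∀ i, ∫ ω, ‖u i ω‖ ^ 2 ∂μ ≤ B) :
    ∫ ω, ‖rowMean fun i => u i ω‖ ^ 2 ∂μ ≤ B := by
  have hm' : (0 : ℝ) < m := Nat.cast_pos.2 hm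
  calc ∫ ω, ‖rowMean fun i => u i ω‖ ^ 2 ∂μ ≤ ∫ ω, (m : ℝ)⁻¹ * ∑ i, ‖u i ω‖ ^ 2 ∂μ :=
        integral_mono (integrable_norm_sq (memLp_rowMean hu))
          ((integrable_finsetSum _ fun i _ => integrable_norm_sq (hu i)).const_mul _)
          fun ω => norm_rowMean_sq_le hm _
    _ = (m : ℝ)⁻¹ * ∑ i, ∫ ω, ‖u i ω‖ ^ 2 ∂μ := by
        rw [integral_const_mul, integral_finsetSum _ fun i _ => integrable_norm_sq (hu i)]
    _ ≤ (m : ℝ)⁻¹ * ∑ _i : Fin m, B := by gcongr; exact hB _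
    _ = B := by
        rw [Finset.sum_const, Finset.card_univ, Fintype.card_fin, nsmul_eq_mul,
          inv_mul_cancel_left₀ hm'.ne']

/-- A crude Lipschitz estimate for the first step. Unlike the descent inequality it contains no
consensus term, so it can be used to bound the initial consensus error without circularity. -/
lemma integral_smooth_one_sub_le [IsProbabilityMeasure μ] (hm : 0 < m) (hn : 0 < n) (hη : 0 < η)
    (hγ : 0 ≤ γ) (hL0 : 0 < L) (hd : W ∈ doublyStochastic ℝ (Fin m)) (hW : P.WellPosed z)
    (hU : P.UpperLipschitz z Lt L)
    (hR : R.IsRun μ P z S W γ η γh Γ D) (hg : ∀ k i, MemLp (R.g k i) 2 μ) {B : ℝ}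
    (hB : ∀ k i, ∫ ω, ‖R.g k i ω‖ ^ 2 ∂μ ≤ B) (hy : ∀ k i, MemLp (R.y k i) 2 μ) :
    ∫ ω, smooth η (P.f z) (rowMean fun i => R.x 1 i ω) ∂μ
      - ∫ ω, smooth η (P.f z) (rowMean fun i => R.x 0 i ω) ∂μ ≤ γ * (n * L * (1 + B)) := by
  have hlip := MPEC.lipschitzWith_f hm hL0 hW hU
  have hi : ∀ k, Integrable (fun ω => smooth η (P.f z) (rowMean fun i => R.x k i ω)) μ :=
    fun k => integrable_smooth_rowMean hm hn hη hL0 hW hU (memLp_x hR hy k)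
  have hmg := integrable_norm_sq (memLp_rowMean (hg 0))
  rw [← integral_sub (hi 1) (hi 0)]
  calc _ ≤ ∫ ω, n * L * γ * (1 + ‖rowMean fun i => R.g 0 i ω‖ ^ 2) ∂μ := by
        refine integral_mono ((hi 1).sub (hi 0)) (((integrable_const _).add hmg).const_mul _)
          fun ω => ?_
        have h1 := (le_abs_self _).trans (abs_smooth_sub_le hn hη hlip
          (rowMean fun i => R.x 0 i ω) (rowMean fun i => R.x 1 i ω))
        rw [Real.coe_toNNReal _ hL0.le] at h1
        refine h1.trans ?_
        have h2 := rowMean_x_succ hd hR 0 ω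
        rw [zero_add] at h2
        rw [h2, sub_sub_cancel_left, norm_neg, norm_smul, Real.norm_of_nonneg hγ, ← mul_assoc]
        simp_rw [hR.y_zero]
        gcongr
        nlinarith [sq_nonneg (‖rowMean fun i => R.g 0 i ω‖ - 1)]
    _ = n * L * γ * (1 + ∫ ω, ‖rowMean fun i => R.g 0 i ω‖ ^ 2 ∂μ) := by
        rw [integral_const_mul, integral_add (integrable_const _) hmg]
        simp
    _ ≤ n * L * γ * (1 + B) := by
        gcongr
        exact integral_norm_rowMean_sq_le hm (hg 0) (hB 0)
    _ = _ := by ring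

/-- The mean iterate moves by -γ times the mean estimator. Its exact part is unbiased for the mean b
of the local gradients, which differs from the gradient a at the mean point by the consensus error
only; the rest is lower-level error and a γ² second moment. -/
lemma integral_smooth_succ_le [IsProbabilityMeasure μ] (hm : 0 < m) (hn : 0 < n) (hη : 0 < η)
    (hγ : 0 ≤ γ) (hL0 : 0 < L) (hd : W ∈ doublyStochastic ℝ (Fin m)) (hzm : Measurable z)
    (hW : P.WellPosed z) (hU : P.UpperLipschitz z Lt L) (hS : S.IsIID μ P η)
    (hR : R.IsRun μ P z S W γ η γh Γ D) (hg : ∀ k i, MemLp (R.g k i) 2 μ) {B : ℝ}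
    (hB : ∀ k i, ∫ ω, ‖R.g k i ω‖ ^ 2 ∂μ ≤ B) (hy : ∀ k i, MemLp (R.y k i) 2 μ) {k : ℕ}
    (hymean : ∀ ω, rowMean (fun i => R.y k i ω) = rowMean fun i => R.g k i ω)
    (hyU : ∀ ω, rowMean (R.yU P z W η k ω) = rowMean (R.gradRow P z η k ω)) {E : ℝ}
    (hE : ∀ i, ∫ ω, ‖R.g k i ω - R.exactG P S z η k i ω‖ ^ 2 ∂μ ≤ E) :
    ∫ ω, smooth η (P.f z) (rowMean fun i => R.x (k + 1) i ω) ∂μ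
      ≤ ∫ ω, smooth η (P.f z) (rowMean fun i => R.x k i ω) ∂μ
        - γ / 4 * ∫ ω, R.gradSq P z η k ω ∂μ - γ / 2 * ∫ ω, R.yUMeanSq P z W η k ω ∂μ
        + γ * ((n * L / η) ^ 2 / (2 * m)) * ∫ ω, R.cons k ω ∂μ + γ * E
        + γ ^ 2 * (n * L / η * B) := by
  have hm' : (0 : ℝ) < m := Nat.cast_pos.2 hm
  have hLn : (L.toNNReal : ℝ) = L := Real.coe_toNNReal _ hL0.le
  have hlip := MPEC.lipschitzWith_f hm hL0 hW hU
  have hlipi := MPEC.lipschitzWith_fi hL0 hW hU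
  have hi : ∀ k, Integrable (fun ω => smooth η (P.f z) (rowMean fun i => R.x k i ω)) μ :=
    fun k => integrable_smooth_rowMean hm hn hη hL0 hW hU (memLp_x hR hy k)
  set a : Ω → Vec n := fun ω => sphereGrad η (P.f z) (rowMean fun i => R.x k i ω) with ha
  set G : Fin m → Ω → Vec n := fun i => R.exactG P S z η k i with hG
  set e : Ω → Vec n := fun ω => rowMean fun i => R.g k i ω - G i ω with he
  set b : Ω → Vec n := fun ω => rowMean fun i => sphereGrad η (P.fi z i) (R.x k i ω) with hb
  have hxmeanm : Measurable[S.sig (Source.past k)] fun ω => rowMean fun i => R.x k i ω :=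
    (Finset.measurable_sum _ fun i _ => measurable_x hW hR k i).const_smul (m : ℝ)⁻¹
  have ham : Measurable[S.sig (Source.past k)] a :=
    (continuous_sphereGrad hn hη hlip).measurable.comp hxmeanm
  have hab : ∀ ω, ‖a ω‖ ≤ n * L := fun ω => by
    have := norm_sphereGrad_le hn hη hlip (rowMean fun i => R.x k i ω)
    rwa [hLn] at this
  have ha2 : MemLp a 2 μ :=
    MemLp.of_bound (ham.mono (hS.sig_le _) le_rfl).aestronglyMeasurable _ (.of_forall hab)
  have hG2 : ∀ i, MemLp (G i) 2 μ := fun i => (exactG_moments hη hzm hW hU hS hR k i).1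
  have hgG2 : ∀ i, MemLp (fun ω => R.g k i ω - G i ω) 2 μ := fun i => (hg k i).sub (hG2 i)
  have he2 : MemLp e 2 μ := memLp_rowMean hgG2
  have hgr2 : ∀ i, MemLp (fun ω => sphereGrad η (P.fi z i) (R.x k i ω)) 2 μ := fun i => by
    have := (gradRow_moments hn hη hL0 hW hU hS hR k i).1
    simp_rw [gradRow_eq hn hη hL0 hW hU] at this
    exact this
  have hb2 : MemLp b 2 μ := memLp_rowMean hgr2
  have hgm2 : MemLp (fun ω => rowMean fun i => R.g k i ω) 2 μ := memLp_rowMean (hg k)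
  have hGm2 : MemLp (fun ω => rowMean fun i => G i ω) 2 μ := memLp_rowMean hG2
  have hinner : ∀ {u v : Ω → Vec n}, MemLp u 2 μ → MemLp v 2 μ →
      Integrable (fun ω => inner ℝ (u ω) (v ω)) μ := by
    intro u v hu hv
    refine ((integrable_norm_sq hu).add (integrable_norm_sq hv)).mono'
      (hu.aestronglyMeasurable.inner hv.aestronglyMeasurable) (.of_forall fun ω => ?_)
    refine (norm_inner_le_norm _ _).trans ?_
    simp only [Pi.add_apply]
    nlinarith [sq_nonneg (‖u ω‖ - ‖v ω‖), sq_nonneg ‖u ω‖, sq_nonneg ‖v ω‖]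
  have hexp : ∀ (u : Fin m → Ω → Vec n), (∀ i, MemLp (u i) 2 μ) →
      ∫ ω, inner ℝ (a ω) (rowMean fun i => u i ω) ∂μ
        = (m : ℝ)⁻¹ * ∑ i, ∫ ω, inner ℝ (a ω) (u i ω) ∂μ := by
    intro u hu
    rw [← integral_finsetSum _ fun i _ => hinner ha2 (hu i), ← integral_const_mul]
    refine integral_congr_ae (.of_forall fun ω => ?_)
    simp only [rowMean, inner_smul_right, inner_sum]
  -- Unbiasedness applies because a is bounded and determined by the past.
  have hunb : ∫ ω, inner ℝ (a ω) (rowMean fun i => G i ω) ∂μ = ∫ ω, inner ℝ (a ω) (b ω) ∂μ := by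
    rw [hexp G hG2, hb, hexp _ hgr2]
    congr 1
    exact Finset.sum_congr rfl fun i _ =>
      integral_inner_exactG hn hη hL0 hzm hW hU hS hR k i ham hab
  have hpt : ∀ ω, smooth η (P.f z) (rowMean fun i => R.x (k + 1) i ω)
      ≤ smooth η (P.f z) (rowMean fun i => R.x k i ω)
        - γ * inner ℝ (a ω) (rowMean fun i => G i ω) + γ * (1 / 4 * ‖a ω‖ ^ 2 + ‖e ω‖ ^ 2)
        + n * L / η * γ ^ 2 * ‖rowMean fun i => R.g k i ω‖ ^ 2 := by
    intro ω
    have h1 := smooth_le_add_inner hn hη hlip (rowMean fun i => R.x k i ω)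
      (rowMean fun i => R.x (k + 1) i ω)
    have h2 : rowMean (fun i => R.x (k + 1) i ω) - rowMean (fun i => R.x k i ω)
        = (-γ) • rowMean fun i => R.g k i ω := by
      rw [rowMean_x_succ hd hR, hymean, neg_smul]; abel
    have h3 : rowMean (fun i => R.g k i ω) = rowMean (fun i => G i ω) + e ω := by
      simp only [he]; rw [rowMean_sub]; abel
    rw [h2, norm_smul, mul_pow, norm_neg, Real.norm_eq_abs, sq_abs, hLn, inner_smul_right] at h1
    have h4 : inner ℝ (a ω) (rowMean fun i => R.g k i ω)
        = inner ℝ (a ω) (rowMean fun i => G i ω) + inner ℝ (a ω) (e ω) := by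
      rw [h3, inner_add_right]
    -- Young with weight 1/4: of the γ/2 on ‖a‖² that the polarization below yields, γ/4 remains.
    have h5 : -inner ℝ (a ω) (e ω) ≤ 1 / 4 * ‖a ω‖ ^ 2 + ‖e ω‖ ^ 2 := by
      have := (neg_le_abs _).trans (abs_real_inner_le_norm (a ω) (e ω))
      nlinarith [sq_nonneg (1 / 2 * ‖a ω‖ - ‖e ω‖)]
    have h6 := mul_le_mul_of_nonneg_left h5 hγ
    change _ ≤ _ + -γ * inner ℝ (a ω) _ + _ at h1
    rw [h4] at h1
    linarith
  have hint : ∫ ω, smooth η (P.f z) (rowMean fun i => R.x (k + 1) i ω) ∂μ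
      ≤ ∫ ω, smooth η (P.f z) (rowMean fun i => R.x k i ω) ∂μ
        - γ * ∫ ω, inner ℝ (a ω) (rowMean fun i => G i ω) ∂μ
        + γ * (1 / 4 * ∫ ω, ‖a ω‖ ^ 2 ∂μ + ∫ ω, ‖e ω‖ ^ 2 ∂μ)
        + n * L / η * γ ^ 2 * ∫ ω, ‖rowMean fun i => R.g k i ω‖ ^ 2 ∂μ := by
    have i1 := (hinner ha2 hGm2).const_mul γ
    have i2 := (integrable_norm_sq ha2).const_mul (1 / 4)
    have i3 := integrable_norm_sq he2
    have i4 := (integrable_norm_sq hgm2).const_mul (n * L / η * γ ^ 2)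
    have i5 : Integrable (fun ω => smooth η (P.f z) (rowMean fun i => R.x k i ω)
        - γ * inner ℝ (a ω) (rowMean fun i => G i ω)) μ := (hi k).sub i1
    have i6 : Integrable (fun ω => γ * (1 / 4 * ‖a ω‖ ^ 2 + ‖e ω‖ ^ 2)) μ := (i2.add i3).const_mul γ
    have i7 : Integrable (fun ω => smooth η (P.f z) (rowMean fun i => R.x k i ω)
        - γ * inner ℝ (a ω) (rowMean fun i => G i ω)
        + γ * (1 / 4 * ‖a ω‖ ^ 2 + ‖e ω‖ ^ 2)) μ := i5.add i6
    refine (integral_mono (hi (k + 1)) (i7.add i4) hpt).trans_eq ?_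
    simp only [Pi.add_apply]
    rw [integral_add i7 i4, integral_add i5 i6, integral_sub (hi k) i1, integral_const_mul,
      integral_const_mul, integral_const_mul, integral_add i2 i3, integral_const_mul]
  -- Polarization 2⟨a,b⟩ = ‖a‖² + ‖b‖² - ‖a - b‖², with ‖a - b‖² bounded by consensus error through
  -- the Lipschitz gradients.
  have hcross : 1 / 2 * ∫ ω, ‖a ω‖ ^ 2 ∂μ + 1 / 2 * ∫ ω, ‖b ω‖ ^ 2 ∂μ
      - (n * L / η) ^ 2 / (2 * m) * ∫ ω, R.cons k ω ∂μ ≤ ∫ ω, inner ℝ (a ω) (b ω) ∂μ := by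
    have i1 := (integrable_norm_sq ha2).const_mul (1 / 2)
    have i2 := (integrable_norm_sq hb2).const_mul (1 / 2)
    have i3 : Integrable (fun ω => (n * L / η) ^ 2 / (2 * m) * R.cons k ω) μ :=
      (integrable_consSq (memLp_x hR hy k)).const_mul _
    have i4 : Integrable (fun ω => 1 / 2 * ‖a ω‖ ^ 2 + 1 / 2 * ‖b ω‖ ^ 2) μ := i1.add i2
    rw [← integral_const_mul, ← integral_const_mul, ← integral_const_mul, ← integral_add i1 i2,
      ← integral_sub i4 i3]
    refine integral_mono (i4.sub i3) (hinner ha2 hb2) fun ω => ?_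
    have h1 : a ω - b ω = rowMean fun i => sphereGrad η (P.fi z i) (rowMean fun i => R.x k i ω)
        - sphereGrad η (P.fi z i) (R.x k i ω) := by
      rw [rowMean_sub]
      congr 1
      exact sphereGrad_mean hn hη hlipi _
    have h2 : ‖a ω - b ω‖ ^ 2 ≤ (n * L / η) ^ 2 / m * R.cons k ω := by
      rw [h1]
      refine (norm_rowMean_sq_le hm _).trans ?_
      unfold cons consSq
      rw [Finset.mul_sum, Finset.mul_sum]
      refine Finset.sum_le_sum fun i _ => ?_
      have h3 := norm_sphereGrad_sub_le hn hη (hlipi i) (rowMean fun i => R.x k i ω) (R.x k i ω)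
      rw [hLn, norm_sub_rev _ (R.x k i ω)] at h3
      calc _ ≤ (m : ℝ)⁻¹ * (n * L / η * ‖R.x k i ω - rowMean fun i => R.x k i ω‖) ^ 2 := by gcongr
        _ = _ := by ring
    have h4 := norm_sub_sq_real (a ω) (b ω)
    have h5 : (n * L / η) ^ 2 / (2 * m) * R.cons k ω
        = 1 / 2 * ((n * L / η) ^ 2 / m * R.cons k ω) := by field_simp
    simp only [h5]
    linarith
  have hA : ∫ ω, R.gradSq P z η k ω ∂μ = ∫ ω, ‖a ω‖ ^ 2 ∂μ :=
    integral_congr_ae (.of_forall fun ω => gradSq_eq hm hn hη hL0 hW hU k ω)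
  have hBU : ∫ ω, R.yUMeanSq P z W η k ω ∂μ = ∫ ω, ‖b ω‖ ^ 2 ∂μ := by
    refine integral_congr_ae (.of_forall fun ω => ?_)
    simp only [yUMeanSq, hyU, hb]
    congr 3
    exact funext fun i => gradRow_eq hn hη hL0 hW hU k i ω
  have hee := integral_norm_rowMean_sq_le hm hgG2 hE
  have hgg := integral_norm_rowMean_sq_le hm (hg k) (hB k)
  rw [hA, hBU]
  rw [hunb] at hint
  have f1 := mul_le_mul_of_nonneg_left hcross hγ
  have f2 := mul_le_mul_of_nonneg_left hee hγ
  have f3 : n * L / η * γ ^ 2 * ∫ ω, ‖rowMean fun i => R.g k i ω‖ ^ 2 ∂μ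
      ≤ n * L / η * γ ^ 2 * B := by gcongr
  linarith

end Run

end Descent

end

-- Assembly of the convergence rate.

theorem theorem1 (m n : ℕ) (hm : 0 < m) (hn : 0 < n) (c : Consts) (hc : c.Admissible) :
    0 < c.C₀ m n ∧
    (∀ K : ℕ, c.LargeK m n K → 0 ≤ c.C₁ m n K ∧ 0 ≤ c.C₂ m n K) ∧
    ∃ κ : ℝ, 0 ≤ κ ∧
      ∀ (p d : ℕ) (P : MPEC m n p d) (z : Vec n → Vec p)
        (W : Matrix (Fin m) (Fin m) ℝ)
        (Ω : Type*) [MeasurableSpace Ω] (μ : Measure Ω) [IsProbabilityMeasure μ]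
        (S : Samples Ω m n d),
        (∀ x, IsVISol (P.Z x) (P.F x) (z x)) →
        P.WellPosed z →
        W.IsSymm → W ∈ doublyStochastic ℝ (Fin m) → secondEigAbs W = c.ρ →
        S.IsIID μ P c.η →
        P.UpperLipschitz z c.Lt c.L →
        P.LowerMonotone c.μF c.LF c.ν →
        (∀ i, Differentiable ℝ (smooth c.η (P.fi z i))) ∧
        Differentiable ℝ (smooth c.η (P.f z)) ∧
        ∀ K : ℕ, c.LargeK m n K →
        ∀ R : Run Ω m n p, R.IsRun μ P z S W (c.γ m n K) c.η c.γh c.Γ c.D →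
        ∀ Llow : ℝ, (∀ k, Llow ≤ R.lyap μ P z W c.η (c.Q m n K) k) →
          (∀ k, Integrable (R.yUMeanSq P z W c.η k) μ ∧
            Integrable (R.gradSq P z c.η k) μ ∧ Integrable (R.cons k) μ) ∧
          c.C₁ m n K * avgE μ K (R.yUMeanSq P z W c.η)
              + c.C₂ m n K / c.C₀ m n * avgE μ K R.cons
            ≤ κ * ((R.lyap μ P z W c.η (c.Q m n K) 0 - Llow) / c.C₀ m n + 1) / √(K : ℝ)
              + κ * c.θ n / K ∧
          c.C₁ m n K * avgE μ K (R.gradSq P z c.η)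
              + c.C₂ m n K / c.C₀ m n * avgE μ K R.cons
            ≤ κ * ((R.lyap μ P z W c.η (c.Q m n K) 0 - Llow) / c.C₀ m n + 1) / √(K : ℝ)
              + κ * c.θ n / K ∧
          ∀ ε : ℝ, 0 < ε →
            κ * ((R.lyap μ P z W c.η (c.Q m n K) 0 - Llow) / c.C₀ m n + 1) ^ 2 / ε ^ 2 ≤ K →
            avgE μ K (R.yUMeanSq P z W c.η) ≤ ε ∧ avgE μ K (R.gradSq P z c.η) ≤ ε ∧
              avgE μ K R.cons ≤ ε := by
  have hη := hc.η_pos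
  have hL0 := hc.L_pos
  have hβ := hc.β_pos
  have hμF := hc.μF_pos
  have hΓ := hc.Γ_pos
  have hγh : 0 ≤ c.γh := by
    have := hc.γh_gt
    have h1 : 0 < 1 / (2 * c.μF) := by positivity
    linarith
  have hC₀ := Consts.C₀_pos hm hn hc
  have hm' : (0 : ℝ) < m := Nat.cast_pos.2 hm
  refine ⟨hC₀, fun K hK => ⟨Consts.C₁_nonneg hm hn hc hK, Consts.C₂_nonneg hm hn hc hK⟩, ?_⟩
  obtain ⟨C, hC0, hC⟩ := exists_saBound_le (LF := c.LF) (ν := c.ν) (D := c.D) hμF hc.γh_gt hΓ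
  set q := (1 + c.β) * c.ρ ^ 2 with hq
  have hq0 : 0 ≤ q := by positivity
  have hq1 : q < 1 := hc.β_ρ
  have hq1' : 0 < 1 - q := by linarith
  set E₀ := 4 * (n / c.η) ^ 2 * c.Lt ^ 2 * C with hE₀
  set B := 2 * E₀ + 2 * (n ^ 2 * c.L ^ 2) with hB
  set By := m * B + (1 + 1 / c.β) * (m * (4 * B)) / (1 - q) with hBy
  set Bu := m * (n * c.L) ^ 2 + (1 + 1 / c.β) * (m * (4 * (n * c.L) ^ 2)) / (1 - q) with hBu
  have hE₀0 : 0 ≤ E₀ := by positivity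
  have hB0 : 0 ≤ B := by positivity
  have hBy0 : 0 ≤ By := by positivity
  have hBu0 : 0 ≤ Bu := by positivity
  -- None of the constants involves K, γ or the run, so κ is uniform as required.
  obtain ⟨κ, hκ0, hκ⟩ := exists_average_bound (c₁ := (1 + 1 / c.β) * By)
    (c₂ := (n * c.L / c.η) ^ 2 / (2 * m)) (c₃ := E₀) (c₄ := n * c.L / c.η * B)
    (c₅ := n * c.L * (1 + B)) (c₆ := Bu) hq0 hq1 (by positivity) (by positivity) hE₀0
    (by positivity) (by positivity) hBu0 hc.α_pos.le hC₀
  set d₂ := (1 + 2 * c.L * n / (m * c.η) * c.C₀ m n) / c.C₀ m n with hd₂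
  have hd₂0 : 0 ≤ d₂ := by positivity
  -- κ² serves the complexity claim, where κT/√K ≤ ε needs K ≥ κ²T²/ε²; (2 + d₂)κ serves the
  -- weighted sums, with C₁ ≤ 2 and C₂/C₀ ≤ d₂.
  refine ⟨κ ^ 2 + (2 + d₂) * κ, by positivity, ?_⟩
  intro p d P z W Ω mΩ μ hμ S hz hW hsymm hds hρ hS hU hL
  have hlip := MPEC.lipschitzWith_f hm hL0 hW hU
  refine ⟨fun i => differentiable_smooth hn hη (MPEC.lipschitzWith_fi hL0 hW hU i),
    differentiable_smooth hn hη hlip, ?_⟩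
  intro K hK R hR Llow hLlow
  have hzm := MPEC.measurable_visol hμF hW hL hz
  have hγ0 := Consts.γ_pos hm hn hc hK.1
  have hg := Run.g_moments hμF hη hγh hΓ hW hL hU hz hS hR hC0 hC
  have hqW : (1 + c.β) * secondEigAbs W ^ 2 = q := by rw [hρ]
  have hytrack := tracking_bound hm hsymm hds hβ (by rw [hqW]; exact hq1) hR.y_zero hR.y_succ
    (fun k i => (hg k i).1) hB0 (fun k i => (hg k i).2)
  have hy : ∀ k i, MemLp (R.y k i) 2 μ := fun k => (hytrack k).1
  have hgr := Run.gradRow_moments hn hη hL0 hW hU hS hR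
  -- The same tracking estimate, now for the auxiliary trackers driven by exact gradients: it bounds
  -- the third Lyapunov term uniformly in k.
  have hutrack := tracking_bound (μ := μ) (g := fun k i ω => R.gradRow P z c.η k ω i)
    (y := fun k i ω => R.yU P z W c.η k ω i) hm hsymm hds hβ (by rw [hqW]; exact hq1)
    (fun i ω => rfl) (fun k i ω => rfl) (fun k i => (hgr k i).1) (sq_nonneg _)
    (fun k i => (hgr k i).2)
  rw [hqW] at hytrack hutrack
  have hx := Run.memLp_x hR hy
  have hXi : ∀ k, Integrable (R.cons k) μ := fun k => integrable_consSq (hx k)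
  have hBi : ∀ k, Integrable (R.yUMeanSq P z W c.η k) μ := fun k =>
    integrable_norm_sq (memLp_rowMean (hutrack k).1)
  have hAi : ∀ k, Integrable (R.gradSq P z c.η k) μ := by
    intro k
    have h1 : MemLp (fun ω => sphereGrad c.η (P.f z) (rowMean fun i => R.x k i ω)) 2 μ :=
      MemLp.of_bound ((continuous_sphereGrad hn hη hlip).comp_aestronglyMeasurable
        (memLp_rowMean (hx k)).aestronglyMeasurable) (n * c.L.toNNReal)
        (.of_forall fun ω => norm_sphereGrad_le hn hη hlip _)
    refine (integrable_norm_sq h1).congr (.of_forall fun ω => ?_)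
    exact (Run.gradSq_eq hm hn hη hL0 hW hU k ω).symm
  refine ⟨fun k => ⟨hBi k, hAi k, hXi k⟩, ?_⟩
  obtain ⟨hΔ, hA, hY, hX⟩ := hκ K (c.γ m n K) Llow
    (R.lyap μ P z W c.η (c.Q m n K) 0 - Llow)
    (fun k => ∫ ω, smooth c.η (P.f z) (rowMean fun i => R.x k i ω) ∂μ)
    (fun k => ∫ ω, R.cons k ω ∂μ) (fun k => ∫ ω, R.gradSq P z c.η k ω ∂μ)
    (fun k => ∫ ω, R.yUMeanSq P z W c.η k ω ∂μ)
    (fun k => ∫ ω, consSq (R.yU P z W c.η k ω) ∂μ) hK.1 rfl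
    (fun k => integral_nonneg fun ω => consSq_nonneg _)
    (fun k => integral_nonneg fun ω => sq_nonneg _)
    (fun k => integral_nonneg fun ω => sq_nonneg _)
    (fun k => integral_nonneg fun ω => consSq_nonneg _)
    (fun k => (hutrack k).2.2)
    (fun k => by
      have := Run.integral_cons_succ_le hm hsymm hds hβ hR hy (fun k => (hytrack k).2.2) k
      rwa [hqW] at this)
    (fun k => Run.integral_smooth_succ_le hm hn hη hγ0.le hL0 hds hzm hW hU hS hR
      (fun k i => (hg k i).1) (fun k i => (hg k i).2) hy (hytrack k).2.1 (hutrack k).2.1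
      (fun i => (Run.g_sub_exactG_moments hμF hη hγh hΓ hW hL hU hz hS hR hC0 hC k i).2)
      |>.trans_eq (by ring))
    (Run.integral_smooth_one_sub_le hm hn hη hγ0.le hL0 hds hW hU hR
      (fun k i => (hg k i).1) (fun k i => (hg k i).2) hy)
    hLlow rfl
  change avgE μ K (R.gradSq P z c.η) ≤ _ at hA
  change avgE μ K (R.yUMeanSq P z W c.η) ≤ _ at hY
  change avgE μ K R.cons ≤ _ at hX
  set Δ := R.lyap μ P z W c.η (c.Q m n K) 0 - Llow
  have hK1 : (1 : ℝ) ≤ K := by exact_mod_cast hK.1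
  have hK0 : (0 : ℝ) < K := by linarith
  set r := √(K : ℝ) with hr
  have hr0 : 0 < r := Real.sqrt_pos.2 hK0
  have hrr : r ^ 2 = K := Real.sq_sqrt hK0.le
  set T := Δ / c.C₀ m n + 1 with hT
  have hT0 : 0 ≤ T := by positivity
  have hX0 : 0 ≤ avgE μ K R.cons := mul_nonneg (by positivity)
    (Finset.sum_nonneg fun k _ => integral_nonneg fun ω => consSq_nonneg _)
  have hC1n := Consts.C₁_nonneg hm hn hc hK
  have hC1 := Consts.C₁_le hm hn hc hK.1
  have hC2 : c.C₂ m n K / c.C₀ m n ≤ d₂ := by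
    rw [hd₂]
    exact div_le_div_of_nonneg_right (Consts.C₂_le hm hn hc hK.1) hC₀.le
  have hθ := Consts.θ_nonneg (n := n) hc
  have hcomb : ∀ s : ℝ, s ≤ κ * T / r →
      c.C₁ m n K * s + c.C₂ m n K / c.C₀ m n * avgE μ K R.cons
        ≤ (κ ^ 2 + (2 + d₂) * κ) * T / r + (κ ^ 2 + (2 + d₂) * κ) * c.θ n / K := by
    intro s hs
    have h0 : 0 ≤ κ * T / r := by positivity
    have e1 : c.C₁ m n K * s ≤ 2 * (κ * T / r) :=
      (mul_le_mul_of_nonneg_left hs hC1n).trans (mul_le_mul_of_nonneg_right hC1 h0)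
    have e2 : c.C₂ m n K / c.C₀ m n * avgE μ K R.cons ≤ d₂ * (κ * T / r) :=
      (mul_le_mul_of_nonneg_right hC2 hX0).trans (mul_le_mul_of_nonneg_left hX hd₂0)
    have e3 : 0 ≤ (κ ^ 2 + (2 + d₂) * κ) * c.θ n / K := by positivity
    have e4 : 0 ≤ κ ^ 2 * T / r := by positivity
    have e5 : (κ ^ 2 + (2 + d₂) * κ) * T / r
        = κ ^ 2 * T / r + 2 * (κ * T / r) + d₂ * (κ * T / r) := by ring
    linarith
  refine ⟨hcomb _ hY, hcomb _ hA, fun ε hε hKε => ?_⟩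
  have hle : κ * T / r ≤ ε := by
    rw [div_le_iff₀ hr0]
    rw [div_le_iff₀ (by positivity), ← hrr] at hKε
    have e1 : (κ * T) ^ 2 ≤ (ε * r) ^ 2 := by
      have e2 : 0 ≤ (2 + d₂) * κ * T ^ 2 := by positivity
      have e3 : (κ ^ 2 + (2 + d₂) * κ) * T ^ 2 = (κ * T) ^ 2 + (2 + d₂) * κ * T ^ 2 := by ring
      have e4 : (ε * r) ^ 2 = r ^ 2 * ε ^ 2 := by ring
      linarith
    exact (sq_le_sq₀ (by positivity) (by positivity)).1 e1
  exact ⟨hY.trans hle, hA.trans hle, hX.trans hle⟩
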